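/- Let $d\ge 2$ and let $\mathcal R=\partial_1/|D|$ be the Riesz transform on $\mathbb R^d$, i.e. the Fourier multiplier with symbol $i\xi_1/|\xi|$. Fix a Littlewood–Paley partition of unity: radial nonnegative functions $\chi\in C_c^\infty(\mathbb R^d)$, $\varphi\in C_c^\infty(\mathbb R^d\setminus\{0\})$ with $\chi(\xi)+\sum_{q\ge 0}\varphi(2^{-q}\xi)=1$ for all $\xi$, $\operatorname{supp}\chi\cap\operatorname{supp}\varphi(2^{-q}\cdot)=\varnothing$ for $q\ge1$, and $\operatorname{supp}\varphi(2^{-j}\cdot)\cap\operatorname{supp}\varphi(2^{-k}\cdot)=\varnothing$ for $|j-k|\ge2$. For a tempered distribution $u$ put $\Delta_{-1}u=\chi(D)u$, $\Delta_q u=\varphi(2^{-q}D)u$ for $q\ge 0$, $$\|u\|_{B^s_{p,r}}=\Big\|\big(2^{qs}\|\Delta_q u\|_{L^p}\big)_{q\ge-1}\Big\|_{\ell^r},\qquad \|u\|_{H^s}=\big\|(1+|D|^2)^{s/2}u\big\|_{L^2}.$$ Norms take values in $[0,\infty]$. Let $v\colon\mathbb R^d\to\mathbb R^d$ be a $C^\infty$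 divergence-free vector field in $L^2$ and let $\theta\colon\mathbb R^d\to\mathbb R$ be a $C^\infty$ function in $L^2$. Then the commutators $[\mathcal R,v]\theta=\mathcal R(v\theta)-v\,\mathcal R\theta$ (componentwise) and $[\mathcal R,v\cdot\nabla]\theta=\mathcal R(v\cdot\nabla\theta)-v\cdot\nabla(\mathcal R\theta)$ are well defined tempered distributions, and the following hold. (1) For every $s\in(0,1)$, $$\|[\mathcal R,v]\theta\|_{H^s}\le C\big(\|\nabla v\|_{L^2}\|\theta\|_{B^{s-1}_{\infty,2}}+\|v\|_{L^2}\|\theta\|_{L^2}\big),$$ where $C$ depends only on $d,\chi,\varphi,s$. (2) For every $p\in[2,\infty]$, $$\|[\mathcal R,v\cdot\nabla]\theta\|_{B^0_{p,\infty}}\le C\big(\|\nabla v\|_{L^p}\|\theta\|_{B^0_{\infty,\infty}}+\|v\|_{L^2}\|\theta\|_{L^2}\big),$$ where $C$ depends only on $d,\chi,\varphi,p$. -/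

import Mathlib

open MeasureTheory SchwartzMap FourierTransform LineDeriv
open scoped ENNReal NNReal ContDiff

noncomputable section

namespace RieszCommutator

/-- The Euclidean space `ℝ^d`. -/
abbrev Space (d : ℕ) : Type := EuclideanSpace ℝ (Fin d)

/-- The tempered distributions on `ℝ^d`. -/
abbrev Temp (d : ℕ) : Type := 𝓢'(Space d, ℂ)

/-! ### Tempered distributions that are functions -/

/-- The tempered distribution `u` is (given by) the locally integrable function `g`. Test functions
with compact support suffice, since these are dense in the Schwartz space. -/
def IsFunction {d : ℕ} (u : Temp d) (g : Space d → ℂ) : Prop :=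
  LocallyIntegrable g volume ∧
    ∀ φ : 𝓢(Space d, ℂ), HasCompactSupport (φ : Space d → ℂ) → u φ = ∫ x, φ x * g x

/-- The `L^p` norm of a tempered distribution: it is `‖g‖_{L^p}` if `u` is a function `g`
(which is then unique almost everywhere), and `∞` if `u` is not a function. -/
def distLpNorm {d : ℕ} (p : ℝ≥0∞) (u : Temp d) : ℝ≥0∞ :=
  ⨅ (g : Space d → ℂ) (_ : IsFunction u g), eLpNorm g p volume

/-- A real-valued function in `L²`, as a tempered distribution. -/
def ofL2 {d : ℕ} (f : Space d → ℝ) (hf : MemLp f 2 volume) : Temp d :=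
  Lp.toTemperedDistribution (MemLp.toLp (fun x => (f x : ℂ)) hf.ofReal)

/-! ### Fourier multipliers, Sobolev and Besov norms -/

/-- The Fourier multiplier `m(D)` with the smooth real symbol `m` (of temperate growth), where
`D = -i∂`, that is, `m(D) e^{i x·ξ} = m(ξ) e^{i x·ξ}`. The factor `2π` accounts for the
normalization `e^{-2πi x·ξ}` in the Fourier transform of Mathlib. -/
def multiplier {d : ℕ} (m : Space d → ℝ) (u : Temp d) : Temp d :=
  TemperedDistribution.fourierMultiplierCLM ℂ
    (fun ξ : Space d => ((m ((2 * Real.pi) • ξ) : ℝ) : ℂ)) u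

/-- The norm of the inhomogeneous Sobolev space `H^s`, that is `‖(1 + |D|²)^{s/2} u‖_{L²}`. -/
def sobolevNorm {d : ℕ} (s : ℝ) (u : Temp d) : ℝ≥0∞ :=
  distLpNorm 2 (multiplier (fun ξ => (1 + ‖ξ‖ ^ 2) ^ (s / 2)) u)

/-- The `H^s` norm of a vector-valued tempered distribution. -/
def vectorSobolevNorm {d : ℕ} (s : ℝ) (w : Fin d → Temp d) : ℝ≥0∞ :=
  (∑ i, sobolevNorm s (w i) ^ 2) ^ (1 / 2 : ℝ)

/-- A Littlewood-Paley dyadic partition of unity `(χ, φ)` on `ℝ^d`. -/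
structure DyadicPartition (d : ℕ) where
  /-- the low frequency cut-off -/
  χ : Space d → ℝ
  /-- the cut-off to a ring -/
  φ : Space d → ℝ
  smooth_χ : ContDiff ℝ ∞ χ
  smooth_φ : ContDiff ℝ ∞ φ
  compact_χ : HasCompactSupport χ
  compact_φ : HasCompactSupport φ
  zero_notMem : (0 : Space d) ∉ tsupport φ
  radial_χ : ∀ ξ η : Space d, ‖ξ‖ = ‖η‖ → χ ξ = χ η
  radial_φ : ∀ ξ η : Space d, ‖ξ‖ = ‖η‖ → φ ξ = φ η
  nonneg_χ : ∀ ξ, 0 ≤ χ ξ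
  nonneg_φ : ∀ ξ, 0 ≤ φ ξ
  sum_eq_one : ∀ ξ, HasSum (fun q : ℕ => φ ((2 : ℝ) ^ (-(q : ℤ)) • ξ)) (1 - χ ξ)
  disjoint_χ : ∀ q : ℕ, 1 ≤ q →
    Disjoint (tsupport χ) (tsupport fun ξ : Space d => φ ((2 : ℝ) ^ (-(q : ℤ)) • ξ))
  disjoint_φ : ∀ j k : ℤ, 2 ≤ |j - k| →
    Disjoint (tsupport fun ξ : Space d => φ ((2 : ℝ) ^ (-j) • ξ))
      (tsupport fun ξ : Space d => φ ((2 : ℝ) ^ (-k) • ξ))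

/-- The dyadic blocks `Δ_q`, `q ≥ -1`, with the index shifted by one: `block P 0` is
`Δ_{-1} = χ(D)`, and `block P (q + 1)` is `Δ_q = φ(2^{-q} D)` for `q ≥ 0`. -/
def block {d : ℕ} (P : DyadicPartition d) : ℕ → Temp d → Temp d
  | 0 => multiplier P.χ
  | q + 1 => multiplier fun ξ => P.φ ((2 : ℝ) ^ (-(q : ℤ)) • ξ)

/-- The norm of the inhomogeneous Besov space `B^s_{p,r}`: the `ℓ^r` norm of the sequence
`2^{qs} ‖Δ_q u‖_{L^p}`, `q ≥ -1` (here `q = k - 1` with `k : ℕ`). -/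
def besovNorm {d : ℕ} (P : DyadicPartition d) (s : ℝ) (p r : ℝ≥0∞) (u : Temp d) : ℝ≥0∞ :=
  eLpNorm (fun k : ℕ => (2 : ℝ≥0∞) ^ (((k : ℝ) - 1) * s) * distLpNorm p (block P k u)) r Measure.count

/-! ### The Riesz transform and the commutators -/

/-- The symbol `i ξ_j / |ξ|` of the Riesz transform `∂_j / |D|`; it is homogeneous of degree `0`,
hence the same in all normalizations of the Fourier transform. -/
def rieszSymbol {d : ℕ} (j : Fin d) (ξ : Space d) : ℂ :=
  Complex.I * ((ξ j / ‖ξ‖ : ℝ) : ℂ)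

/-- `w = (∂_j / |D|) u`. This is defined for the tempered distributions `u` whose Fourier transform
is a locally integrable function `g` for which `(i ξ_j / |ξ|) g` is again a tempered distribution. -/
def IsRiesz {d : ℕ} (j : Fin d) (u w : Temp d) : Prop :=
  ∃ g : Space d → ℂ, IsFunction (𝓕 u) g ∧ IsFunction (𝓕 w) fun ξ => rieszSymbol j ξ * g ξ

/-- `w = a u`, the product of the smooth function `a` and the distribution `u`:
`⟨a u, φ⟩ = ⟨u, a φ⟩` for all test functions `φ` with compact support. -/
def IsProduct {d : ℕ} (a : Space d → ℝ) (u w : Temp d) : Prop :=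
  ContDiff ℝ ∞ a ∧
    ∀ φ ψ : 𝓢(Space d, ℂ), HasCompactSupport (φ : Space d → ℂ) →
      (∀ x, ψ x = (a x : ℂ) * φ x) → w φ = u ψ

/-- `w = v · ∇u = ∑ i, v_i ∂_i u` for a smooth vector field `v` and a distribution `u`. The sum is
tested as a whole, so that only the sum is required to be a tempered distribution. -/
def IsConvection {d : ℕ} (v : Space d → Space d) (u w : Temp d) : Prop :=
  ContDiff ℝ ∞ v ∧
    ∀ (φ : 𝓢(Space d, ℂ)) (ψ : Fin d → 𝓢(Space d, ℂ)), HasCompactSupport (φ : Space d → ℂ) →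
      (∀ i x, ψ i x = (v x i : ℂ) * φ x) →
        w φ = ∑ i, (∂_{EuclideanSpace.single i (1 : ℝ)} u : Temp d) (ψ i)

/-- `w = [R, a] u = R (a u) - a (R u)` for the Riesz transform `R = ∂_j / |D|`
and a smooth function `a`. -/
def IsCommProduct {d : ℕ} (j : Fin d) (a : Space d → ℝ) (u w : Temp d) : Prop :=
  ∃ au Rau Ru aRu : Temp d,
    IsProduct a u au ∧ IsRiesz j au Rau ∧ IsRiesz j u Ru ∧ IsProduct a Ru aRu ∧ w = Rau - aRu

/-- `w = [R, v · ∇] u = R (v · ∇u) - v · ∇(R u)` for the Riesz transform `R = ∂_j / |D|`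
and a smooth vector field `v`. -/
def IsCommConvection {d : ℕ} (j : Fin d) (v : Space d → Space d) (u w : Temp d) : Prop :=
  ∃ vu Rvu Ru vRu : Temp d,
    IsConvection v u vu ∧ IsRiesz j vu Rvu ∧ IsRiesz j u Ru ∧ IsConvection v Ru vRu ∧ w = Rvu - vRu

/-- The divergence of the vector field `v` vanishes. -/
def DivFree {d : ℕ} (v : Space d → Space d) : Prop :=
  ∀ x, ∑ i, fderiv ℝ v x (EuclideanSpace.single i (1 : ℝ)) i = 0

end RieszCommutator

end

/-! A frequency block of the commutator sees only increments of the field. Let `K_k` and `K'_k` be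
the kernels of `φ(2^{-k}D)` and `φ(2^{-k}D)R`. Adding and subtracting `a · φ(2^{-k}D)Rθ` writes the
block of `[R, a]θ` at scale `2^k` as the difference of `∫ K'_k(x-y)(a(y)-a(x))θ(y)dy` and `∫
K_k(x-y)(a(y)-a(x))Rθ(y)dy` (`IsRieszData.fourierInv_dil_commSym`). Both are instances of `bil`. The
second factor is then split into homogeneous blocks `g_q`, `q ∈ ℤ`. Although `R` is unbounded on
`L^∞`, a block of `Rθ` is the same block of `θ` convolved with a kernel whose mass does not depend
on `q` (`blk_cut_eq`, `enorm_blk_le`), so only blocks of `θ` enter the bounds.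

For one pair of scales there are two gains over `‖∇a‖_p ‖g_q‖_∞`. The fundamental theorem of
calculus and the first moment of the kernel give `2^{-k}` (`eLpNorm_lintegral_diff_le`,
`moment_ker`). Writing `g_q` as `2^{-q}` times a divergence and integrating by parts gives `2^{-q}`
(`eLpNorm_bil_blk_le_of_sum`).

Convection: since `div v = 0`, `v·∇θ = div(vθ)`, and the divergence falls on the kernel with a
factor `2^k`. For `q ≥ k` the second gain leaves `2^{k-q}`. For `q ≤ k` the derivative is moved from
the kernel back to `g_q`, where `div v = 0` removes the remaining term, and the first gain leaves
`2^{q-k}` (`eLpNorm_bilDiv_le`). The weight `2^{-|k-q|}` is summable, so the supremum of the blocks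
of `θ` suffices.

Product: for `q ≥ 0`, `2^{ks} min(2^{-k}, 2^{-q})` is at most `2^{-σ|k-q|} 2^{q(s-1)}` with `σ =
min(s, 1-s)`, and Young's inequality `ℓ¹ * ℓ² ⊂ ℓ²` applies. Each block with `q < 0` is controlled
by `Δ_{-1}θ` and `Δ_0θ` (`exists_amp_le_of_neg`), but there are infinitely many of them. Decay in
`q` comes from interpolation with a bound that does not use `∇a` and with Bernstein's inequality
`‖g_q‖_∞ ≲ 2^{qd/2}‖θ‖_2` (`exists_eLpNorm_bil_le`).

The block `Δ_{-1}` of the commutator needs no cancellation: the products `aθ` and `aRθ` are in `L¹`,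
so its Fourier transform is a bounded function up to factors `ξ_i`, and the cut-off puts it in `L¹ ∩
L²`. The norms `‖v‖_2 ‖θ‖_2` arise from low frequencies only. Finally, the distributional predicates
force the Fourier transform of `w` to be `commSym`, or its divergence `divSym`; this gives existence
and lets the estimates apply to every admissible `w`. -/

noncomputable section

namespace RieszCommutator

/-! ### Compactly supported test functions are dense -/

section Density

variable {d : ℕ}

/-- A fixed smooth bump function which equals `1` on the unit ball. -/
def unitBump (d : ℕ) : ContDiffBump (0 : Space d) := ⟨1, 2, one_pos, one_lt_two⟩

/-- The complement `1 - g(ε x)` of a dilated bump function. -/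
def coBump (d : ℕ) (ε : ℝ) (x : Space d) : ℂ := ((1 - unitBump d (ε • x) : ℝ) : ℂ)

lemma contDiff_coBump (ε : ℝ) : ContDiff ℝ ∞ (coBump d ε) := by
  unfold coBump
  have h : ContDiff ℝ ∞ (fun x : Space d => unitBump d (ε • x)) :=
    (unitBump d).contDiff.comp (contDiff_const_smul ε)
  exact Complex.ofRealCLM.contDiff.comp (contDiff_const.sub h)

lemma coBump_eq_zero {ε : ℝ} {x : Space d} (h : ‖ε • x‖ ≤ 1) : coBump d ε x = 0 := by
  have : unitBump d (ε • x) = 1 := by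
    apply (unitBump d).one_of_mem_closedBall
    simpa [unitBump] using h
  simp [coBump, this]

lemma norm_coBump_le (ε : ℝ) (x : Space d) : ‖coBump d ε x‖ ≤ 1 := by
  have h0 := (unitBump d).nonneg' (ε • x)
  have h1 : unitBump d (ε • x) ≤ 1 := (unitBump d).le_one
  rw [coBump, Complex.norm_real, Real.norm_eq_abs, abs_le]
  constructor <;> linarith

/-- Each derivative of order `i ≥ 1` brings out `ε^i ≤ ε`. At order zero the function vanishes for
`ε‖x‖ ≤ 1` and is at most `1 ≤ ε‖x‖` elsewhere. A factor `ε` is thus bought with one power of `‖x‖`,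
which Schwartz seminorms can absorb. -/
lemma exists_norm_iteratedFDeriv_coBump_le (n : ℕ) :
    ∃ C : ℝ, 0 ≤ C ∧ ∀ ε : ℝ, 0 < ε → ε ≤ 1 → ∀ x : Space d, ∀ i ≤ n,
      ‖iteratedFDeriv ℝ i (coBump d ε) x‖ ≤ C * ε * (1 + ‖x‖) := by
  have hg : HasCompactSupport (coBump d 1 - fun _ => 1) := by
    have : (coBump d 1 - fun _ => 1) = fun x => -((unitBump d x : ℝ) : ℂ) := by
      ext x; simp [coBump]
    rw [this]
    exact ((unitBump d).hasCompactSupport.comp_left (g := fun t : ℝ => -(t : ℂ)) (by simp))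
  have hgs : ContDiff ℝ ∞ (coBump d 1 - fun _ => 1) := (contDiff_coBump 1).sub contDiff_const
  have hT := hg.hasTemperateGrowth hgs
  have hbd : ∀ i : ℕ, ∃ C : ℝ, 0 ≤ C ∧ ∀ x, 1 ≤ i → ‖iteratedFDeriv ℝ i (coBump d 1) x‖ ≤ C := by
    intro i
    have hc : Continuous (iteratedFDeriv ℝ i (coBump d 1 - fun _ => 1)) :=
      hgs.continuous_iteratedFDeriv (mod_cast le_top)
    obtain ⟨C, hC⟩ := (hg.iteratedFDeriv (𝕜 := ℝ) i).exists_bound_of_continuous hc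
    refine ⟨C, (norm_nonneg _).trans (hC 0), fun x hi => ?_⟩
    refine le_trans (le_of_eq ?_) (hC x)
    rw [iteratedFDeriv_sub ((contDiff_coBump 1).of_le (mod_cast le_top)) contDiff_const]
    rw [Pi.sub_apply, iteratedFDeriv_const_of_ne (by omega)]
    simp
  choose C hC0 hC using hbd
  refine ⟨1 + ∑ i ∈ Finset.range (n + 1), C i, ?_, fun ε hε hε1 x i hi => ?_⟩
  · have := Finset.sum_nonneg (s := Finset.range (n + 1)) (f := C) (fun i _ => hC0 i)
    linarith
  have hS := Finset.sum_nonneg (s := Finset.range (n + 1)) (f := C) (fun i _ => hC0 i)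
  rcases Nat.eq_zero_or_pos i with rfl | hi1
  · rw [norm_iteratedFDeriv_zero]
    by_cases h : ‖ε • x‖ ≤ 1
    · rw [coBump_eq_zero h, norm_zero]; positivity
    · push Not at h
      rw [norm_smul, Real.norm_eq_abs, abs_of_pos hε] at h
      refine (norm_coBump_le ε x).trans ?_
      nlinarith [norm_nonneg x, mul_nonneg hS hε.le]
  · have hcomp : coBump d ε = coBump d 1 ∘ (ε • ContinuousLinearMap.id ℝ (Space d)) := by
      ext y; simp [coBump]
    rw [hcomp, ContinuousLinearMap.iteratedFDeriv_comp_right _ (contDiff_coBump 1) x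
      (mod_cast le_top)]
    refine (ContinuousMultilinearMap.norm_compContinuousLinearMap_le _ _).trans ?_
    rw [Finset.prod_const, Finset.card_univ, Fintype.card_fin]
    have h1 : ‖ε • ContinuousLinearMap.id ℝ (Space d)‖ ≤ ε := by
      rw [norm_smul, Real.norm_eq_abs, abs_of_pos hε]
      exact mul_le_of_le_one_right hε.le ContinuousLinearMap.norm_id_le
    have h2 : ‖ε • ContinuousLinearMap.id ℝ (Space d)‖ ^ i ≤ ε := by
      refine (pow_le_pow_left₀ (norm_nonneg _) h1 i).trans ?_
      exact pow_le_of_le_one hε.le hε1 (by omega)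
    have h3 := hC i ((ε • ContinuousLinearMap.id ℝ (Space d)) x) hi1
    have h4 : C i ≤ ∑ i ∈ Finset.range (n + 1), C i :=
      Finset.single_le_sum (fun i _ => hC0 i) (Finset.mem_range.2 (by omega))
    calc _ ≤ C i * ε := mul_le_mul h3 h2 (by positivity) (hC0 i)
      _ ≤ (1 + ∑ i ∈ Finset.range (n + 1), C i) * ε := by gcongr; linarith
      _ ≤ _ := le_mul_of_one_le_right (by positivity) (by linarith [norm_nonneg x])

/-- The truncation `g(ε x) φ(x)` of a Schwartz function. -/
def truncate (ε : ℝ) (φ : 𝓢(Space d, ℂ)) : 𝓢(Space d, ℂ) :=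
  SchwartzMap.smulLeftCLM ℂ (fun x => ((unitBump d (ε • x) : ℝ) : ℂ)) φ

lemma hasCompactSupport_bump_comp {ε : ℝ} (hε : 0 < ε) :
    HasCompactSupport (fun x : Space d => ((unitBump d (ε • x) : ℝ) : ℂ)) := by
  have h : HasCompactSupport (fun x : Space d => unitBump d (ε • x)) :=
    (unitBump d).hasCompactSupport.comp_smul hε.ne'
  exact h.comp_left (g := fun t : ℝ => (t : ℂ)) (by simp)

lemma hasTemperateGrowth_bump_comp {ε : ℝ} (hε : 0 < ε) :
    (fun x : Space d => ((unitBump d (ε • x) : ℝ) : ℂ)).HasTemperateGrowth := by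
  apply (hasCompactSupport_bump_comp hε).hasTemperateGrowth
  have h : ContDiff ℝ ∞ (fun x : Space d => unitBump d (ε • x)) :=
    (unitBump d).contDiff.comp (contDiff_const_smul ε)
  exact Complex.ofRealCLM.contDiff.comp h

lemma truncate_apply {ε : ℝ} (hε : 0 < ε) (φ : 𝓢(Space d, ℂ)) (x : Space d) :
    truncate ε φ x = ((unitBump d (ε • x) : ℝ) : ℂ) * φ x := by
  rw [truncate, SchwartzMap.smulLeftCLM_apply_apply (hasTemperateGrowth_bump_comp hε), smul_eq_mul]

lemma hasCompactSupport_truncate {ε : ℝ} (hε : 0 < ε) (φ : 𝓢(Space d, ℂ)) :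
    HasCompactSupport (truncate ε φ : Space d → ℂ) := by
  have : (truncate ε φ : Space d → ℂ) = fun x => ((unitBump d (ε • x) : ℝ) : ℂ) * φ x :=
    funext (truncate_apply hε φ)
  rw [this]
  exact (hasCompactSupport_bump_comp hε).mul_right

/-- By Leibniz' rule and the bound on `coBump`, the error in the seminorm `(k, m)` is `O(ε)` times
seminorms with weights `k` and `k + 1`. -/
lemma tendsto_truncate (φ : 𝓢(Space d, ℂ)) :
    Filter.Tendsto (fun n : ℕ => truncate (1 / ((n : ℝ) + 1)) φ) Filter.atTop (nhds φ) := by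
  rw [(schwartz_withSeminorms ℂ (Space d) ℂ).tendsto_nhds]
  rintro ⟨k, m⟩ δ hδ
  obtain ⟨C, hC0, hC⟩ := exists_norm_iteratedFDeriv_coBump_le (d := d) m
  set S : ℝ := ∑ i ∈ Finset.range (m + 1), (m.choose i : ℝ) *
    (SchwartzMap.seminorm ℝ k (m - i) φ + SchwartzMap.seminorm ℝ (k + 1) (m - i) φ) with hSdef
  have hS0 : 0 ≤ S := Finset.sum_nonneg fun i _ => by positivity
  have key : ∀ n : ℕ, SchwartzMap.seminorm ℂ k m (truncate (1 / ((n : ℝ) + 1)) φ - φ) ≤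
      C * S * (1 / ((n : ℝ) + 1)) := by
    intro n
    set ε : ℝ := 1 / ((n : ℝ) + 1)
    have hε : 0 < ε := by positivity
    have hε1 : ε ≤ 1 := by
      rw [div_le_one (by positivity)]; linarith [Nat.cast_nonneg (α := ℝ) n]
    apply SchwartzMap.seminorm_le_bound _ _ _ _ (by positivity)
    intro x
    have heq : ((truncate ε φ - φ : 𝓢(Space d, ℂ)) : Space d → ℂ) =
        fun x => -(coBump d ε x * φ x) := by
      ext y
      rw [sub_apply, truncate_apply hε]
      simp [coBump]; ring
    rw [heq]
    have hneg : iteratedFDeriv ℝ m (fun x => -(coBump d ε x * φ x)) x =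
        -iteratedFDeriv ℝ m (fun x => coBump d ε x * φ x) x :=
      iteratedFDeriv_neg_apply (f := fun x => coBump d ε x * φ x)
    rw [hneg, norm_neg]
    have hmul := norm_iteratedFDeriv_mul_le (n := m) (N := ∞) (contDiff_coBump (d := d) ε)
      (φ.smooth ⊤) x (mod_cast le_top)
    calc ‖x‖ ^ k * ‖iteratedFDeriv ℝ m (fun x => coBump d ε x * φ x) x‖
        ≤ ‖x‖ ^ k * ∑ i ∈ Finset.range (m + 1), (m.choose i : ℝ) *
          ‖iteratedFDeriv ℝ i (coBump d ε) x‖ * ‖iteratedFDeriv ℝ (m - i) φ x‖ := by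
          gcongr
      _ = ∑ i ∈ Finset.range (m + 1), ‖x‖ ^ k * ((m.choose i : ℝ) *
          ‖iteratedFDeriv ℝ i (coBump d ε) x‖ * ‖iteratedFDeriv ℝ (m - i) φ x‖) := by
          rw [Finset.mul_sum]
      _ ≤ ∑ i ∈ Finset.range (m + 1), C * ε * ((m.choose i : ℝ) *
          (SchwartzMap.seminorm ℝ k (m - i) φ + SchwartzMap.seminorm ℝ (k + 1) (m - i) φ)) := by
          apply Finset.sum_le_sum
          intro i hi
          have h1 := hC ε hε hε1 x i (by simpa [Nat.lt_succ_iff] using hi)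
          have h2 := SchwartzMap.le_seminorm ℝ k (m - i) φ x
          have h3 := SchwartzMap.le_seminorm ℝ (k + 1) (m - i) φ x
          calc _ ≤ ‖x‖ ^ k * ((m.choose i : ℝ) *
              (C * ε * (1 + ‖x‖)) * ‖iteratedFDeriv ℝ (m - i) φ x‖) := by gcongr
            _ = C * ε * ((m.choose i : ℝ) * (‖x‖ ^ k * ‖iteratedFDeriv ℝ (m - i) φ x‖ +
                ‖x‖ ^ (k + 1) * ‖iteratedFDeriv ℝ (m - i) φ x‖)) := by ring
            _ ≤ _ := by gcongr
      _ = C * S * ε := by rw [← Finset.mul_sum]; ring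
  have hlim : Filter.Tendsto (fun n : ℕ => C * S * (1 / ((n : ℝ) + 1))) Filter.atTop (nhds 0) := by
    simpa using tendsto_one_div_add_atTop_nhds_zero_nat.const_mul (C * S)
  filter_upwards [hlim.eventually (gt_mem_nhds hδ)] with n hn
  exact (key n).trans_lt hn

/-- A tempered distribution is determined by its values on compactly supported test functions. -/
theorem ext_of_hasCompactSupport {u w : Temp d}
    (h : ∀ φ : 𝓢(Space d, ℂ), HasCompactSupport (φ : Space d → ℂ) → u φ = w φ) : u = w := by
  ext φ
  have hu := (u.continuous.tendsto φ).comp (tendsto_truncate φ)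
  have hw := (w.continuous.tendsto φ).comp (tendsto_truncate φ)
  refine tendsto_nhds_unique hu (hw.congr fun n => ?_)
  exact (h _ (hasCompactSupport_truncate (by positivity) φ)).symm

end Density

/-! ### Uniqueness of representing functions -/

section Functions

variable {d : ℕ}

lemma IsFunction.ae_eq {u : Temp d} {g g' : Space d → ℂ} (h : IsFunction u g)
    (h' : IsFunction u g') : g =ᵐ[volume] g' := by
  apply ae_eq_of_integral_contDiff_smul_eq h.1 h'.1
  intro f hf hfc
  have hc : HasCompactSupport (Complex.ofRealCLM ∘ f) := hfc.comp_left rfl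
  have hs : ContDiff ℝ ∞ (Complex.ofRealCLM ∘ f) := by fun_prop
  have h1 := h.2 (hc.toSchwartzMap hs) hc
  rw [h'.2 (hc.toSchwartzMap hs) hc] at h1
  simpa using h1.symm

lemma IsFunction.congr_ae {u : Temp d} {g g' : Space d → ℂ} (h : IsFunction u g)
    (hg : g =ᵐ[volume] g') : IsFunction u g' := by
  refine ⟨h.1.congr hg, fun φ hφ => (h.2 φ hφ).trans (integral_congr_ae ?_)⟩
  filter_upwards [hg] with x hx
  rw [hx]

lemma IsFunction.eq {u u' : Temp d} {g : Space d → ℂ} (h : IsFunction u g)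
    (h' : IsFunction u' g) : u = u' :=
  ext_of_hasCompactSupport fun φ hφ => (h.2 φ hφ).trans (h'.2 φ hφ).symm

lemma IsFunction.distLpNorm_eq {u : Temp d} {g : Space d → ℂ} (h : IsFunction u g) (p : ℝ≥0∞) :
    distLpNorm p u = eLpNorm g p volume := by
  apply le_antisymm
  · exact iInf₂_le g h
  · refine le_iInf₂ fun g' h' => ?_
    rw [eLpNorm_congr_ae (h.ae_eq h')]

lemma toTemperedDistribution_toLp_apply {p : ℝ≥0∞} [hp : Fact (1 ≤ p)] {g : Space d → ℂ}
    (hg : MemLp g p volume) (φ : 𝓢(Space d, ℂ)) :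
    (hg.toLp g : Temp d) φ = ∫ x, φ x * g x := by
  rw [Lp.toTemperedDistribution_apply]
  apply integral_congr_ae
  filter_upwards [hg.coeFn_toLp] with x hx
  rw [hx, smul_eq_mul]

lemma isFunction_toLp {p : ℝ≥0∞} [hp : Fact (1 ≤ p)] {g : Space d → ℂ} (hg : MemLp g p volume) :
    IsFunction (hg.toLp g : Temp d) g :=
  ⟨hg.locallyIntegrable hp.elim, fun φ _ => toTemperedDistribution_toLp_apply hg φ⟩

/-- A distribution given by an `L^p` function is the image of this function. -/
lemma IsFunction.eq_toLp {p : ℝ≥0∞} [hp : Fact (1 ≤ p)] {u : Temp d} {g : Space d → ℂ}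
    (h : IsFunction u g) (hg : MemLp g p volume) : u = (hg.toLp g : Temp d) :=
  h.eq (isFunction_toLp hg)

end Functions

/-! ### Fourier pairs -/

section FourierPairs

variable {d : ℕ}

/-- `F` is the Fourier transform of `f` in the weak sense. -/
def IsFourierPair (f F : Space d → ℂ) : Prop :=
  ∀ φ : 𝓢(Space d, ℂ), ∫ x, (𝓕 φ) x * f x = ∫ ξ, φ ξ * F ξ

/-- This is the multiplication formula. Weak pairs treat `L¹` and `L²` transforms alike, so that
convolution and multiplier identities need only one proof. -/
lemma isFourierPair_of_integrable {f : Space d → ℂ} (hf : Integrable f) :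
    IsFourierPair f (𝓕 f) := by
  intro φ
  have := VectorFourier.integral_fourierIntegral_smul_eq_flip (L := innerₗ (Space d))
    (μ := volume) (ν := volume) (e := Real.fourierChar) Real.continuous_fourierChar
    (by simpa using continuous_inner) φ.integrable hf
  simpa [flip_innerₗ, SchwartzMap.fourier_coe] using! this

lemma isFourierPair_fourierInv {F : Space d → ℂ} (hF : Integrable F) :
    IsFourierPair (𝓕⁻ F) F := by
  intro φ
  have h2 := isFourierPair_of_integrable hF (𝓕⁻ φ)
  rw [FourierTransform.fourier_fourierInv_eq] at h2
  rw [h2]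
  rw [← integral_neg_eq_self]
  congr 1
  ext x
  rw [Real.fourierInv_eq_fourier_neg]
  rw [neg_neg, SchwartzMap.fourier_coe, SchwartzMap.fourierInv_coe, Real.fourierInv_eq_fourier_neg]

lemma isFourierPair_Lp (f : Lp ℂ 2 (volume : Measure (Space d))) :
    IsFourierPair f (𝓕 f : Lp ℂ 2 (volume : Measure (Space d))) := by
  intro φ
  have h := congrArg (fun u : Temp d => u φ) (Lp.fourier_toTemperedDistribution_eq f)
  simpa [Lp.toTemperedDistribution_apply] using h

lemma IsFourierPair.congr {f F f' F' : Space d → ℂ} (h : IsFourierPair f F) (hf : f =ᵐ[volume] f')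
    (hF : F =ᵐ[volume] F') : IsFourierPair f' F' := by
  intro φ
  have e1 : ∫ x, (𝓕 φ) x * f' x = ∫ x, (𝓕 φ) x * f x := by
    apply integral_congr_ae; filter_upwards [hf] with x hx; rw [hx]
  have e2 : ∫ x, φ x * F' x = ∫ x, φ x * F x := by
    apply integral_congr_ae; filter_upwards [hF] with x hx; rw [hx]
  rw [e1, e2, h φ]

/-- The Fourier transform is onto the Schwartz space, so testing against all `𝓕 φ` is testing
against all Schwartz functions. -/
lemma IsFourierPair.ae_eq_left {f f' F : Space d → ℂ} (h : IsFourierPair f F)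
    (h' : IsFourierPair f' F) (hf : LocallyIntegrable f) (hf' : LocallyIntegrable f') :
    f =ᵐ[volume] f' := by
  apply ae_eq_of_integral_contDiff_smul_eq hf hf'
  intro g hg hgc
  have hc : HasCompactSupport (Complex.ofRealCLM ∘ g) := hgc.comp_left rfl
  have hs : ContDiff ℝ ∞ (Complex.ofRealCLM ∘ g) := by fun_prop
  have h1 := h (𝓕⁻ (hc.toSchwartzMap hs))
  have h2 := h' (𝓕⁻ (hc.toSchwartzMap hs))
  rw [← h2, FourierTransform.fourier_fourierInv_eq] at h1
  simpa using h1

/-- The modulation `ψ(ξ) e^{2πi x·ξ}` of a Schwartz function. -/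
lemma exists_modulation (ψ : 𝓢(Space d, ℂ)) (x : Space d) :
    ∃ φ : 𝓢(Space d, ℂ), (∀ ξ, φ ξ = Real.fourierChar (inner ℝ ξ x) • ψ ξ) ∧
      ∀ y, (𝓕 φ) y = (𝓕⁻ ψ) (x - y) := by
  refine ⟨𝓕⁻ (SchwartzMap.compSubConstCLM ℂ x (𝓕 ψ)), fun ξ => ?_, fun y => ?_⟩
  · rw [SchwartzMap.fourierInv_coe, Real.fourierInv_eq]
    have h1 : (fun v => Real.fourierChar (inner ℝ v ξ) •
        (SchwartzMap.compSubConstCLM ℂ x (𝓕 ψ)) v) = fun v =>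
        (fun w => Real.fourierChar (inner ℝ (w + x) ξ) • (𝓕 ψ) w) (v - x) := by
      ext v; simp
    rw [h1]
    refine (integral_sub_right_eq_self (μ := volume)
      (fun w => Real.fourierChar (inner ℝ (w + x) ξ) • (𝓕 ψ) w) x).trans ?_
    have h2 : ∀ w, Real.fourierChar (inner ℝ (w + x) ξ) • (𝓕 ψ) w =
        (Real.fourierChar (inner ℝ ξ x) : ℂ) • (Real.fourierChar (inner ℝ w ξ) • (𝓕 ψ) w) := by
      intro w
      rw [inner_add_left, AddChar.map_add_eq_mul, real_inner_comm ξ x, mul_comm, mul_smul]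
      rfl
    simp_rw [h2]
    rw [integral_smul, ← Real.fourierInv_eq, ← SchwartzMap.fourierInv_coe,
      FourierTransform.fourierInv_fourier_eq]
    rfl
  · rw [FourierTransform.fourier_fourierInv_eq]
    rw [SchwartzMap.compSubConstCLM_apply]
    rw [SchwartzMap.fourier_coe, SchwartzMap.fourierInv_coe, Real.fourierInv_eq_fourier_neg,
      neg_sub]

/-- Convolution with the kernel `𝓕⁻ ψ` is the Fourier multiplier with symbol `ψ`. -/
theorem IsFourierPair.convolution_eq {f F : Space d → ℂ} (h : IsFourierPair f F)
    (ψ : 𝓢(Space d, ℂ)) (x : Space d) :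
    ∫ y, (𝓕⁻ ψ) (x - y) * f y = 𝓕⁻ (fun ξ => ψ ξ * F ξ) x := by
  -- The weak identity is tested on `ψ(ξ) e^{2πi x·ξ}`, whose transform is the kernel centred at
  -- `x`.
  obtain ⟨φ, hφ, hφ'⟩ := exists_modulation ψ x
  have := h φ
  simp_rw [hφ'] at this
  rw [this, Real.fourierInv_eq]
  congr 1
  ext ξ
  rw [hφ, Circle.smul_def, Circle.smul_def]
  simp [mul_assoc]

theorem continuous_fourierInv {F : Space d → ℂ} (h1 : Integrable F) : Continuous (𝓕⁻ F) := by
  have : 𝓕⁻ F = fun x => 𝓕 F (-x) := funext fun x => Real.fourierInv_eq_fourier_neg F x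
  rw [this]
  exact (VectorFourier.fourierIntegral_continuous Real.continuous_fourierChar
    (by simpa using continuous_inner) h1).comp continuous_neg

/-- Plancherel's theorem for the inverse Fourier integral. -/
theorem fourierInv_ae_eq {F : Space d → ℂ} (h1 : Integrable F) (h2 : MemLp F 2 volume) :
    𝓕⁻ F =ᵐ[volume] (𝓕⁻ (h2.toLp F) : Lp ℂ 2 (volume : Measure (Space d))) := by
  have hp := isFourierPair_Lp (𝓕⁻ (h2.toLp F))
  rw [FourierTransform.fourier_fourierInv_eq] at hp
  have hp' := hp.congr (ae_eq_refl _) h2.coeFn_toLp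
  refine (isFourierPair_fourierInv h1).ae_eq_left hp' ?_
    ((Lp.memLp _).locallyIntegrable (by norm_num))
  exact (continuous_fourierInv h1).locallyIntegrable

theorem eLpNorm_Lp_fourierInv {F : Space d → ℂ} (h2 : MemLp F 2 volume) :
    eLpNorm (𝓕⁻ (h2.toLp F) : Lp ℂ 2 (volume : Measure (Space d))) 2 volume =
      eLpNorm F 2 volume := by
  have h := (Lp.fourierTransformₗᵢ (Space d) ℂ).symm.norm_map (h2.toLp F)
  have h' : ‖(𝓕⁻ (h2.toLp F) : Lp ℂ 2 (volume : Measure (Space d)))‖ = ‖h2.toLp F‖ := h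
  rw [Lp.norm_def, Lp.norm_def,
    ENNReal.toReal_eq_toReal_iff' (Lp.eLpNorm_ne_top _) (Lp.eLpNorm_ne_top _)] at h'
  rw [h', eLpNorm_congr_ae h2.coeFn_toLp]

theorem eLpNorm_fourierInv {F : Space d → ℂ} (h1 : Integrable F) (h2 : MemLp F 2 volume) :
    eLpNorm (𝓕⁻ F) 2 volume = eLpNorm F 2 volume := by
  rw [eLpNorm_congr_ae (fourierInv_ae_eq h1 h2), eLpNorm_Lp_fourierInv]

theorem enorm_fourierInv_le (F : Space d → ℂ) (x : Space d) :
    ‖𝓕⁻ F x‖ₑ ≤ ∫⁻ ξ, ‖F ξ‖ₑ := by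
  rw [Real.fourierInv_eq]
  refine (enorm_integral_le_lintegral_enorm _).trans (le_of_eq ?_)
  congr 1
  ext ξ
  rw [← ofReal_norm, Circle.norm_smul, ofReal_norm]

end FourierPairs

/-! ### Minkowski's inequality for averages of translates -/

section Minkowski

variable {d : ℕ}

/-- A general parameter space `Z` covers two uses: the measure `|κ(z)|dz` gives Young's inequality,
and `|z||κ(z)|dz ⊗ dt` gives the bound for increments. For finite `p`, Hölder's inequality for the
finite measure `μ` is followed by Tonelli and translation invariance; for `p = ∞`, null sets are
exchanged by Fubini. -/
theorem eLpNorm_lintegral_translate_le {Z : Type*} [MeasurableSpace Z] (μ : Measure Z)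
    [IsFiniteMeasure μ] {τ : Z → Space d} (hτ : Measurable τ) {F : Space d → ℝ≥0∞}
    (hF : Measurable F) {p : ℝ≥0∞} (hp : 1 ≤ p) :
    eLpNorm (fun x => ∫⁻ z, F (x - τ z) ∂μ) p volume ≤ μ Set.univ * eLpNorm F p volume := by
  have hm : Measurable (fun q : Space d × Z => F (q.1 - τ q.2)) :=
    hF.comp (measurable_fst.sub (hτ.comp measurable_snd))
  rcases eq_or_ne p ∞ with rfl | hp'
  · rw [eLpNorm_exponent_top, eLpNorm_exponent_top]
    set M := eLpNormEssSup F volume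
    have hM : ∀ᵐ x, F x ≤ M := by
      have := enorm_ae_le_eLpNormEssSup F volume
      simpa using this
    have h1 : ∀ᵐ z ∂μ, ∀ᵐ x, F (x - τ z) ≤ M := by
      refine Filter.Eventually.of_forall fun z => ?_
      exact (measurePreserving_sub_right volume (τ z)).quasiMeasurePreserving.ae hM
    have h2 : ∀ᵐ x, ∀ᵐ z ∂μ, F (x - τ z) ≤ M := by
      rw [Measure.ae_ae_comm]
      · exact h1
      · exact measurableSet_le hm measurable_const
    refine essSup_le_of_ae_le _ ?_
    filter_upwards [h2] with x hx
    simp only [enorm_eq_self]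
    calc ∫⁻ z, F (x - τ z) ∂μ ≤ ∫⁻ _, M ∂μ := lintegral_mono_ae hx
      _ = μ Set.univ * M := by rw [lintegral_const, mul_comm]
  · have hp0 : p ≠ 0 := (zero_lt_one.trans_le hp).ne'
    have hpr : 1 ≤ p.toReal := by
      rw [← ENNReal.toReal_one]; exact ENNReal.toReal_mono hp' hp
    have hpr0 : 0 < p.toReal := zero_lt_one.trans_le hpr
    have key : ∀ x, (∫⁻ z, F (x - τ z) ∂μ) ^ p.toReal ≤
        μ Set.univ ^ (p.toReal - 1) * ∫⁻ z, F (x - τ z) ^ p.toReal ∂μ := by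
      intro x
      have hmx : Measurable fun z => F (x - τ z) := hF.comp (measurable_const.sub hτ)
      have h := eLpNorm_le_eLpNorm_mul_rpow_measure_univ (μ := μ) hp hmx.aestronglyMeasurable
      rw [eLpNorm_one_eq_lintegral_enorm, eLpNorm_eq_lintegral_rpow_enorm_toReal hp0 hp'] at h
      simp only [enorm_eq_self] at h
      refine (ENNReal.rpow_le_rpow h hpr0.le).trans ?_
      rw [ENNReal.mul_rpow_of_nonneg _ _ hpr0.le, ← ENNReal.rpow_mul, ← ENNReal.rpow_mul, mul_comm]
      apply le_of_eq
      congr 2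
      · rw [ENNReal.toReal_one]; field_simp
      · rw [one_div, inv_mul_cancel₀ hpr0.ne', ENNReal.rpow_one]
    rw [eLpNorm_eq_lintegral_rpow_enorm_toReal hp0 hp', eLpNorm_eq_lintegral_rpow_enorm_toReal hp0 hp']
    simp only [enorm_eq_self]
    have hfin : μ Set.univ = (μ Set.univ ^ p.toReal) ^ (1 / p.toReal) := by
      rw [← ENNReal.rpow_mul, mul_one_div_cancel hpr0.ne', ENNReal.rpow_one]
    rw [hfin, ← ENNReal.mul_rpow_of_nonneg _ _ (by positivity)]
    gcongr
    calc ∫⁻ x, (∫⁻ z, F (x - τ z) ∂μ) ^ p.toReal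
        ≤ ∫⁻ x, μ Set.univ ^ (p.toReal - 1) * ∫⁻ z, F (x - τ z) ^ p.toReal ∂μ := lintegral_mono key
      _ = μ Set.univ ^ (p.toReal - 1) * ∫⁻ x, ∫⁻ z, F (x - τ z) ^ p.toReal ∂μ := by
          rw [lintegral_const_mul]
          exact (hm.pow_const _).lintegral_prod_right'
      _ = μ Set.univ ^ (p.toReal - 1) * ∫⁻ z, ∫⁻ x, F (x - τ z) ^ p.toReal ∂volume ∂μ := by
          rw [lintegral_lintegral_swap]
          exact (hm.pow_const _).aemeasurable
      _ = μ Set.univ ^ (p.toReal - 1) * ∫⁻ z, ∫⁻ x, F x ^ p.toReal ∂volume ∂μ := by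
          congr 2
          ext z
          exact lintegral_sub_right_eq_self (fun x => F x ^ p.toReal) (τ z)
      _ = μ Set.univ ^ (p.toReal - 1) * μ Set.univ * ∫⁻ x, F x ^ p.toReal := by
          rw [lintegral_const]; ring
      _ ≤ μ Set.univ ^ p.toReal * ∫⁻ x, F x ^ p.toReal := by
          gcongr
          rcases eq_or_ne (μ Set.univ) 0 with h0 | h0
          · simp [h0]
          · conv_lhs => rw [← ENNReal.rpow_one (μ Set.univ), ← ENNReal.rpow_mul, one_mul]
            rw [← ENNReal.rpow_add _ _ h0 (measure_ne_top _ _)]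
            simp

lemma eLpNorm_le_mul_of_enorm_le {X ε ε' : Type*} [MeasurableSpace X] {μ : Measure X}
    [TopologicalSpace ε] [ContinuousENorm ε] [TopologicalSpace ε'] [ContinuousENorm ε']
    {f : X → ε} {g : X → ε'} {c : ℝ≥0∞}
    (hc : c ≠ ⊤) (h : ∀ x, ‖f x‖ₑ ≤ c * ‖g x‖ₑ) {p : ℝ≥0∞} :
    eLpNorm f p μ ≤ c * eLpNorm g p μ := by
  lift c to ℝ≥0 using hc
  exact eLpNorm_le_nnreal_smul_eLpNorm_of_ae_le_mul' (Filter.Eventually.of_forall h) p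

/-- The `L¹` mass of a kernel. -/
def mass (κ : Space d → ℂ) : ℝ≥0∞ := ∫⁻ z, ‖κ z‖ₑ

/-- The first absolute moment of a kernel. -/
def moment (κ : Space d → ℂ) : ℝ≥0∞ := ∫⁻ z, ‖z‖ₑ * ‖κ z‖ₑ

/-- Young's inequality for the convolution with an `L¹` kernel. -/
theorem eLpNorm_lintegral_mul_le {κ : Space d → ℂ} (hκ : Continuous κ) (hκ' : mass κ ≠ ⊤)
    {F : Space d → ℝ≥0∞} (hF : Measurable F) {p : ℝ≥0∞} (hp : 1 ≤ p) :
    eLpNorm (fun x => ∫⁻ z, ‖κ z‖ₑ * F (x - z)) p volume ≤ mass κ * eLpNorm F p volume := by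
  have hm : Measurable fun z => ‖κ z‖ₑ := hκ.measurable.enorm
  set μ := (volume : Measure (Space d)).withDensity fun z => ‖κ z‖ₑ
  have huniv : μ Set.univ = mass κ := by simp [μ, mass]
  have : IsFiniteMeasure μ := ⟨by rw [huniv]; exact hκ'.lt_top⟩
  have h := eLpNorm_lintegral_translate_le μ (τ := id) measurable_id hF hp
  rw [huniv] at h
  refine le_trans (le_of_eq ?_) h
  congr 1
  ext x
  have hFx : Measurable fun z => F (x - z) := hF.comp (measurable_const.sub measurable_id)
  exact (lintegral_withDensity_eq_lintegral_mul volume hm hFx).symm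

/-- The bound keeps the average along the segment instead of a supremum, so that it can be
integrated in `L^p` over `x`. -/
lemma enorm_sub_le_lintegral_fderiv {G : Type*} [NormedAddCommGroup G] [NormedSpace ℝ G]
    [CompleteSpace G] {v : Space d → G} (hv : ContDiff ℝ ∞ v) (x z : Space d) :
    ‖v (x - z) - v x‖ₑ ≤ ∫⁻ t in Set.Ioc (0 : ℝ) 1, ‖z‖ₑ * ‖fderiv ℝ v (x - t • z)‖ₑ := by
  have hd : ∀ t : ℝ, HasDerivAt (fun t : ℝ => v (x - t • z)) (fderiv ℝ v (x - t • z) (-z)) t := by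
    intro t
    have h1 : HasDerivAt (fun t : ℝ => x - t • z) (-z) t := by
      simpa using ((hasDerivAt_id t).smul_const z).const_sub x
    exact ((hv.differentiable (by simp)).differentiableAt.hasFDerivAt).comp_hasDerivAt t h1
  have hc : Continuous fun t : ℝ => fderiv ℝ v (x - t • z) (-z) := by
    have := hv.continuous_fderiv (by simp)
    fun_prop
  have := intervalIntegral.integral_eq_sub_of_hasDerivAt (a := 0) (b := 1)
    (fun t _ => hd t) (hc.intervalIntegrable _ _)
  simp only [one_smul, zero_smul, sub_zero] at this
  rw [← this, intervalIntegral.integral_of_le zero_le_one]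
  refine (enorm_integral_le_lintegral_enorm _).trans (lintegral_mono fun t => ?_)
  have h := (fderiv ℝ v (x - t • z)).le_opENorm (-z)
  rw [enorm_neg, mul_comm] at h
  exact h

/-- The increment is at most `‖z‖` times an average of translates `‖∇v(x - tz)‖`. The left side is
therefore an average of translates for the measure `‖z‖‖κ(z)‖dz ⊗ dt`, whose total mass is the first
moment of `κ`. -/
theorem eLpNorm_lintegral_diff_le {G : Type*} [NormedAddCommGroup G] [NormedSpace ℝ G]
    [CompleteSpace G] {κ : Space d → ℂ} (hκ : Continuous κ) (hκ' : moment κ ≠ ⊤)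
    {v : Space d → G} (hv : ContDiff ℝ ∞ v) {p : ℝ≥0∞} (hp : 1 ≤ p) :
    eLpNorm (fun x => ∫⁻ z, ‖κ z‖ₑ * ‖v (x - z) - v x‖ₑ) p volume ≤
      moment κ * eLpNorm (fderiv ℝ v) p volume := by
  have hm : Measurable fun z : Space d => ‖z‖ₑ * ‖κ z‖ₑ :=
    measurable_id.enorm.mul hκ.measurable.enorm
  set ν := (volume : Measure (Space d)).withDensity fun z => ‖z‖ₑ * ‖κ z‖ₑ
  have hν : ν Set.univ = moment κ := by simp [ν, moment]
  have : IsFiniteMeasure ν := ⟨by rw [hν]; exact hκ'.lt_top⟩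
  set μ := ν.prod ((volume : Measure ℝ).restrict (Set.Ioc 0 1))
  have huniv : μ Set.univ = moment κ := by
    rw [← Set.univ_prod_univ, Measure.prod_prod, hν]; simp
  have hF : Measurable fun x => ‖fderiv ℝ v x‖ₑ :=
    (hv.continuous_fderiv (by simp)).measurable.enorm
  have h := eLpNorm_lintegral_translate_le μ (τ := fun q => q.2 • q.1)
    (measurable_snd.smul measurable_fst) hF hp
  rw [huniv, eLpNorm_enorm] at h
  refine le_trans (eLpNorm_mono_enorm fun x => ?_) h
  simp only [enorm_eq_self]
  have hmx : Measurable fun q : Space d × ℝ => ‖fderiv ℝ v (x - q.2 • q.1)‖ₑ :=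
    hF.comp (measurable_const.sub (measurable_snd.smul measurable_fst))
  rw [lintegral_prod _ hmx.aemeasurable,
    lintegral_withDensity_eq_lintegral_mul _ hm hmx.lintegral_prod_right']
  refine lintegral_mono fun z => ?_
  simp only [Pi.mul_apply]
  have hmz : Measurable fun t : ℝ => ‖fderiv ℝ v (x - t • z)‖ₑ :=
    hF.comp (measurable_const.sub (measurable_id.smul measurable_const))
  calc ‖κ z‖ₑ * ‖v (x - z) - v x‖ₑ
      ≤ ‖κ z‖ₑ * ∫⁻ t in Set.Ioc (0 : ℝ) 1, ‖z‖ₑ * ‖fderiv ℝ v (x - t • z)‖ₑ := by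
        gcongr; exact enorm_sub_le_lintegral_fderiv hv x z
    _ = _ := by rw [lintegral_const_mul _ hmz]; ring

/-- The version without gain, by the triangle inequality. It involves `v` instead of `∇v` and serves
for the very low frequencies of the second factor. -/
theorem eLpNorm_lintegral_diff_le_two {G : Type*} [NormedAddCommGroup G] {κ : Space d → ℂ} (hκ : Continuous κ) (hκ' : mass κ ≠ ⊤)
    {v : Space d → G} (hv : Continuous v) {p : ℝ≥0∞} (hp : 1 ≤ p) :
    eLpNorm (fun x => ∫⁻ z, ‖κ z‖ₑ * ‖v (x - z) - v x‖ₑ) p volume ≤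
      2 * mass κ * eLpNorm v p volume := by
  have hF : Measurable fun x => ‖v x‖ₑ := hv.enorm.measurable
  have hκm : Measurable fun z => ‖κ z‖ₑ := hκ.measurable.enorm
  have h := eLpNorm_lintegral_mul_le hκ hκ' hF hp
  rw [eLpNorm_enorm] at h
  have hm : Measurable fun x => ∫⁻ z, ‖κ z‖ₑ * ‖v (x - z)‖ₑ := by
    apply Measurable.lintegral_prod_right' (f := fun q : Space d × Space d =>
      ‖κ q.2‖ₑ * ‖v (q.1 - q.2)‖ₑ)
    exact (hκm.comp measurable_snd).mul (hF.comp (measurable_fst.sub measurable_snd))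
  calc eLpNorm (fun x => ∫⁻ z, ‖κ z‖ₑ * ‖v (x - z) - v x‖ₑ) p volume
      ≤ eLpNorm ((fun x => ∫⁻ z, ‖κ z‖ₑ * ‖v (x - z)‖ₑ) + fun x => mass κ * ‖v x‖ₑ) p volume := by
        apply eLpNorm_mono_enorm fun x => ?_
        simp only [enorm_eq_self, Pi.add_apply]
        rw [mass, ← lintegral_mul_const _ hκm, ← lintegral_add_right _ (hκm.mul_const _)]
        refine lintegral_mono fun z => ?_
        rw [← mul_add]
        gcongr
        exact enorm_sub_le
    _ ≤ eLpNorm (fun x => ∫⁻ z, ‖κ z‖ₑ * ‖v (x - z)‖ₑ) p volume +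
        eLpNorm (fun x => mass κ * ‖v x‖ₑ) p volume :=
        eLpNorm_add_le hm.aestronglyMeasurable (hF.const_mul _).aestronglyMeasurable hp
    _ ≤ mass κ * eLpNorm v p volume + mass κ * eLpNorm v p volume := by
        gcongr
        exact eLpNorm_le_mul_of_enorm_le hκ' fun x => by simp
    _ = _ := by ring

end Minkowski

/-! ### Dilated symbols and kernels -/

section Dilation

variable {d : ℕ}

/-- The standard basis vectors. -/
abbrev basisVec (j : Fin d) : Space d := EuclideanSpace.single j (1 : ℝ)

lemma two_zpow_ne_zero (k : ℤ) : (2 : ℝ) ^ k ≠ 0 := zpow_ne_zero k two_ne_zero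

lemma enorm_two_zpow (k : ℤ) : ‖(2 : ℝ) ^ k‖ₑ = (2 : ℝ≥0∞) ^ (k : ℝ) := by
  rw [Real.enorm_eq_ofReal (by positivity), ← Real.rpow_intCast,
    ← ENNReal.ofReal_rpow_of_pos two_pos]
  simp

lemma two_rpow_add (s t : ℝ) : (2 : ℝ≥0∞) ^ (s + t) = 2 ^ s * 2 ^ t :=
  ENNReal.rpow_add _ _ two_ne_zero ENNReal.ofNat_ne_top

lemma two_rpow_ne_zero (s : ℝ) : (2 : ℝ≥0∞) ^ s ≠ 0 := by
  simp [ENNReal.rpow_eq_zero_iff]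

lemma two_rpow_ne_top (s : ℝ) : (2 : ℝ≥0∞) ^ s ≠ ⊤ := by
  simp [ENNReal.rpow_eq_top_iff]

lemma two_rpow_mul_neg (s : ℝ) : (2 : ℝ≥0∞) ^ s * 2 ^ (-s) = 1 := by
  rw [← two_rpow_add]; simp

lemma two_rpow_neg_mul (s : ℝ) : (2 : ℝ≥0∞) ^ (-s) * 2 ^ s = 1 := by
  rw [← two_rpow_add]; simp

lemma lintegral_comp_smul {c : ℝ} (hc : c ≠ 0) {h : Space d → ℝ≥0∞} (hh : Measurable h) :
    ∫⁻ x, h (c • x) = ENNReal.ofReal |(c ^ d)⁻¹| * ∫⁻ x, h x := by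
  have h1 := lintegral_map (μ := (volume : Measure (Space d))) hh (measurable_const_smul c)
  rw [Measure.map_addHaar_smul volume hc, lintegral_smul_measure] at h1
  simpa using h1.symm

/-- The dilated symbol `ψ(2^{-k} ξ)`. -/
def dil (k : ℤ) (ψ : 𝓢(Space d, ℂ)) : 𝓢(Space d, ℂ) :=
  SchwartzMap.compCLMOfContinuousLinearEquiv ℂ
    (ContinuousLinearEquiv.smulLeft (R₁ := ℝ) (M₁ := Space d)
      (Units.mk0 ((2 : ℝ) ^ (-k)) (two_zpow_ne_zero _))) ψ

lemma dil_apply (k : ℤ) (ψ : 𝓢(Space d, ℂ)) (ξ : Space d) :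
    dil k ψ ξ = ψ ((2 : ℝ) ^ (-k) • ξ) := rfl

/-- The symbol `2πi ξ_j ψ(ξ)` of the `j`-th derivative. -/
def dsym (j : Fin d) (ψ : 𝓢(Space d, ℂ)) : 𝓢(Space d, ℂ) :=
  (2 * Real.pi * Complex.I) • SchwartzMap.smulLeftCLM ℂ (fun ξ => inner ℝ ξ (basisVec j)) ψ

lemma dsym_apply (j : Fin d) (ψ : 𝓢(Space d, ℂ)) (ξ : Space d) :
    dsym j ψ ξ = 2 * Real.pi * Complex.I * (ξ j : ℂ) * ψ ξ := by
  have h : (fun ξ : Space d => inner ℝ ξ (basisVec j)).HasTemperateGrowth := by fun_prop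
  rw [dsym, smul_apply, SchwartzMap.smulLeftCLM_apply_apply h]
  simp [EuclideanSpace.inner_single_right, mul_assoc]

/-- The kernel of the Fourier multiplier with the symbol `ψ(2^{-k} ξ)`. -/
def ker (k : ℤ) (ψ : 𝓢(Space d, ℂ)) : 𝓢(Space d, ℂ) := 𝓕⁻ (dil k ψ)

lemma ker_apply (k : ℤ) (ψ : 𝓢(Space d, ℂ)) (x : Space d) :
    ker k ψ x = ((2 : ℝ) ^ k) ^ d • (𝓕⁻ ψ) ((2 : ℝ) ^ k • x) := by
  rw [ker, SchwartzMap.fourierInv_coe, SchwartzMap.fourierInv_coe, Real.fourierInv_eq,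
    Real.fourierInv_eq]
  have h := Measure.integral_comp_smul (volume : Measure (Space d))
    (fun v => Real.fourierChar (inner ℝ v ((2 : ℝ) ^ k • x)) • ψ v) ((2 : ℝ) ^ (-k))
  rw [finrank_euclideanSpace_fin] at h
  have h2 : |(((2 : ℝ) ^ (-k)) ^ d)⁻¹| = ((2 : ℝ) ^ k) ^ d := by
    rw [abs_of_pos (by positivity), zpow_neg, inv_pow, inv_inv]
  rw [h2] at h
  rw [← h]
  congr 1
  ext v
  rw [dil_apply, inner_smul_left, inner_smul_right]
  congr 2
  simp only [conj_trivial]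
  rw [← mul_assoc, ← zpow_add₀ two_ne_zero]
  simp

lemma enorm_ker_apply (k : ℤ) (ψ : 𝓢(Space d, ℂ)) (x : Space d) :
    ‖ker k ψ x‖ₑ = ‖(2 : ℝ) ^ k‖ₑ ^ d * ‖(𝓕⁻ ψ) ((2 : ℝ) ^ k • x)‖ₑ := by
  rw [ker_apply, enorm_smul, enorm_pow]

lemma scale_factor (k : ℤ) :
    ‖(2 : ℝ) ^ k‖ₑ ^ d * ENNReal.ofReal |(((2 : ℝ) ^ k) ^ d)⁻¹| = 1 := by
  rw [← enorm_pow, ← Real.enorm_eq_ofReal_abs, ← enorm_mul, mul_inv_cancel₀ (by positivity)]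
  simp

/-- The `L¹` mass of the kernel of `ψ(D)`. -/
def kmass (ψ : 𝓢(Space d, ℂ)) : ℝ≥0∞ := ∫⁻ z, ‖(𝓕⁻ ψ) z‖ₑ

/-- The first absolute moment of the kernel of `ψ(D)`. -/
def kmoment (ψ : 𝓢(Space d, ℂ)) : ℝ≥0∞ := ∫⁻ z, ‖z‖ₑ * ‖(𝓕⁻ ψ) z‖ₑ

lemma mass_ker (k : ℤ) (ψ : 𝓢(Space d, ℂ)) : mass (ker k ψ) = kmass ψ := by
  have hm : Measurable fun x : Space d => ‖(𝓕⁻ ψ) x‖ₑ := (𝓕⁻ ψ).continuous.measurable.enorm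
  have h := lintegral_comp_smul (two_zpow_ne_zero k) hm
  have hm' : Measurable fun x : Space d => ‖(𝓕⁻ ψ) ((2 : ℝ) ^ k • x)‖ₑ :=
    hm.comp (measurable_const_smul _)
  rw [mass, kmass]
  simp_rw [enorm_ker_apply]
  rw [lintegral_const_mul _ hm', h, ← mul_assoc, scale_factor,
    one_mul]

/-- The kernel is `2^{kd} h(2^k ·)` with `h = 𝓕⁻ ψ`. Dilation preserves its mass and multiplies its
first moment by `2^{-k}`: this is the commutator's gain of one derivative. -/
lemma moment_ker (k : ℤ) (ψ : 𝓢(Space d, ℂ)) :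
    moment (ker k ψ) = 2 ^ (-(k : ℝ)) * kmoment ψ := by
  have hm : Measurable fun x : Space d => ‖x‖ₑ * ‖(𝓕⁻ ψ) x‖ₑ :=
    measurable_id.enorm.mul (𝓕⁻ ψ).continuous.measurable.enorm
  have h := lintegral_comp_smul (two_zpow_ne_zero k) hm
  rw [moment, kmoment]
  have h1 : ∀ z : Space d, ‖z‖ₑ * ‖ker k ψ z‖ₑ = 2 ^ (-(k : ℝ)) * ‖(2 : ℝ) ^ k‖ₑ ^ d *
      (‖(2 : ℝ) ^ k • z‖ₑ * ‖(𝓕⁻ ψ) ((2 : ℝ) ^ k • z)‖ₑ) := by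
    intro z
    rw [enorm_ker_apply, enorm_smul]
    calc _ = 1 * ‖z‖ₑ * (‖(2 : ℝ) ^ k‖ₑ ^ d * ‖(𝓕⁻ ψ) ((2 : ℝ) ^ k • z)‖ₑ) := by rw [one_mul]
      _ = _ := by rw [← two_rpow_neg_mul (k : ℝ), ← enorm_two_zpow k]; ring
  have hm' : Measurable fun x : Space d =>
      ‖(2 : ℝ) ^ k • x‖ₑ * ‖(𝓕⁻ ψ) ((2 : ℝ) ^ k • x)‖ₑ := hm.comp (measurable_const_smul _)
  simp_rw [h1]
  rw [lintegral_const_mul _ hm', h]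
  calc _ = 2 ^ (-(k : ℝ)) * (‖(2 : ℝ) ^ k‖ₑ ^ d * ENNReal.ofReal |(((2 : ℝ) ^ k) ^ d)⁻¹|) *
      ∫⁻ x, ‖x‖ₑ * ‖(𝓕⁻ ψ) x‖ₑ := by ring
    _ = _ := by rw [scale_factor, mul_one]

lemma mass_ne_top (κ : 𝓢(Space d, ℂ)) : mass κ ≠ ⊤ := by
  have := κ.integrable (μ := volume)
  exact this.2.ne

lemma moment_ne_top (κ : 𝓢(Space d, ℂ)) : moment κ ≠ ⊤ := by
  have := κ.integrable_pow_mul (volume : Measure (Space d)) 1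
  have h := this.2.ne
  refine ne_of_eq_of_ne ?_ h
  rw [moment]
  congr 1
  ext z
  simp [enorm_mul]

lemma kmass_ne_top (ψ : 𝓢(Space d, ℂ)) : kmass ψ ≠ ⊤ := mass_ne_top (𝓕⁻ ψ)

lemma kmoment_ne_top (ψ : 𝓢(Space d, ℂ)) : kmoment ψ ≠ ⊤ := moment_ne_top (𝓕⁻ ψ)

lemma dil_dsym (k : ℤ) (j : Fin d) (ψ : 𝓢(Space d, ℂ)) :
    dsym j (dil k ψ) = ((2 : ℝ) ^ k : ℂ) • dil k (dsym j ψ) := by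
  ext ξ
  rw [smul_apply, dil_apply, dsym_apply, dsym_apply, dil_apply]
  simp only [PiLp.smul_apply, smul_eq_mul, zpow_neg]
  push_cast
  have : (2 : ℂ) ^ k ≠ 0 := zpow_ne_zero k two_ne_zero
  field_simp

lemma fderiv_ker (k : ℤ) (j : Fin d) (ψ : 𝓢(Space d, ℂ)) (x : Space d) :
    fderiv ℝ (ker k ψ) x (basisVec j) = ((2 : ℝ) ^ k : ℂ) * ker k (dsym j ψ) x := by
  have h : ∂_{basisVec j} (𝓕⁻ (dil k ψ)) = 𝓕⁻ (dsym j (dil k ψ)) :=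
    SchwartzMap.lineDerivOp_fourierInv_eq _ _
  rw [dil_dsym, FourierTransform.fourierInv_smul] at h
  have h2 := congrArg (fun f : 𝓢(Space d, ℂ) => f x) h
  simp only [SchwartzMap.lineDerivOp_apply_eq_fderiv] at h2
  exact h2

end Dilation

/-! ### Frequency localized functions -/

section FrequencyBlocks

variable {d : ℕ}

/-- The function with the Fourier transform `ρ(2^{-q} ξ) F(ξ)`. -/
def blk (q : ℤ) (ρ : 𝓢(Space d, ℂ)) (F : Space d → ℂ) : Space d → ℂ :=
  𝓕⁻ fun ξ => dil q ρ ξ * F ξ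

lemma integrable_schwartz_mul (ψ : 𝓢(Space d, ℂ)) {F : Space d → ℂ} (hF : Integrable F) :
    Integrable fun ξ => ψ ξ * F ξ := by
  obtain ⟨C, hC⟩ : ∃ C, ∀ x, ‖ψ x‖ ≤ C := ⟨_, ψ.norm_le_seminorm ℝ⟩
  exact hF.bdd_mul ψ.continuous.aestronglyMeasurable (Filter.Eventually.of_forall hC)

lemma continuous_blk (q : ℤ) (ρ : 𝓢(Space d, ℂ)) {F : Space d → ℂ} (hF : Integrable F) :
    Continuous (blk q ρ F) := continuous_fourierInv (integrable_schwartz_mul _ hF)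

/-- `blk q ρ F` is the convolution of `𝓕⁻ F` with a kernel whose mass does not depend on `q`. With
`ρ` containing the Riesz symbol, this replaces the missing boundedness of `R` on `L^∞`. -/
lemma enorm_blk_le (q : ℤ) (ρ : 𝓢(Space d, ℂ)) {F : Space d → ℂ} (hF : Integrable F)
    (x : Space d) : ‖blk q ρ F x‖ₑ ≤ kmass ρ * eLpNorm (𝓕⁻ F) ∞ volume := by
  rw [blk, ← (isFourierPair_fourierInv hF).convolution_eq (dil q ρ) x, ← mass_ker q, mass]
  have hm : Measurable fun y : Space d => ‖ker q ρ y‖ₑ := (ker q ρ).continuous.measurable.enorm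
  refine (enorm_integral_le_lintegral_enorm _).trans ?_
  rw [← lintegral_sub_left_eq_self (fun y => ‖ker q ρ y‖ₑ) x, ← lintegral_mul_const]
  · apply lintegral_mono_ae
    filter_upwards [enorm_ae_le_eLpNormEssSup (𝓕⁻ F) volume] with y hy
    rw [enorm_mul, eLpNorm_exponent_top]
    exact mul_le_mul_right hy _
  · exact hm.comp (measurable_const.sub measurable_id)

lemma hasFDerivAt_fourierInv {F : Space d → ℂ} (h1 : Integrable F)
    (h2 : Integrable fun ξ => ‖ξ‖ * ‖F ξ‖) (x : Space d) :
    DifferentiableAt ℝ (𝓕⁻ F) x ∧ ∀ j, fderiv ℝ (𝓕⁻ F) x (basisVec j) =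
      𝓕⁻ (fun ξ => 2 * Real.pi * Complex.I * (ξ j : ℂ) * F ξ) x := by
  have he : 𝓕⁻ F = (𝓕 F) ∘ fun y => -y := funext fun x => Real.fourierInv_eq_fourier_neg F x
  have hd := (Real.hasFDerivAt_fourier h1 h2 (-x)).comp x (hasFDerivAt_id x).neg
  rw [he]
  refine ⟨hd.differentiableAt, fun j => ?_⟩
  have hc : fderiv ℝ ((𝓕 F) ∘ fun y => -y) x = _ := HasFDerivAt.fderiv hd
  rw [hc]
  simp only [ContinuousLinearMap.comp_apply, _root_.neg_apply, ContinuousLinearMap.id_apply,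
    map_neg]
  have hint : Integrable (VectorFourier.fourierSMulRight (innerSL ℝ) F) := by
    have hm : AEStronglyMeasurable
        (fun ξ => VectorFourier.fourierSMulRight (innerSL ℝ (E := Space d)) F ξ) volume :=
      h1.aestronglyMeasurable.fourierSMulRight
    refine (h2.const_mul (2 * Real.pi * ‖innerSL ℝ (E := Space d)‖)).mono' hm ?_
    refine Filter.Eventually.of_forall fun ξ => ?_
    have := VectorFourier.norm_fourierSMulRight_le (innerSL ℝ (E := Space d)) F ξ
    linarith
  rw [Real.fourier_continuousLinearMap_apply hint, Real.fourierInv_eq_fourier_neg,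
    Real.fourier_eq, Real.fourier_eq, ← integral_neg]
  congr 1
  ext ξ
  rw [VectorFourier.fourierSMulRight_apply, ← smul_neg]
  congr 1
  rw [innerSL_apply_apply, EuclideanSpace.inner_single_right]
  simp [mul_assoc]

lemma integrable_norm_mul_schwartz (ψ : 𝓢(Space d, ℂ)) {F : Space d → ℂ} (hF : Integrable F) :
    Integrable fun ξ => ‖ξ‖ * ‖ψ ξ * F ξ‖ := by
  have hb : ∀ ξ, ‖‖ξ‖ * ‖ψ ξ‖‖ ≤ SchwartzMap.seminorm ℝ 1 0 ψ := by
    intro ξ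
    have := ψ.norm_pow_mul_le_seminorm ℝ 1 ξ
    rw [Real.norm_of_nonneg (by positivity)]
    simpa using this
  have := hF.norm.bdd_mul (f := fun ξ : Space d => ‖ξ‖ * ‖ψ ξ‖)
    (continuous_norm.mul ψ.continuous.norm).aestronglyMeasurable
    (Filter.Eventually.of_forall hb)
  simpa [mul_assoc] using this

lemma differentiable_blk (q : ℤ) (ρ : 𝓢(Space d, ℂ)) {F : Space d → ℂ} (hF : Integrable F) :
    Differentiable ℝ (blk q ρ F) := fun x =>
  (hasFDerivAt_fourierInv (integrable_schwartz_mul _ hF) (integrable_norm_mul_schwartz _ hF) x).1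

lemma fderiv_blk (q : ℤ) (ρ : 𝓢(Space d, ℂ)) {F : Space d → ℂ} (hF : Integrable F)
    (x : Space d) (j : Fin d) :
    fderiv ℝ (blk q ρ F) x (basisVec j) = ((2 : ℝ) ^ q : ℂ) * blk q (dsym j ρ) F x := by
  have h := (hasFDerivAt_fourierInv (integrable_schwartz_mul (dil q ρ) hF)
    (integrable_norm_mul_schwartz _ hF) x).2 j
  rw [blk, h, blk, Real.fourierInv_eq, Real.fourierInv_eq, ← integral_const_mul]
  congr 1
  ext ξ
  have h2 := congrArg (fun f : 𝓢(Space d, ℂ) => f ξ) (dil_dsym q j ρ)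
  simp only [dsym_apply, smul_apply, smul_eq_mul] at h2
  rw [Circle.smul_def, Circle.smul_def, smul_eq_mul, smul_eq_mul]
  linear_combination ((Real.fourierChar (inner ℝ ξ x) : Circle) : ℂ) * F ξ * h2

end FrequencyBlocks

/-! ### The bilinear operator behind the commutator -/

section Bilinear

variable {d : ℕ}

/-- The commutator `∫ κ(x - y) (a(y) - a(x)) g(y) dy` of the convolution with `κ` and the
multiplication by `a`, applied to `g`. -/
def bil (κ : Space d → ℂ) (a : Space d → ℝ) (g : Space d → ℂ) (x : Space d) : ℂ :=
  ∫ y, κ (x - y) * ((a y - a x : ℝ) : ℂ) * g y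

lemma enorm_bil_le {κ : Space d → ℂ} (hκ : Continuous κ) {a : Space d → ℝ} (ha : Continuous a)
    {g : Space d → ℂ} {b : ℝ≥0∞} (hg : ∀ y, ‖g y‖ₑ ≤ b) (x : Space d) :
    ‖bil κ a g x‖ₑ ≤ b * ∫⁻ z, ‖κ z‖ₑ * ‖a (x - z) - a x‖ₑ := by
  have hm : Measurable fun z => ‖κ z‖ₑ * ‖a (x - z) - a x‖ₑ := by
    apply Measurable.mul hκ.measurable.enorm
    exact ((ha.comp (continuous_const.sub continuous_id)).sub continuous_const).measurable.enorm
  rw [bil, ← lintegral_sub_left_eq_self _ x, ← lintegral_const_mul]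
  · refine (enorm_integral_le_lintegral_enorm _).trans (lintegral_mono fun y => ?_)
    rw [enorm_mul, enorm_mul, mul_comm, sub_sub_cancel]
    have : ‖((a y - a x : ℝ) : ℂ)‖ₑ = ‖a y - a x‖ₑ := by
      rw [← ofReal_norm, ← ofReal_norm, Complex.norm_real]
    rw [this]
    exact mul_le_mul_left (hg y) _
  · exact hm.comp (measurable_const.sub measurable_id)

theorem eLpNorm_bil_le {κ : Space d → ℂ} (hκ : Continuous κ) (hκ' : moment κ ≠ ⊤)
    {a : Space d → ℝ} (ha : ContDiff ℝ ∞ a) {g : Space d → ℂ} {b : ℝ≥0∞} (hb : b ≠ ⊤)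
    (hg : ∀ y, ‖g y‖ₑ ≤ b) {p : ℝ≥0∞} (hp : 1 ≤ p) :
    eLpNorm (bil κ a g) p volume ≤ b * moment κ * eLpNorm (fderiv ℝ a) p volume := by
  rw [mul_assoc]
  refine (eLpNorm_le_mul_of_enorm_le hb fun x => ?_).trans
    (mul_le_mul_right (eLpNorm_lintegral_diff_le hκ hκ' ha hp) b)
  exact enorm_bil_le hκ ha.continuous hg x

theorem eLpNorm_bil_le_two {κ : Space d → ℂ} (hκ : Continuous κ) (hκ' : mass κ ≠ ⊤)
    {a : Space d → ℝ} (ha : Continuous a) {g : Space d → ℂ} {b : ℝ≥0∞} (hb : b ≠ ⊤)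
    (hg : ∀ y, ‖g y‖ₑ ≤ b) {p : ℝ≥0∞} (hp : 1 ≤ p) :
    eLpNorm (bil κ a g) p volume ≤ b * (2 * mass κ * eLpNorm a p volume) := by
  refine (eLpNorm_le_mul_of_enorm_le hb fun x => ?_).trans
    (mul_le_mul_right (eLpNorm_lintegral_diff_le_two hκ hκ' ha hp) b)
  exact enorm_bil_le hκ ha hg x

theorem eLpNorm_convolution_mul_le {κ : Space d → ℂ} (hκ : Continuous κ) (hκ' : mass κ ≠ ⊤)
    {w : Space d → ℝ} {W : Space d → ℝ≥0∞} (hW : Measurable W)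
    (hwW : ∀ y, ‖w y‖ₑ ≤ W y) {g : Space d → ℂ}
    {b : ℝ≥0∞} (hb : b ≠ ⊤) (hg : ∀ y, ‖g y‖ₑ ≤ b) {p : ℝ≥0∞} (hp : 1 ≤ p) :
    eLpNorm (fun x => ∫ y, κ (x - y) * (w y : ℂ) * g y) p volume ≤
      b * mass κ * eLpNorm W p volume := by
  rw [mul_assoc]
  refine (eLpNorm_le_mul_of_enorm_le hb fun x => ?_).trans
    (mul_le_mul_right (eLpNorm_lintegral_mul_le hκ hκ' hW hp) b)
  have hm : Measurable fun z => ‖κ z‖ₑ * W (x - z) :=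
    hκ.measurable.enorm.mul (hW.comp (measurable_const.sub measurable_id))
  rw [enorm_eq_self, ← lintegral_sub_left_eq_self _ x, ← lintegral_const_mul]
  · refine (enorm_integral_le_lintegral_enorm _).trans (lintegral_mono fun y => ?_)
    rw [enorm_mul, enorm_mul, mul_comm, sub_sub_cancel]
    have : ‖(w y : ℂ)‖ₑ = ‖w y‖ₑ := by
      rw [← ofReal_norm, ← ofReal_norm, Complex.norm_real]
    rw [this]
    exact mul_le_mul' (hg y) (mul_le_mul_right (hwW y) _)
  · exact hm.comp (measurable_const.sub measurable_id)

lemma measurable_bil {κ : Space d → ℂ} (hκ : Continuous κ) {a : Space d → ℝ} (ha : Continuous a)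
    {g : Space d → ℂ} (hg : AEStronglyMeasurable g volume) :
    AEStronglyMeasurable (bil κ a g) volume := by
  have h1 : AEStronglyMeasurable (fun q : Space d × Space d =>
      κ (q.1 - q.2) * ((a q.2 - a q.1 : ℝ) : ℂ) * g q.2)
      ((volume : Measure (Space d)).prod (volume : Measure (Space d))) := by
    apply AEStronglyMeasurable.mul
    · apply Continuous.aestronglyMeasurable
      fun_prop
    · exact hg.comp_snd
  exact h1.integral_prod_right'

lemma memLp_translate (κ : 𝓢(Space d, ℂ)) (x : Space d) (p : ℝ≥0∞) :
    MemLp (fun y => κ (x - y)) p volume :=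
  (κ.memLp p volume).comp_measurePreserving (Measure.measurePreserving_sub_left volume x)

lemma memLp_two_translate_mul_diff (κ : 𝓢(Space d, ℂ)) {a : Space d → ℝ} (ha : MemLp a 2 volume)
    (x : Space d) : MemLp (fun y => κ (x - y) * ((a y - a x : ℝ) : ℂ)) 2 volume := by
  have h1 : MemLp (fun y => κ (x - y) * (a y : ℂ)) 2 volume := by
    obtain ⟨C, hC⟩ : ∃ C, ∀ x, ‖κ x‖ ≤ C := ⟨_, κ.norm_le_seminorm ℝ⟩
    refine MemLp.of_le_mul (c := C) ha ?_ (Filter.Eventually.of_forall fun y => ?_)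
    · exact (memLp_translate κ x 2).1.mul ha.ofReal.1
    · rw [norm_mul, Complex.norm_real]
      gcongr
      exact hC _
  have h2 : MemLp (fun y => κ (x - y) * (a x : ℂ)) 2 volume :=
    (memLp_translate κ x 2).mul_const _
  convert h1.sub h2 using 1
  ext y
  simp [mul_sub]

lemma integrable_translate_mul_diff (κ : 𝓢(Space d, ℂ)) {a : Space d → ℝ}
    (ha : MemLp a 2 volume) (x : Space d) :
    Integrable (fun y => κ (x - y) * ((a y - a x : ℝ) : ℂ)) volume := by
  have h1 : Integrable (fun y => κ (x - y) * (a y : ℂ)) volume :=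
    (memLp_translate κ x 2).integrable_mul ha.ofReal
  have h2 : Integrable (fun y => κ (x - y) * (a x : ℂ)) volume :=
    ((memLp_one_iff_integrable.1 (memLp_translate κ x 1))).mul_const _
  convert h1.sub h2 using 1
  ext y
  simp [mul_sub]

lemma integrable_translate_mul_of_memLp (κ : 𝓢(Space d, ℂ)) {w : Space d → ℝ} {p : ℝ≥0∞}
    (hp : 1 ≤ p) (hw : MemLp w p volume) (x : Space d) :
    Integrable (fun y => κ (x - y) * (w y : ℂ)) volume := by
  have := ENNReal.HolderConjugate.inv_one_sub_inv' hp
  have h2 := hw.ofReal (K := ℂ)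
  have h1 := h2.integrable_mul (memLp_translate κ x (1 - p⁻¹)⁻¹)
  convert h1 using 1
  ext y
  exact mul_comm _ _

lemma Integrable.mul_bdd_enorm {f g : Space d → ℂ} (hf : Integrable f) (hg : Continuous g)
    {b : ℝ≥0∞} (hb : b ≠ ⊤) (hgb : ∀ y, ‖g y‖ₑ ≤ b) : Integrable fun y => f y * g y := by
  lift b to ℝ≥0 using hb
  refine hf.mul_bdd (c := b) hg.aestronglyMeasurable (Filter.Eventually.of_forall fun y => ?_)
  have := hgb y
  rw [← ofReal_norm] at this
  exact (ENNReal.ofReal_le_coe).1 this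

lemma integrable_bil (κ : 𝓢(Space d, ℂ)) {a : Space d → ℝ} (ha : MemLp a 2 volume)
    {g : Space d → ℂ} (hg : Continuous g) {b : ℝ≥0∞} (hb : b ≠ ⊤) (hgb : ∀ y, ‖g y‖ₑ ≤ b)
    (x : Space d) : Integrable (fun y => κ (x - y) * ((a y - a x : ℝ) : ℂ) * g y) volume :=
  Integrable.mul_bdd_enorm (integrable_translate_mul_diff κ ha x) hg hb hgb

/-- The integration by parts formula for the bilinear operator. -/
theorem integral_by_parts (κ : 𝓢(Space d, ℂ)) {a : Space d → ℝ} (ha : ContDiff ℝ ∞ a)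
    (ha2 : MemLp a 2 volume) {p : ℝ≥0∞} (hp : 1 ≤ p) (hap : MemLp (fderiv ℝ a) p volume)
    {g : Space d → ℂ} (hg : Differentiable ℝ g) {b b' : ℝ≥0∞} (hb : b ≠ ⊤) (hb' : b' ≠ ⊤)
    (hgb : ∀ y, ‖g y‖ₑ ≤ b) (j : Fin d) (hgc : Continuous fun y => fderiv ℝ g y (basisVec j))
    (hgb' : ∀ y, ‖fderiv ℝ g y (basisVec j)‖ₑ ≤ b') (x : Space d) :
    bil κ a (fun y => fderiv ℝ g y (basisVec j)) x =
      bil (fun y => fderiv ℝ κ y (basisVec j)) a g x -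
        ∫ y, κ (x - y) * (fderiv ℝ a y (basisVec j) : ℂ) * g y := by
  -- The derivative in `y` falls on `κ(x - ·)`, with a sign that makes this term positive after
  -- integration by parts, and on `a`, which yields the second term.
  set u : Space d → ℂ := fun y => κ (x - y) * ((a y - a x : ℝ) : ℂ)
  have hκd : ∀ y, HasFDerivAt (fun y => κ (x - y)) (-(fderiv ℝ κ (x - y))) y := by
    intro y
    have h1 : HasFDerivAt (fun y : Space d => x - y) (-ContinuousLinearMap.id ℝ (Space d)) y :=
      (hasFDerivAt_id y).const_sub x
    have h2 := (κ.hasFDerivAt (x - y)).comp y h1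
    convert! h2 using 1
    ext v
    simp
  have had : ∀ y, HasFDerivAt (fun y => ((a y - a x : ℝ) : ℂ))
      (Complex.ofRealCLM.comp (fderiv ℝ a y)) y := by
    intro y
    have h1 : HasFDerivAt (fun y => a y - a x) (fderiv ℝ a y) y :=
      ((ha.differentiable (by simp)) y).hasFDerivAt.sub_const _
    exact Complex.ofRealCLM.hasFDerivAt.comp y h1
  have hud : ∀ y, HasFDerivAt u (κ (x - y) • (Complex.ofRealCLM.comp (fderiv ℝ a y)) +
      ((a y - a x : ℝ) : ℂ) • (-(fderiv ℝ κ (x - y)))) y := fun y => (hκd y).mul (had y)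
  have hue : ∀ y, fderiv ℝ u y (basisVec j) = κ (x - y) * (fderiv ℝ a y (basisVec j) : ℂ) -
      fderiv ℝ κ (x - y) (basisVec j) * ((a y - a x : ℝ) : ℂ) := by
    intro y
    rw [(hud y).fderiv]
    simp; ring
  have hw : MemLp (fun y => fderiv ℝ a y (basisVec j)) p volume := by
    refine MemLp.of_le hap ?_ (Filter.Eventually.of_forall fun y => ?_)
    · have := ha.continuous_fderiv (by simp)
      apply Continuous.aestronglyMeasurable
      fun_prop
    · refine ((fderiv ℝ a y).le_opNorm _).trans ?_
      simp
  have i1 : Integrable fun y => κ (x - y) * (fderiv ℝ a y (basisVec j) : ℂ) * g y :=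
    Integrable.mul_bdd_enorm (integrable_translate_mul_of_memLp κ hp hw x) hg.continuous hb hgb
  have i2 : Integrable fun y => fderiv ℝ κ (x - y) (basisVec j) * ((a y - a x : ℝ) : ℂ) * g y :=
    integrable_bil (∂_{basisVec j} κ) ha2 hg.continuous hb hgb x
  have i3 : Integrable fun y => u y * fderiv ℝ g y (basisVec j) :=
    integrable_bil κ ha2 hgc hb' hgb' x
  have i4 : Integrable fun y => u y * g y := integrable_bil κ ha2 hg.continuous hb hgb x
  have e1 : (fun y => fderiv ℝ u y (basisVec j) * g y) = fun y =>
      κ (x - y) * (fderiv ℝ a y (basisVec j) : ℂ) * g y -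
      fderiv ℝ κ (x - y) (basisVec j) * ((a y - a x : ℝ) : ℂ) * g y := by
    ext y; rw [hue y]; ring
  have h := integral_mul_fderiv_eq_neg_fderiv_mul_of_integrable (μ := volume) (f := u) (g := g)
    (v := basisVec j) (by rw [e1]; exact i1.sub i2) i3 i4
    (fun y _ => (hud y).differentiableAt) (fun y _ => hg y)
  rw [bil, h, e1, integral_sub i1 i2, bil]
  ring

end Bilinear

/-! ### Estimates for frequency localized functions -/

section Estimates

variable {d : ℕ}

/-- Integration by parts between the two frequency scales. -/
theorem bil_blk_by_parts (k q : ℤ) (ψ ρ : 𝓢(Space d, ℂ)) {a : Space d → ℝ}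
    (ha : ContDiff ℝ ∞ a) (ha2 : MemLp a 2 volume) {p : ℝ≥0∞} (hp : 1 ≤ p)
    (hap : MemLp (fderiv ℝ a) p volume) {F : Space d → ℂ} (hF : Integrable F)
    (hb : eLpNorm (𝓕⁻ F) ∞ volume ≠ ⊤) (j : Fin d) (x : Space d) :
    ((2 : ℝ) ^ q : ℂ) * bil (ker k ψ) a (blk q (dsym j ρ) F) x =
      ((2 : ℝ) ^ k : ℂ) * bil (ker k (dsym j ψ)) a (blk q ρ F) x -
        ∫ y, ker k ψ (x - y) * (fderiv ℝ a y (basisVec j) : ℂ) * blk q ρ F y := by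
  have hfe : (fun y => fderiv ℝ (blk q ρ F) y (basisVec j)) =
      fun y => ((2 : ℝ) ^ q : ℂ) * blk q (dsym j ρ) F y := funext fun y => fderiv_blk q ρ hF y j
  have hc : Continuous fun y => ((2 : ℝ) ^ q : ℂ) * blk q (dsym j ρ) F y :=
    continuous_const.mul (continuous_blk q _ hF)
  have h := integral_by_parts (ker k ψ) ha ha2 hp hap (differentiable_blk q ρ hF)
    (ENNReal.mul_ne_top (kmass_ne_top ρ) hb)
    (b' := ‖((2 : ℝ) ^ q : ℂ)‖ₑ * (kmass (dsym j ρ) * eLpNorm (𝓕⁻ F) ∞ volume))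
    (ENNReal.mul_ne_top enorm_ne_top (ENNReal.mul_ne_top (kmass_ne_top _) hb))
    (enorm_blk_le q ρ hF) j (by rw [hfe]; exact hc)
    (fun y => by
      rw [fderiv_blk q ρ hF, enorm_mul]
      exact mul_le_mul_right (enorm_blk_le q _ hF y) _) x
  have hke : (fun y => fderiv ℝ (ker k ψ) y (basisVec j)) =
      fun y => ((2 : ℝ) ^ k : ℂ) * ker k (dsym j ψ) y := funext fun y => fderiv_ker k j ψ y
  rw [hfe, hke] at h
  rw [bil, bil, ← integral_const_mul, ← integral_const_mul]
  rw [bil, bil] at h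
  convert! h using 1
  · congr 1; ext y; ring
  · congr 2; ext y; ring

/-- The estimate without gain from the frequency of the second factor. -/
theorem eLpNorm_bil_blk_le (k q : ℤ) (ψ ρ : 𝓢(Space d, ℂ)) {a : Space d → ℝ}
    (ha : ContDiff ℝ ∞ a) {p : ℝ≥0∞} (hp : 1 ≤ p) {F : Space d → ℂ} (hF : Integrable F)
    (hb : eLpNorm (𝓕⁻ F) ∞ volume ≠ ⊤) :
    eLpNorm (bil (ker k ψ) a (blk q ρ F)) p volume ≤
      2 ^ (-(k : ℝ)) * (kmass ρ * kmoment ψ) *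
        (eLpNorm (fderiv ℝ a) p volume * eLpNorm (𝓕⁻ F) ∞ volume) := by
  refine (eLpNorm_bil_le (ker k ψ).continuous (moment_ne_top _) ha
    (ENNReal.mul_ne_top (kmass_ne_top ρ) hb) (enorm_blk_le q ρ hF) hp).trans (le_of_eq ?_)
  rw [moment_ker]
  ring

theorem eLpNorm_bil_blk_le_two (k q : ℤ) (ψ ρ : 𝓢(Space d, ℂ)) {a : Space d → ℝ}
    (ha : ContDiff ℝ ∞ a) {p : ℝ≥0∞} (hp : 1 ≤ p) {F : Space d → ℂ} (hF : Integrable F)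
    (hb : eLpNorm (𝓕⁻ F) ∞ volume ≠ ⊤) :
    eLpNorm (bil (ker k ψ) a (blk q ρ F)) p volume ≤
      2 * (kmass ρ * kmass ψ) * (eLpNorm a p volume * eLpNorm (𝓕⁻ F) ∞ volume) := by
  refine (eLpNorm_bil_le_two (ker k ψ).continuous (mass_ne_top _) ha.continuous
    (ENNReal.mul_ne_top (kmass_ne_top ρ) hb) (enorm_blk_le q ρ hF) hp).trans (le_of_eq ?_)
  rw [mass_ker]
  ring

lemma bil_zero_right (κ : Space d → ℂ) (a : Space d → ℝ) {g : Space d → ℂ} (hg : ∀ y, g y = 0) :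
    bil κ a g = fun _ => 0 := by
  ext x; simp [bil, hg]

lemma blk_eq_zero (q : ℤ) (ρ : 𝓢(Space d, ℂ)) {F : Space d → ℂ} (hF : Integrable F)
    (hb : eLpNorm (𝓕⁻ F) ∞ volume = 0) (y : Space d) : blk q ρ F y = 0 := by
  have := enorm_blk_le q ρ hF y
  rwa [hb, mul_zero, nonpos_iff_eq_zero, enorm_eq_zero] at this

/-- The estimate with a gain from the frequency of the second factor. -/
theorem eLpNorm_bil_blk_dsym_le (k q : ℤ) (ψ ρ : 𝓢(Space d, ℂ)) {a : Space d → ℝ}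
    (ha : ContDiff ℝ ∞ a) (ha2 : MemLp a 2 volume) {p : ℝ≥0∞} (hp : 1 ≤ p)
    {F : Space d → ℂ} (hF : Integrable F) (hb : eLpNorm (𝓕⁻ F) ∞ volume ≠ ⊤) (j : Fin d) :
    eLpNorm (bil (ker k ψ) a (blk q (dsym j ρ) F)) p volume ≤
      2 ^ (-(q : ℝ)) * ((kmass ρ + 1) * (kmoment (dsym j ψ) + kmass ψ + 1)) *
        (eLpNorm (fderiv ℝ a) p volume * eLpNorm (𝓕⁻ F) ∞ volume) := by
  set b := eLpNorm (𝓕⁻ F) ∞ volume with hbdef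
  rcases eq_or_ne b 0 with h0 | h0
  · rw [bil_zero_right _ _ (blk_eq_zero q _ hF h0)]
    simp
  -- The summands `+ 1` in the constant keep it nonzero, so an infinite gradient norm makes the
  -- right side infinite.
  by_cases hap : eLpNorm (fderiv ℝ a) p volume = ⊤
  · rw [hap, ENNReal.top_mul h0, ENNReal.mul_top]
    · exact le_top
    · exact mul_ne_zero (two_rpow_ne_zero _) (mul_ne_zero (by simp) (by simp))
  have hfc := ha.continuous_fderiv (by simp)
  have hap' : MemLp (fderiv ℝ a) p volume := ⟨hfc.aestronglyMeasurable, lt_top_iff_ne_top.2 hap⟩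
  have hbρ := ENNReal.mul_ne_top (kmass_ne_top ρ) hb
  have hq : ((2 : ℝ) ^ q : ℂ) ≠ 0 := by exact_mod_cast two_zpow_ne_zero q
  set w : Space d → ℝ := fun y => fderiv ℝ a y (basisVec j)
  have hwc : Continuous w := by fun_prop
  have e : bil (ker k ψ) a (blk q (dsym j ρ) F) = (((2 : ℝ) ^ q : ℂ))⁻¹ •
      ((((2 : ℝ) ^ k : ℂ) • bil (ker k (dsym j ψ)) a (blk q ρ F)) -
        fun x => ∫ y, ker k ψ (x - y) * (w y : ℂ) * blk q ρ F y) := by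
    ext x
    have := bil_blk_by_parts k q ψ ρ ha ha2 hp hap' hF hb j x
    simp only [Pi.smul_apply, Pi.sub_apply, smul_eq_mul]
    rw [← this, inv_mul_cancel_left₀ hq]
  have n1 : ‖(((2 : ℝ) ^ q : ℂ))⁻¹‖ₑ = 2 ^ (-(q : ℝ)) := by
    have : (((2 : ℝ) ^ q : ℂ))⁻¹ = (((2 : ℝ) ^ (-q) : ℝ) : ℂ) := by
      push_cast; rw [zpow_neg]
    rw [this, ← ofReal_norm, Complex.norm_real, ofReal_norm, enorm_two_zpow]
    simp
  have n2 : ‖((2 : ℝ) ^ k : ℂ)‖ₑ = 2 ^ (k : ℝ) := by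
    have : ((2 : ℝ) ^ k : ℂ) = (((2 : ℝ) ^ k : ℝ) : ℂ) := by push_cast; rfl
    rw [this, ← ofReal_norm, Complex.norm_real, ofReal_norm, enorm_two_zpow]
  have m1 := measurable_bil (ker k (dsym j ψ)).continuous ha.continuous
    (continuous_blk q ρ hF).aestronglyMeasurable
  have m2 : AEStronglyMeasurable (fun x => ∫ y, ker k ψ (x - y) * (w y : ℂ) * blk q ρ F y)
      volume := by
    have h1 : AEStronglyMeasurable (fun z : Space d × Space d =>
        ker k ψ (z.1 - z.2) * (w z.2 : ℂ) * blk q ρ F z.2)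
        ((volume : Measure (Space d)).prod (volume : Measure (Space d))) := by
      apply Continuous.aestronglyMeasurable
      have := continuous_blk q ρ hF
      have := (ker k ψ).continuous
      fun_prop
    exact h1.integral_prod_right'
  rw [e, eLpNorm_const_smul, n1]
  have s1 := eLpNorm_bil_blk_le k q (dsym j ψ) ρ ha hp hF hb
  have s2 := eLpNorm_convolution_mul_le (ker k ψ).continuous (mass_ne_top _) (w := w)
    (W := fun y => ‖fderiv ℝ a y‖ₑ) hfc.measurable.enorm
    (fun y => by
      refine ((fderiv ℝ a y).le_opENorm _).trans ?_
      simp [enorm_eq_nnnorm]) hbρ (enorm_blk_le q ρ hF) hp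
  rw [eLpNorm_enorm, mass_ker] at s2
  have s3 := eLpNorm_sub_le (m1.const_smul ((2 : ℝ) ^ k : ℂ)) m2 hp
  rw [eLpNorm_const_smul, n2] at s3
  rw [mul_assoc]
  refine mul_le_mul_right (s3.trans ?_) _
  set A := eLpNorm (fderiv ℝ a) p volume
  -- The factor `2^k` from differentiating the kernel cancels the `2^{-k}` of its first moment, so
  -- both terms have size one and only the prefactor `2^{-q}` remains.
  calc _ ≤ 2 ^ (k : ℝ) * (2 ^ (-(k : ℝ)) * (kmass ρ * kmoment (dsym j ψ)) * (A * b)) +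
        kmass ρ * b * kmass ψ * A := add_le_add (mul_le_mul_right s1 _) s2
    _ = (2 ^ (k : ℝ) * 2 ^ (-(k : ℝ))) * (kmass ρ * kmoment (dsym j ψ)) * (A * b) +
        kmass ρ * kmass ψ * (A * b) := by ring
    _ = kmass ρ * (kmoment (dsym j ψ) + kmass ψ) * (A * b) := by rw [two_rpow_mul_neg]; ring
    _ ≤ _ := mul_le_mul_left (mul_le_mul' le_self_add le_self_add) _

lemma blk_sum (q : ℤ) {ι : Type*} (s : Finset ι) (ρ : ι → 𝓢(Space d, ℂ)) {F : Space d → ℂ}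
    (hF : Integrable F) (y : Space d) :
    blk q (∑ j ∈ s, ρ j) F y = ∑ j ∈ s, blk q (ρ j) F y := by
  simp only [blk, Real.fourierInv_eq]
  rw [← integral_finsetSum]
  · congr 1
    ext ξ
    rw [← Finset.smul_sum, ← Finset.sum_mul]
    simp [dil_apply]
  · intro j _
    have h := integrable_schwartz_mul (dil q (ρ j)) hF
    have := (Real.fourierIntegral_convergent_iff (-y)).2 h
    simpa using this

/-- The estimate with a gain, for symbols which are sums of derivatives. -/
theorem eLpNorm_bil_blk_le_of_sum (k q : ℤ) (ψ : 𝓢(Space d, ℂ)) (σ : Fin d → 𝓢(Space d, ℂ))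
    {ρ : 𝓢(Space d, ℂ)} (hρ : ρ = ∑ j, dsym j (σ j)) {a : Space d → ℝ}
    (ha : ContDiff ℝ ∞ a) (ha2 : MemLp a 2 volume) {p : ℝ≥0∞} (hp : 1 ≤ p)
    {F : Space d → ℂ} (hF : Integrable F) (hb : eLpNorm (𝓕⁻ F) ∞ volume ≠ ⊤) :
    eLpNorm (bil (ker k ψ) a (blk q ρ F)) p volume ≤
      2 ^ (-(q : ℝ)) * (∑ j, (kmass (σ j) + 1) * (kmoment (dsym j ψ) + kmass ψ + 1)) *
        (eLpNorm (fderiv ℝ a) p volume * eLpNorm (𝓕⁻ F) ∞ volume) := by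
  have e : bil (ker k ψ) a (blk q ρ F) =
      ∑ j, bil (ker k ψ) a (blk q (dsym j (σ j)) F) := by
    ext x
    rw [Finset.sum_apply]
    simp only [bil]
    rw [← integral_finsetSum]
    · congr 1
      ext y
      rw [hρ, blk_sum q _ _ hF, Finset.mul_sum]
    · intro j _
      exact integrable_bil _ ha2 (continuous_blk q _ hF)
        (ENNReal.mul_ne_top (kmass_ne_top _) hb) (enorm_blk_le q _ hF) x
  rw [e]
  refine (eLpNorm_sum_le (fun j _ => measurable_bil (ker k ψ).continuous ha.continuous
    (continuous_blk q _ hF).aestronglyMeasurable) hp).trans ?_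
  rw [Finset.mul_sum, Finset.sum_mul]
  exact Finset.sum_le_sum fun j _ => eLpNorm_bil_blk_dsym_le k q ψ (σ j) ha ha2 hp hF hb j

/-! ### Components of the vector field and the operator in divergence form. -/

lemma fderiv_coord {v : Space d → Space d} (hv : ContDiff ℝ ∞ v) (i : Fin d) (x e : Space d) :
    fderiv ℝ (fun x => v x i) x e = fderiv ℝ v x e i := by
  have h := ((EuclideanSpace.proj (𝕜 := ℝ) i).hasFDerivAt (x := v x)).comp x
    ((hv.differentiable (by simp)) x).hasFDerivAt
  have h2 : HasFDerivAt (fun x => v x i) _ x := h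
  rw [h2.fderiv]
  rfl

lemma contDiff_coord {v : Space d → Space d} (hv : ContDiff ℝ ∞ v) (i : Fin d) :
    ContDiff ℝ ∞ (fun x => v x i) :=
  (EuclideanSpace.proj (𝕜 := ℝ) i).contDiff.comp hv

lemma memLp_coord {v : Space d → Space d} (hv : MemLp v 2 volume) (i : Fin d) :
    MemLp (fun x => v x i) 2 volume := by
  refine MemLp.of_le hv ?_ (Filter.Eventually.of_forall fun x => PiLp.norm_apply_le (v x) i)
  exact (EuclideanSpace.proj (𝕜 := ℝ) i).continuous.comp_aestronglyMeasurable hv.1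

lemma eLpNorm_coord_le (v : Space d → Space d) (i : Fin d) (p : ℝ≥0∞) :
    eLpNorm (fun x => v x i) p volume ≤ eLpNorm v p volume :=
  eLpNorm_mono fun x => PiLp.norm_apply_le (v x) i

lemma eLpNorm_fderiv_coord_le {v : Space d → Space d} (hv : ContDiff ℝ ∞ v) (i : Fin d)
    (p : ℝ≥0∞) : eLpNorm (fderiv ℝ (fun x => v x i)) p volume ≤ eLpNorm (fderiv ℝ v) p volume := by
  refine eLpNorm_mono fun x => ContinuousLinearMap.opNorm_le_bound _ (norm_nonneg _) fun e => ?_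
  rw [fderiv_coord hv]
  exact (PiLp.norm_apply_le _ i).trans ((fderiv ℝ v x).le_opNorm e)

/-- The convection type sum of bilinear operators, with the derivative on the kernel. -/
def bilDiv (k : ℤ) (ψ : 𝓢(Space d, ℂ)) (v : Space d → Space d) (g : Space d → ℂ) (x : Space d) :
    ℂ :=
  ((2 : ℝ) ^ k : ℂ) * ∑ i, bil (ker k (dsym i ψ)) (fun y => v y i) g x

lemma measurable_bilDiv (k : ℤ) (ψ : 𝓢(Space d, ℂ)) {v : Space d → Space d}
    (hv : Continuous v) {g : Space d → ℂ} (hg : AEStronglyMeasurable g volume) :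
    AEStronglyMeasurable (bilDiv k ψ v g) volume := by
  refine AEStronglyMeasurable.const_mul ?_ _
  have : (fun x => ∑ i, bil (ker k (dsym i ψ)) (fun y => v y i) g x) =
      ∑ i, bil (ker k (dsym i ψ)) (fun y => v y i) g := by
    ext x; simp
  rw [this]
  exact Finset.aestronglyMeasurable_sum _ fun i _ =>
    measurable_bil (ker k _).continuous (by fun_prop) hg

lemma enorm_two_zpow_complex (k : ℤ) : ‖((2 : ℝ) ^ k : ℂ)‖ₑ = (2 : ℝ≥0∞) ^ (k : ℝ) := by
  have : ((2 : ℝ) ^ k : ℂ) = (((2 : ℝ) ^ k : ℝ) : ℂ) := by push_cast; rfl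
  rw [this, ← ofReal_norm, Complex.norm_real, ofReal_norm, enorm_two_zpow]

/-- High frequencies of the second factor in the convection commutator. -/
theorem eLpNorm_bilDiv_le_of_sum (k q : ℤ) (ψ : 𝓢(Space d, ℂ)) (σ : Fin d → 𝓢(Space d, ℂ))
    {ρ : 𝓢(Space d, ℂ)} (hρ : ρ = ∑ j, dsym j (σ j)) {v : Space d → Space d}
    (hv : ContDiff ℝ ∞ v) (hv2 : MemLp v 2 volume) {p : ℝ≥0∞} (hp : 1 ≤ p)
    {F : Space d → ℂ} (hF : Integrable F) (hb : eLpNorm (𝓕⁻ F) ∞ volume ≠ ⊤) :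
    eLpNorm (bilDiv k ψ v (blk q ρ F)) p volume ≤
      2 ^ ((k : ℝ) - q) * (∑ i, ∑ j, (kmass (σ j) + 1) *
        (kmoment (dsym j (dsym i ψ)) + kmass (dsym i ψ) + 1)) *
        (eLpNorm (fderiv ℝ v) p volume * eLpNorm (𝓕⁻ F) ∞ volume) := by
  have e : bilDiv k ψ v (blk q ρ F) = ((2 : ℝ) ^ k : ℂ) •
      ∑ i, bil (ker k (dsym i ψ)) (fun y => v y i) (blk q ρ F) := by
    ext x; simp [bilDiv]
  rw [e, eLpNorm_const_smul, enorm_two_zpow_complex, sub_eq_add_neg, two_rpow_add, mul_assoc,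
    mul_assoc]
  refine mul_le_mul_right ?_ _
  refine (eLpNorm_sum_le (fun i _ => measurable_bil (ker k _).continuous
    (contDiff_coord hv i).continuous (continuous_blk q _ hF).aestronglyMeasurable) hp).trans ?_
  rw [← mul_assoc, Finset.mul_sum, Finset.sum_mul]
  refine Finset.sum_le_sum fun i _ => ?_
  refine (eLpNorm_bil_blk_le_of_sum k q (dsym i ψ) σ hρ (contDiff_coord hv i) (memLp_coord hv2 i)
    hp hF hb).trans ?_
  exact mul_le_mul_right (mul_le_mul_left (eLpNorm_fderiv_coord_le hv i p) _) _

/-- Low frequencies of the second factor in the convection commutator. -/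
theorem eLpNorm_bilDiv_le (k q : ℤ) (ψ ρ : 𝓢(Space d, ℂ)) {v : Space d → Space d}
    (hv : ContDiff ℝ ∞ v) (hv2 : MemLp v 2 volume) (hdiv : DivFree v) {p : ℝ≥0∞} (hp : 1 ≤ p)
    {F : Space d → ℂ} (hF : Integrable F) (hb : eLpNorm (𝓕⁻ F) ∞ volume ≠ ⊤) :
    eLpNorm (bilDiv k ψ v (blk q ρ F)) p volume ≤
      2 ^ ((q : ℝ) - k) * (∑ i, (kmass (dsym i ρ) * kmoment ψ + 1)) *
        (eLpNorm (fderiv ℝ v) p volume * eLpNorm (𝓕⁻ F) ∞ volume) := by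
  rcases isEmpty_or_nonempty (Fin d) with hd | hd
  · have : bilDiv k ψ v (blk q ρ F) = 0 := by ext x; simp [bilDiv]
    rw [this]; simp
  rcases eq_or_ne (eLpNorm (𝓕⁻ F) ∞ volume) 0 with h0 | h0
  · have : bilDiv k ψ v (blk q ρ F) = 0 := by
      ext x; simp [bilDiv, bil_zero_right _ _ (blk_eq_zero q ρ hF h0)]
    rw [this]; simp
  by_cases hap : eLpNorm (fderiv ℝ v) p volume = ⊤
  · rw [hap, ENNReal.top_mul h0, ENNReal.mul_top]
    · exact le_top
    · refine mul_ne_zero (two_rpow_ne_zero _) ?_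
      simp
  have hap' : ∀ i, MemLp (fderiv ℝ (fun x => v x i)) p volume := fun i =>
    ⟨((contDiff_coord hv i).continuous_fderiv (by simp)).aestronglyMeasurable,
      (eLpNorm_fderiv_coord_le hv i p).trans_lt (lt_top_iff_ne_top.2 hap)⟩
  have hbρ := ENNReal.mul_ne_top (kmass_ne_top ρ) hb
  -- The derivatives are moved from the kernel to the low-frequency block, which trades the factor
  -- `2^k` for `2^q`; the moment of the undifferentiated kernel then supplies `2^{-k}`.
  have e : bilDiv k ψ v (blk q ρ F) = ((2 : ℝ) ^ q : ℂ) •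
      ∑ i, bil (ker k ψ) (fun y => v y i) (blk q (dsym i ρ) F) := by
    ext x
    have h1 := fun i => bil_blk_by_parts k q ψ ρ (contDiff_coord hv i) (memLp_coord hv2 i) hp
      (hap' i) hF hb i x
    have hint : ∀ i, Integrable fun y => ker k ψ (x - y) *
        (fderiv ℝ (fun x => v x i) y (basisVec i) : ℂ) * blk q ρ F y := by
      intro i
      refine Integrable.mul_bdd_enorm (integrable_translate_mul_of_memLp _ hp ?_ x)
        (continuous_blk q ρ hF) hbρ (enorm_blk_le q ρ hF)
      have hc := (contDiff_coord hv i).continuous_fderiv (by simp)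
      refine MemLp.of_le (hap' i) ?_ (Filter.Eventually.of_forall fun y => ?_)
      · apply Continuous.aestronglyMeasurable
        fun_prop
      · refine ((fderiv ℝ (fun x => v x i) y).le_opNorm _).trans ?_
        simp
    -- The terms with the derivative on `v_i` add up to the convolution of the kernel with `(div v)
    -- g = 0`.
    have h2 : ∑ i, ∫ y, ker k ψ (x - y) * (fderiv ℝ (fun x => v x i) y (basisVec i) : ℂ) *
        blk q ρ F y = 0 := by
      rw [← integral_finsetSum _ fun i _ => hint i]
      apply integral_eq_zero_of_ae
      refine Filter.Eventually.of_forall fun y => ?_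
      have h3 : ∑ i, fderiv ℝ (fun x => v x i) y (basisVec i) = 0 := by
        simp_rw [fderiv_coord hv]; exact hdiv y
      have h4 : ∑ i, (fderiv ℝ (fun x => v x i) y (basisVec i) : ℂ) = 0 := by
        exact_mod_cast congrArg (fun t : ℝ => (t : ℂ)) h3
      simp only [Pi.zero_apply]
      rw [← Finset.sum_mul, ← Finset.mul_sum, h4]
      simp
    rw [Pi.smul_apply, Finset.sum_apply, smul_eq_mul, Finset.mul_sum, bilDiv, Finset.mul_sum]
    rw [Finset.sum_congr rfl fun i _ => h1 i, Finset.sum_sub_distrib, h2, sub_zero]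
  rw [e, eLpNorm_const_smul, enorm_two_zpow_complex, sub_eq_add_neg, two_rpow_add, mul_assoc,
    mul_assoc]
  refine mul_le_mul_right ?_ _
  refine (eLpNorm_sum_le (fun i _ => measurable_bil (ker k _).continuous
    (contDiff_coord hv i).continuous (continuous_blk q _ hF).aestronglyMeasurable) hp).trans ?_
  rw [← mul_assoc, Finset.mul_sum, Finset.sum_mul]
  refine Finset.sum_le_sum fun i _ => ?_
  refine (eLpNorm_bil_blk_le k q ψ (dsym i ρ) (contDiff_coord hv i) hp hF hb).trans ?_
  exact mul_le_mul' (mul_le_mul_right le_self_add _)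
    (mul_le_mul_left (eLpNorm_fderiv_coord_le hv i p) _)

end Estimates

/-! ### The dyadic partition of unity -/

namespace DyadicPartition

variable {d : ℕ} (P : DyadicPartition d)

/-- The partition identity at `ξ/2` is the one at `ξ` with the sum shifted by one index; subtracting
them isolates `φ(ξ)`. Hence all sums of dilates of `φ` telescope. -/
lemma φ_eq (ξ : Space d) : P.φ ξ = P.χ ((2 : ℝ) ^ (-(1 : ℤ)) • ξ) - P.χ ξ := by
  have h1 := P.sum_eq_one ξ
  have h2 := P.sum_eq_one ((2 : ℝ) ^ (-(1 : ℤ)) • ξ)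
  have h3 := (hasSum_nat_add_iff' (f := fun q : ℕ => P.φ ((2 : ℝ) ^ (-(q : ℤ)) • ξ)) 1).2 h1
  have h4 : (fun n : ℕ => P.φ ((2 : ℝ) ^ (-((n + 1 : ℕ) : ℤ)) • ξ)) =
      fun q : ℕ => P.φ ((2 : ℝ) ^ (-(q : ℤ)) • (2 : ℝ) ^ (-(1 : ℤ)) • ξ) := by
    ext n
    rw [smul_smul, ← zpow_add₀ two_ne_zero]
    push_cast
    rw [neg_add]
  rw [h4] at h3
  have := h3.unique h2
  simp only [Finset.sum_range_one, Nat.cast_zero, neg_zero, zpow_zero, one_smul] at this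
  linarith

lemma φ_zpow (q : ℤ) (ξ : Space d) :
    P.φ ((2 : ℝ) ^ (-q) • ξ) = P.χ ((2 : ℝ) ^ (-(q + 1)) • ξ) - P.χ ((2 : ℝ) ^ (-q) • ξ) := by
  rw [φ_eq, smul_smul, ← zpow_add₀ two_ne_zero]
  congr 3
  ring_nf

lemma exists_φ_eq_zero : ∃ a : ℝ, 0 < a ∧ ∀ ξ : Space d, ‖ξ‖ < a → P.φ ξ = 0 := by
  have h : (tsupport P.φ)ᶜ ∈ nhds (0 : Space d) :=
    (isClosed_tsupport _).isOpen_compl.mem_nhds P.zero_notMem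
  obtain ⟨a, ha, h⟩ := Metric.mem_nhds_iff.1 h
  exact ⟨a, ha, fun ξ hξ => image_eq_zero_of_notMem_tsupport (h (by simpa using hξ))⟩

lemma exists_χ_eq_one : ∃ a : ℝ, 0 < a ∧ ∀ ξ : Space d, ‖ξ‖ < a → P.χ ξ = 1 := by
  obtain ⟨a, ha, h⟩ := P.exists_φ_eq_zero
  refine ⟨a, ha, fun ξ hξ => ?_⟩
  have h1 := P.sum_eq_one ξ
  have h2 : (fun q : ℕ => P.φ ((2 : ℝ) ^ (-(q : ℤ)) • ξ)) = fun _ => 0 := by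
    ext q
    apply h
    rw [norm_smul, Real.norm_of_nonneg (by positivity)]
    refine lt_of_le_of_lt (mul_le_of_le_one_left (norm_nonneg _) ?_) hξ
    exact zpow_le_one_of_nonpos₀ one_le_two (by simp)
  rw [h2] at h1
  have := h1.unique hasSum_zero
  linarith

lemma χ_le_one (ξ : Space d) : P.χ ξ ≤ 1 := by
  have := (P.sum_eq_one ξ).nonneg fun q => P.nonneg_φ _
  linarith

lemma φ_le_one (ξ : Space d) : P.φ ξ ≤ 1 := by
  rw [φ_eq]
  linarith [P.χ_le_one ((2 : ℝ) ^ (-(1 : ℤ)) • ξ), P.nonneg_χ ξ]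

lemma exists_bound : ∃ M : ℝ, 0 < M ∧ (∀ ξ : Space d, M < ‖ξ‖ → P.χ ξ = 0) ∧
    ∀ ξ : Space d, M < ‖ξ‖ → P.φ ξ = 0 := by
  obtain ⟨M1, h1⟩ := P.compact_χ.isCompact.isBounded.exists_norm_le
  obtain ⟨M2, h2⟩ := P.compact_φ.isCompact.isBounded.exists_norm_le
  refine ⟨max 1 (max M1 M2), by positivity, fun ξ hξ => ?_, fun ξ hξ => ?_⟩
  · apply image_eq_zero_of_notMem_tsupport
    intro h
    have := h1 ξ h
    have := le_max_left M1 M2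
    have := le_max_right 1 (max M1 M2)
    linarith
  · apply image_eq_zero_of_notMem_tsupport
    intro h
    have := h2 ξ h
    have := le_max_right M1 M2
    have := le_max_right 1 (max M1 M2)
    linarith

lemma φ_mul_φ_eq_zero {j k : ℤ} (h : 2 ≤ |j - k|) (ξ : Space d) :
    P.φ ((2 : ℝ) ^ (-j) • ξ) = 0 ∨ P.φ ((2 : ℝ) ^ (-k) • ξ) = 0 := by
  by_contra! hne
  have h1 : ξ ∈ tsupport fun ξ : Space d => P.φ ((2 : ℝ) ^ (-j) • ξ) := subset_tsupport _ hne.1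
  have h2 : ξ ∈ tsupport fun ξ : Space d => P.φ ((2 : ℝ) ^ (-k) • ξ) := subset_tsupport _ hne.2
  exact Set.disjoint_left.1 (P.disjoint_φ j k h) h1 h2

lemma χ_mul_φ_eq_zero {q : ℕ} (h : 1 ≤ q) (ξ : Space d) :
    P.χ ξ = 0 ∨ P.φ ((2 : ℝ) ^ (-(q : ℤ)) • ξ) = 0 := by
  by_contra! hne
  have h1 : ξ ∈ tsupport P.χ := subset_tsupport _ hne.1
  have h2 : ξ ∈ tsupport fun ξ : Space d => P.φ ((2 : ℝ) ^ (-(q : ℤ)) • ξ) :=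
    subset_tsupport _ hne.2
  exact Set.disjoint_left.1 (P.disjoint_χ q h) h1 h2

/-- A cut-off to a larger ring, equal to `1` on the support of `φ`. -/
def fat (ξ : Space d) : ℝ := P.χ ((2 : ℝ) ^ (-(2 : ℤ)) • ξ) - P.χ ((2 : ℝ) ^ (1 : ℤ) • ξ)

/-- In the partition identity at `2^{-q}ξ`, every ring term is a dilate of `φ` at least two scales
away from the one that is nonzero at `ξ`. All of them vanish and `χ` carries the whole sum. -/
lemma χ_eq_one_of_φ_ne_zero {q : ℤ} {ξ : Space d} (hq : 2 ≤ q) (h : P.φ ξ ≠ 0) :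
    P.χ ((2 : ℝ) ^ (-q) • ξ) = 1 := by
  have h1 := P.sum_eq_one ((2 : ℝ) ^ (-q) • ξ)
  have h2 : (fun n : ℕ => P.φ ((2 : ℝ) ^ (-(n : ℤ)) • (2 : ℝ) ^ (-q) • ξ)) = fun _ => 0 := by
    ext n
    rw [smul_smul, ← zpow_add₀ two_ne_zero, ← neg_add]
    have h3 := P.φ_mul_φ_eq_zero (j := n + q) (k := 0) (by
      rw [sub_zero, abs_of_nonneg (by omega)]; omega) ξ
    simpa [h] using h3
  rw [h2] at h1
  have := h1.unique hasSum_zero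
  linarith

/-- Where `φ ≠ 0`, `χ(ξ/4) = 1` by the preceding lemma, and `χ(2ξ) = 0` because the supports of `χ`
and `φ(·/2)` are disjoint. -/
lemma fat_mul_φ (ξ : Space d) : P.fat ξ * P.φ ξ = P.φ ξ := by
  by_cases h : P.φ ξ = 0
  · simp [h]
  · have h1 := P.χ_eq_one_of_φ_ne_zero (q := 2) le_rfl h
    have h2 := P.χ_mul_φ_eq_zero (q := 1) le_rfl ((2 : ℝ) ^ (1 : ℤ) • ξ)
    rw [smul_smul, ← zpow_add₀ two_ne_zero] at h2
    simp only [Nat.cast_one, neg_add_cancel, zpow_zero, one_smul, h, or_false] at h2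
    rw [fat, h1, h2]; simp

lemma contDiff_fat : ContDiff ℝ ∞ P.fat :=
  (P.smooth_χ.comp (contDiff_const_smul _)).sub (P.smooth_χ.comp (contDiff_const_smul _))

lemma hasCompactSupport_fat : HasCompactSupport P.fat := by
  have h1 := P.compact_χ.comp_smul (c := (2 : ℝ) ^ (-(2 : ℤ))) (two_zpow_ne_zero _)
  have h2 := P.compact_χ.comp_smul (c := (2 : ℝ) ^ (1 : ℤ)) (two_zpow_ne_zero _)
  exact h1.sub h2

lemma exists_fat_eq_zero : ∃ a : ℝ, 0 < a ∧ ∀ ξ : Space d, ‖ξ‖ < a → P.fat ξ = 0 := by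
  obtain ⟨a, ha, h⟩ := P.exists_χ_eq_one
  refine ⟨a / 2, by positivity, fun ξ hξ => ?_⟩
  rw [fat, h, h, sub_self]
  · rw [norm_smul]; norm_num; linarith
  · rw [norm_smul]; norm_num; linarith [norm_nonneg ξ]

lemma sum_φ (N : ℕ) (ξ : Space d) :
    ∑ q ∈ Finset.Ico (-(N : ℤ)) N, P.φ ((2 : ℝ) ^ (-q) • ξ) =
      P.χ ((2 : ℝ) ^ (-(N : ℤ)) • ξ) - P.χ ((2 : ℝ) ^ (N : ℤ) • ξ) := by
  induction N with
  | zero => simp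
  | succ n ih =>
    have e : Finset.Ico (-((n + 1 : ℕ) : ℤ)) ((n + 1 : ℕ) : ℤ) =
        insert (-((n : ℤ) + 1)) (insert (n : ℤ) (Finset.Ico (-(n : ℤ)) n)) := by
      ext x
      simp only [Finset.mem_Ico, Finset.mem_insert]
      push_cast
      omega
    rw [e, Finset.sum_insert (by simp), Finset.sum_insert (by simp), ih, φ_zpow, φ_zpow]
    push_cast
    simp only [neg_neg]
    ring_nf

/-- For fixed `ξ ≠ 0` the telescoped sum is eventually equal to `1`: `χ` is `1` near the origin and
`0` far away. -/
lemma tendsto_sum_φ {ξ : Space d} (hξ : ξ ≠ 0) :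
    Filter.Tendsto (fun N : ℕ => ∑ q ∈ Finset.Ico (-(N : ℤ)) N, P.φ ((2 : ℝ) ^ (-q) • ξ))
      Filter.atTop (nhds 1) := by
  obtain ⟨a, ha, h1⟩ := P.exists_χ_eq_one
  obtain ⟨M, hM, h2, -⟩ := P.exists_bound
  have hpos : 0 < ‖ξ‖ := norm_pos_iff.2 hξ
  have t1 : Filter.Tendsto (fun N : ℕ => (2 : ℝ) ^ N) Filter.atTop Filter.atTop :=
    tendsto_pow_atTop_atTop_of_one_lt one_lt_two
  apply tendsto_const_nhds.congr'
  filter_upwards [t1.eventually_gt_atTop (‖ξ‖ / a), t1.eventually_gt_atTop (M / ‖ξ‖)] with N e1 e2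
  rw [sum_φ, h1, h2, sub_zero]
  · rw [norm_smul, Real.norm_of_nonneg (by positivity), zpow_natCast]
    rwa [div_lt_iff₀ hpos] at e2
  · rw [norm_smul, Real.norm_of_nonneg (by positivity), zpow_neg, zpow_natCast,
      inv_mul_lt_iff₀ (by positivity)]
    rwa [div_lt_iff₀ ha] at e1

lemma sum_φ_mem (N : ℕ) (ξ : Space d) :
    |1 - ∑ q ∈ Finset.Ico (-(N : ℤ)) N, P.φ ((2 : ℝ) ^ (-q) • ξ)| ≤ 1 := by
  have h0 : 0 ≤ ∑ q ∈ Finset.Ico (-(N : ℤ)) N, P.φ ((2 : ℝ) ^ (-q) • ξ) :=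
    Finset.sum_nonneg fun q _ => P.nonneg_φ _
  have h1 : ∑ q ∈ Finset.Ico (-(N : ℤ)) N, P.φ ((2 : ℝ) ^ (-q) • ξ) ≤ 1 := by
    rw [sum_φ]
    linarith [P.χ_le_one ((2 : ℝ) ^ (-(N : ℤ)) • ξ), P.nonneg_χ ((2 : ℝ) ^ (N : ℤ) • ξ)]
  rw [abs_le]; constructor <;> linarith

/-- The symbols of the inhomogeneous dyadic blocks, with the index shifted by one. -/
def sym : ℕ → Space d → ℝ
  | 0 => P.χ
  | q + 1 => fun ξ => P.φ ((2 : ℝ) ^ (-(q : ℤ)) • ξ)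

lemma hasSum_sym (ξ : Space d) : HasSum (fun k => P.sym k ξ) 1 := by
  have h := P.sum_eq_one ξ
  rw [← hasSum_nat_add_iff' 1]
  simpa [sym] using h

lemma sym_eq_zero_or {j k : ℕ} (h : j + 2 ≤ k) (ξ : Space d) : P.sym j ξ = 0 ∨ P.sym k ξ = 0 := by
  obtain ⟨k, rfl⟩ : ∃ l, k = l + 1 := ⟨k - 1, by omega⟩
  cases j with
  | zero => exact P.χ_mul_φ_eq_zero (by omega) ξ
  | succ j =>
    apply P.φ_mul_φ_eq_zero
    rw [abs_of_nonpos (by omega)]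
    omega

/-- The symbols add up to `1`, and those nonzero at `ξ` lie among three consecutive ones. -/
lemma exists_sym_ge (ξ : Space d) : ∃ k, 1 / 3 ≤ P.sym k ξ := by
  by_contra! hlt
  have hs := P.hasSum_sym ξ
  obtain ⟨k, hk⟩ : ∃ k, P.sym k ξ ≠ 0 := by
    by_contra! h0
    simp only [h0] at hs
    exact zero_ne_one (hasSum_zero.unique hs)
  have h1 : ∀ j ∉ Finset.Icc (k - 1) (k + 1), P.sym j ξ = 0 := by
    intro j hj
    simp only [Finset.mem_Icc, not_and_or, not_le] at hj
    rcases hj with hj | hj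
    · exact (P.sym_eq_zero_or (by omega) ξ).resolve_right hk
    · exact (P.sym_eq_zero_or (by omega) ξ).resolve_left hk
  have h2 := (hasSum_sum_of_ne_finset_zero h1).unique hs
  have hne : (Finset.Icc (k - 1) (k + 1)).Nonempty := ⟨k, by simp⟩
  have h3 := Finset.sum_lt_sum_of_nonempty hne fun j _ => hlt j
  rw [h2, Finset.sum_const, nsmul_eq_mul] at h3
  have h4 : ((Finset.Icc (k - 1) (k + 1)).card : ℝ) ≤ 3 := by
    rw [Nat.card_Icc]
    exact_mod_cast (by omega : k + 1 + 1 - (k - 1) ≤ 3)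
  nlinarith

lemma exists_norm_le_of_sym : ∃ M : ℝ, 1 ≤ M ∧
    ∀ (k : ℕ) (ξ : Space d), P.sym k ξ ≠ 0 → 1 + ‖ξ‖ ^ 2 ≤ M * (2 : ℝ) ^ (2 * ((k : ℝ) - 1)) := by
  obtain ⟨M, hM, h1, h2⟩ := P.exists_bound
  -- The index `k` stands for the scale `2^{k-1}`. From `‖ξ‖ ≤ 2^k M` and `1 ≤ 2^k` follows `1 +
  -- ‖ξ‖² ≤ (1 + M²) 4^k`, and `4^k` is four times the square of this scale.
  refine ⟨4 * (1 + M ^ 2), by nlinarith, fun k ξ hk => ?_⟩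
  have hx : ‖ξ‖ ≤ 2 ^ k * M := by
    cases k with
    | zero =>
      by_contra! h
      exact hk (h1 ξ (by simpa using h))
    | succ k =>
      have h3 : ¬ M < ‖(2 : ℝ) ^ (-(k : ℤ)) • ξ‖ := fun h => hk (h2 _ h)
      rw [norm_smul, Real.norm_of_nonneg (by positivity), zpow_neg, zpow_natCast, not_lt,
        inv_mul_le_iff₀ (by positivity)] at h3
      refine h3.trans ?_
      rw [pow_succ]
      nlinarith [pow_pos (two_pos (α := ℝ)) k, mul_pos (pow_pos (two_pos (α := ℝ)) k) hM]
  have e : (2 : ℝ) ^ (2 * ((k : ℝ) - 1)) = (2 ^ k) ^ 2 / 4 := by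
    rw [mul_sub, Real.rpow_sub two_pos, mul_comm, Real.rpow_mul (by norm_num), Real.rpow_natCast]
    norm_num
  rw [e]
  have h5 : (1 : ℝ) ≤ 2 ^ k := one_le_pow₀ one_le_two
  have h6 : ‖ξ‖ ^ 2 ≤ (2 ^ k * M) ^ 2 := pow_le_pow_left₀ (norm_nonneg _) hx 2
  nlinarith

end DyadicPartition

/-! ### Homogeneous symbols -/

section Symbols

variable {d : ℕ}

/-- Symbols which are homogeneous of degree `0`, smooth away from the origin and bounded by `1`. -/
structure IsHomSymbol (m : Space d → ℂ) : Prop where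
  smooth : ContDiffOn ℝ ∞ m {0}ᶜ
  homog : ∀ (c : ℝ) (ξ : Space d), 0 < c → m (c • ξ) = m ξ
  norm_le : ∀ ξ, ‖m ξ‖ ≤ 1
  measurable : Measurable m

/-- With the symbol `1` the estimates apply to `θ`, with the Riesz symbol to `Rθ`. -/
lemma isHomSymbol_one : IsHomSymbol (fun _ : Space d => (1 : ℂ)) :=
  ⟨contDiffOn_const, fun _ _ _ => rfl, fun _ => by simp, measurable_const⟩

lemma isHomSymbol_riesz (j : Fin d) : IsHomSymbol (rieszSymbol j) := by
  refine ⟨?_, fun c ξ hc => ?_, fun ξ => ?_, ?_⟩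
  · have h1 : ContDiffOn ℝ ∞ (fun ξ : Space d => ξ j / ‖ξ‖) {0}ᶜ := by
      intro ξ hξ
      apply ContDiffAt.contDiffWithinAt
      exact ((EuclideanSpace.proj (𝕜 := ℝ) j).contDiff.contDiffAt (x := ξ)).div
        (contDiffAt_norm ℝ hξ) (norm_ne_zero_iff.2 hξ)
    exact contDiffOn_const.mul (Complex.ofRealCLM.contDiff.comp_contDiffOn h1)
  · rw [rieszSymbol, rieszSymbol, norm_smul, Real.norm_of_nonneg hc.le]
    congr 2
    rw [PiLp.smul_apply, smul_eq_mul, mul_div_mul_left _ _ hc.ne']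
  · rw [rieszSymbol, norm_mul, Complex.norm_I, one_mul, Complex.norm_real, norm_div, norm_norm]
    exact div_le_one_of_le₀ (PiLp.norm_apply_le ξ j) (norm_nonneg _)
  · unfold rieszSymbol
    have h : Measurable fun ξ : Space d => ξ j := (EuclideanSpace.proj (𝕜 := ℝ) j).measurable
    exact measurable_const.mul (Complex.measurable_ofReal.comp (h.div measurable_norm))

lemma exists_schwartz_cutoff {f : Space d → ℝ} (hf : ContDiff ℝ ∞ f) (hfc : HasCompactSupport f)
    (hf0 : ∃ a : ℝ, 0 < a ∧ ∀ ξ : Space d, ‖ξ‖ < a → f ξ = 0) {h : Space d → ℂ}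
    (hh : ContDiffOn ℝ ∞ h {0}ᶜ) : ∃ ψ : 𝓢(Space d, ℂ), ∀ ξ, ψ ξ = h ξ * (f ξ : ℂ) := by
  obtain ⟨a, ha, hfa⟩ := hf0
  have hc : HasCompactSupport fun ξ => h ξ * (f ξ : ℂ) :=
    (hfc.comp_left (g := fun t : ℝ => (t : ℂ)) (by simp)).mul_left
  have hs : ContDiff ℝ ∞ fun ξ => h ξ * (f ξ : ℂ) := by
    rw [contDiff_iff_contDiffAt]
    intro ξ
    by_cases hξ : ξ = 0
    · have : (fun ξ => h ξ * (f ξ : ℂ)) =ᶠ[nhds ξ] fun _ => 0 := by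
        filter_upwards [Metric.ball_mem_nhds ξ ha] with y hy
        rw [hξ, mem_ball_zero_iff] at hy
        simp [hfa y hy]
      exact contDiffAt_const.congr_of_eventuallyEq this
    · exact (hh.contDiffAt (isOpen_compl_singleton.mem_nhds hξ)).mul
        (Complex.ofRealCLM.contDiff.comp hf).contDiffAt
  exact ⟨hc.toSchwartzMap hs, fun ξ => rfl⟩

variable (P : DyadicPartition d)

lemma two_pi_ne_zero' : (2 * Real.pi : ℝ) ≠ 0 := by positivity

lemma exists_schwartz_ring {f : Space d → ℝ} (hf : ContDiff ℝ ∞ f) (hfc : HasCompactSupport f)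
    (hf0 : ∃ a : ℝ, 0 < a ∧ ∀ ξ : Space d, ‖ξ‖ < a → f ξ = 0) {h : Space d → ℂ}
    (hh : ContDiffOn ℝ ∞ h {0}ᶜ) :
    ∃ ψ : 𝓢(Space d, ℂ), ∀ ξ, ψ ξ = h ξ * (f ((2 * Real.pi) • ξ) : ℂ) := by
  obtain ⟨a, ha, hfa⟩ := hf0
  refine exists_schwartz_cutoff (f := fun ξ => f ((2 * Real.pi) • ξ))
    (hf.comp (contDiff_const_smul _)) (hfc.comp_smul two_pi_ne_zero')
    ⟨a / (2 * Real.pi), by positivity, fun ξ hξ => hfa _ ?_⟩ hh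
  rw [norm_smul, Real.norm_of_nonneg (by positivity)]
  rwa [lt_div_iff₀' (by positivity)] at hξ

/-- The symbol `m φ`, in the normalization of the Fourier transform of Mathlib. -/
lemma exists_ringSym {m : Space d → ℂ} (hm : IsHomSymbol m) :
    ∃ ψ : 𝓢(Space d, ℂ), ∀ ξ, ψ ξ = m ξ * (P.φ ((2 * Real.pi) • ξ) : ℂ) :=
  exists_schwartz_ring P.smooth_φ P.compact_φ P.exists_φ_eq_zero hm.smooth

/-- The symbol `m φ'` for the enlarged cut-off `φ'`, as a sum of derivatives. -/
lemma exists_fatSym {m : Space d → ℂ} (hm : IsHomSymbol m) :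
    ∃ (ρ : 𝓢(Space d, ℂ)) (σ : Fin d → 𝓢(Space d, ℂ)),
      (∀ ξ, ρ ξ = m ξ * (P.fat ((2 * Real.pi) • ξ) : ℂ)) ∧ ρ = ∑ j, dsym j (σ j) := by
  obtain ⟨ρ, hρ⟩ := exists_schwartz_ring P.contDiff_fat P.hasCompactSupport_fat
    P.exists_fat_eq_zero hm.smooth
  -- Since `∑ ξ_j² = |ξ|²`, the choice `σ_j = m ξ_j fat / (2πi |ξ|²)` solves `∑ 2πi ξ_j σ_j = m
  -- fat`; it is smooth because the cut-off vanishes near the origin.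
  have hj : ∀ j : Fin d, ContDiffOn ℝ ∞
      (fun ξ : Space d => m ξ * ((2 * Real.pi * Complex.I)⁻¹ * ((ξ j / ‖ξ‖ ^ 2 : ℝ) : ℂ)))
      {0}ᶜ := by
    intro j
    refine hm.smooth.mul (contDiffOn_const.mul (Complex.ofRealCLM.contDiff.comp_contDiffOn ?_))
    intro ξ hξ
    apply ContDiffAt.contDiffWithinAt
    exact ((EuclideanSpace.proj (𝕜 := ℝ) j).contDiff.contDiffAt (x := ξ)).div
      ((contDiffAt_norm ℝ hξ).pow 2) (pow_ne_zero 2 (norm_ne_zero_iff.2 hξ))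
  choose σ hσ using fun j => exists_schwartz_ring P.contDiff_fat P.hasCompactSupport_fat
    P.exists_fat_eq_zero (hj j)
  refine ⟨ρ, σ, hρ, ?_⟩
  ext ξ
  have e : (∑ j, dsym j (σ j)) ξ = ∑ j, dsym j (σ j) ξ := by simp
  rw [e, hρ]
  simp_rw [dsym_apply, hσ]
  by_cases hξ : ξ = 0
  · obtain ⟨a, ha, h0⟩ := P.exists_fat_eq_zero
    have : P.fat ((2 * Real.pi) • ξ) = 0 := h0 _ (by simpa [hξ] using ha)
    simp [this]
  · have h1 : ∀ j : Fin d, 2 * (Real.pi : ℂ) * Complex.I * (ξ j : ℂ) *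
        (m ξ * ((2 * Real.pi * Complex.I)⁻¹ * ((ξ j / ‖ξ‖ ^ 2 : ℝ) : ℂ)) *
          (P.fat ((2 * Real.pi) • ξ) : ℂ)) =
        m ξ * (P.fat ((2 * Real.pi) • ξ) : ℂ) * ((ξ j ^ 2 / ‖ξ‖ ^ 2 : ℝ) : ℂ) := by
      intro j
      have hpi : (Real.pi : ℂ) ≠ 0 := by exact_mod_cast Real.pi_ne_zero
      have hI := Complex.I_ne_zero
      have hn : (‖ξ‖ : ℂ) ≠ 0 := by exact_mod_cast norm_ne_zero_iff.2 hξ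
      push_cast
      field_simp
    simp_rw [h1]
    rw [← Finset.mul_sum, ← Complex.ofReal_sum, ← Finset.sum_div, ← EuclideanSpace.real_norm_sq_eq,
      div_self (pow_ne_zero 2 (norm_ne_zero_iff.2 hξ))]
    simp

end Symbols

variable {d : ℕ}

/-! ### `L²` tools -/

section LTwo

lemma lintegral_enorm_mul_le {f g : Space d → ℂ} (hf : AEStronglyMeasurable f volume)
    (hg : AEStronglyMeasurable g volume) :
    ∫⁻ x, ‖f x‖ₑ * ‖g x‖ₑ ≤ eLpNorm f 2 volume * eLpNorm g 2 volume := by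
  have h := eLpNorm_smul_le_mul_eLpNorm (p := 2) (q := 2) (r := 1) hg hf (μ := volume)
  rw [eLpNorm_one_eq_lintegral_enorm] at h
  simpa [enorm_mul] using h

lemma enorm_integral_mul_le {f g : Space d → ℂ} (hf : AEStronglyMeasurable f volume)
    (hg : AEStronglyMeasurable g volume) :
    ‖∫ x, f x * g x‖ₑ ≤ eLpNorm f 2 volume * eLpNorm g 2 volume := by
  refine (enorm_integral_le_lintegral_enorm _).trans ?_
  simp_rw [enorm_mul]
  exact lintegral_enorm_mul_le hf hg

lemma eLpNorm_two_sq {f : Space d → ℂ} :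
    eLpNorm f 2 volume = (∫⁻ x, ‖f x‖ₑ ^ 2) ^ (1 / 2 : ℝ) := by
  rw [eLpNorm_eq_lintegral_rpow_enorm_toReal two_ne_zero ENNReal.ofNat_ne_top]
  simp

/-- Plancherel's theorem for Fourier pairs. -/
lemma IsFourierPair.eLpNorm_eq {f F : Space d → ℂ} (h : IsFourierPair f F)
    (hf : LocallyIntegrable f volume) (hF : MemLp F 2 volume) :
    eLpNorm f 2 volume = eLpNorm F 2 volume := by
  have hp := isFourierPair_Lp (𝓕⁻ (hF.toLp F))
  rw [FourierTransform.fourier_fourierInv_eq] at hp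
  have hp' := hp.congr (ae_eq_refl _) hF.coeFn_toLp
  rw [eLpNorm_congr_ae (h.ae_eq_left hp' hf ((Lp.memLp _).locallyIntegrable (by norm_num))),
    eLpNorm_Lp_fourierInv]

lemma integrable_schwartz_mul_memLp (φ : 𝓢(Space d, ℂ)) {f : Space d → ℂ} {p : ℝ≥0∞}
    (hp : 1 ≤ p) (hf : MemLp f p volume) : Integrable fun x => φ x * f x := by
  have := ENNReal.HolderConjugate.inv_one_sub_inv' hp
  have h1 := hf.integrable_mul (φ.memLp (1 - p⁻¹)⁻¹ volume)
  convert h1 using 1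
  ext y
  exact mul_comm _ _

lemma IsFourierPair.sub {f F g G : Space d → ℂ} (h : IsFourierPair f F) (h' : IsFourierPair g G)
    (hf : MemLp f 2 volume) (hg : MemLp g 2 volume) (hF : MemLp F 2 volume)
    (hG : MemLp G 2 volume) : IsFourierPair (f - g) (F - G) := by
  intro φ
  simp only [Pi.sub_apply, mul_sub]
  rw [integral_sub (integrable_schwartz_mul_memLp _ one_le_two hf)
    (integrable_schwartz_mul_memLp _ one_le_two hg),
    integral_sub (integrable_schwartz_mul_memLp _ one_le_two hF)
    (integrable_schwartz_mul_memLp _ one_le_two hG), h φ, h' φ]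

lemma tendsto_eLpNorm_two_mul {c : ℕ → Space d → ℂ} (hc : ∀ n, Measurable (c n))
    (hc1 : ∀ n ξ, ‖c n ξ‖ ≤ 1)
    (hlim : ∀ᵐ ξ, Filter.Tendsto (fun n => c n ξ) Filter.atTop (nhds 0))
    {F : Space d → ℂ} (hF : MemLp F 2 volume) :
    Filter.Tendsto (fun n => eLpNorm (fun ξ => c n ξ * F ξ) 2 volume) Filter.atTop (nhds 0) := by
  simp_rw [eLpNorm_two_sq]
  have hfin : ∫⁻ ξ, ‖F ξ‖ₑ ^ 2 ≠ ⊤ := by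
    intro h
    have := hF.2.ne
    rw [eLpNorm_two_sq, h] at this
    simp at this
  have h0 : Filter.Tendsto (fun n => ∫⁻ ξ, ‖c n ξ * F ξ‖ₑ ^ 2) Filter.atTop
      (nhds (∫⁻ _ : Space d, 0)) := by
    refine tendsto_lintegral_of_dominated_convergence' (fun ξ => ‖F ξ‖ₑ ^ 2) (fun n => ?_)
      (fun n => Filter.Eventually.of_forall fun ξ => ?_) hfin ?_
    · exact (((hc n).aestronglyMeasurable.mul hF.1).enorm).pow_const 2
    · simp only [enorm_mul]
      have h1 : ‖c n ξ‖ₑ ≤ 1 := by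
        rw [← ofReal_norm]
        exact ENNReal.ofReal_le_one.2 (hc1 n ξ)
      calc (‖c n ξ‖ₑ * ‖F ξ‖ₑ) ^ 2 ≤ (1 * ‖F ξ‖ₑ) ^ 2 := by gcongr
        _ = _ := by rw [one_mul]
    · filter_upwards [hlim] with ξ hξ
      have h2 : Filter.Tendsto (fun n => c n ξ * F ξ) Filter.atTop (nhds 0) := by
        simpa using hξ.mul_const (F ξ)
      have h3 := ((continuous_enorm.tendsto (0 : ℂ)).comp h2)
      have h4 := ((ENNReal.continuous_pow 2).tendsto _).comp h3
      simpa only [Function.comp_def, enorm_zero, ne_eq, OfNat.ofNat_ne_zero, not_false_eq_true, zero_pow] using h4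
  have h5 := ((ENNReal.continuous_rpow_const (y := (1 / 2 : ℝ))).tendsto _).comp h0
  simpa only [Function.comp_def, lintegral_zero, ENNReal.zero_rpow_of_pos (show (0:ℝ) < 1 / 2 by norm_num)] using h5

end LTwo

/-! ### Decomposition into frequency blocks -/

section Decomposition

variable (P : DyadicPartition d)

/-- The symbol of the homogeneous block with the index `q : ℤ`. -/
def ringSym (q : ℤ) (ξ : Space d) : ℝ := P.φ ((2 : ℝ) ^ (-q) • (2 * Real.pi) • ξ)

lemma continuous_ringSym (q : ℤ) : Continuous (ringSym P q) := by
  have := P.smooth_φ.continuous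
  unfold ringSym
  fun_prop

lemma hasCompactSupport_ringSym (q : ℤ) : HasCompactSupport (ringSym P q) :=
  (P.compact_φ.comp_smul (two_zpow_ne_zero (-q))).comp_smul two_pi_ne_zero'

lemma ringSym_nonneg (q : ℤ) (ξ : Space d) : 0 ≤ ringSym P q ξ := P.nonneg_φ _

lemma ringSym_le_one (q : ℤ) (ξ : Space d) : ringSym P q ξ ≤ 1 := P.φ_le_one _

/-- The homogeneous frequency block `φ(2^{-q} ξ) Θ(ξ)`. -/
def cut (q : ℤ) (Θ : Space d → ℂ) (ξ : Space d) : ℂ := (ringSym P q ξ : ℂ) * Θ ξ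

lemma norm_ringSym_le_one (q : ℤ) (ξ : Space d) : ‖(ringSym P q ξ : ℂ)‖ ≤ 1 := by
  rw [Complex.norm_real, Real.norm_of_nonneg (ringSym_nonneg P q ξ)]
  exact ringSym_le_one P q ξ

lemma continuous_ringSym_complex (q : ℤ) : Continuous fun ξ => (ringSym P q ξ : ℂ) :=
  Complex.continuous_ofReal.comp (continuous_ringSym P q)

lemma memLp_ringSym (q : ℤ) (p : ℝ≥0∞) : MemLp (fun ξ => (ringSym P q ξ : ℂ)) p volume :=
  (continuous_ringSym_complex P q).memLp_of_hasCompactSupport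
    ((hasCompactSupport_ringSym P q).comp_left (g := fun t : ℝ => (t : ℂ)) (by simp))

lemma memLp_cut (q : ℤ) {Θ : Space d → ℂ} (hΘ : MemLp Θ 2 volume) :
    MemLp (cut P q Θ) 2 volume := by
  refine MemLp.of_le hΘ ((continuous_ringSym_complex P q).aestronglyMeasurable.mul hΘ.1)
    (Filter.Eventually.of_forall fun ξ => ?_)
  rw [cut, norm_mul]
  exact mul_le_of_le_one_left (norm_nonneg _) (norm_ringSym_le_one P q ξ)

lemma integrable_cut (q : ℤ) {Θ : Space d → ℂ} (hΘ : MemLp Θ 2 volume) :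
    Integrable (cut P q Θ) :=
  (memLp_ringSym P q 2).integrable_mul hΘ

/-- The size of the homogeneous block with the index `q`. -/
def amp (q : ℤ) (Θ : Space d → ℂ) : ℝ≥0∞ := eLpNorm (𝓕⁻ (cut P q Θ)) ∞ volume

lemma eLpNorm_ringSym (q : ℤ) : eLpNorm (fun ξ => (ringSym P q ξ : ℂ)) 2 volume =
    2 ^ ((q : ℝ) * (d / 2)) * eLpNorm (fun ξ => (ringSym P 0 ξ : ℂ)) 2 volume := by
  rw [eLpNorm_two_sq, eLpNorm_two_sq]
  have hm : Measurable fun ξ : Space d => ‖(ringSym P 0 ξ : ℂ)‖ₑ ^ 2 :=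
    ((continuous_ringSym_complex P 0).measurable.enorm).pow_const 2
  have h := lintegral_comp_smul (two_zpow_ne_zero (-q)) hm
  have e : ∀ ξ : Space d, ringSym P 0 ((2 : ℝ) ^ (-q) • ξ) = ringSym P q ξ := by
    intro ξ
    rw [ringSym, ringSym]
    simp only [neg_zero, zpow_zero, one_smul]
    rw [smul_comm]
  simp_rw [e] at h
  rw [h, ENNReal.mul_rpow_of_nonneg _ _ (by norm_num)]
  congr 1
  rw [← Real.enorm_eq_ofReal_abs, zpow_neg, inv_pow, inv_inv, enorm_pow, enorm_two_zpow,
    ← ENNReal.rpow_natCast, ← ENNReal.rpow_mul, ← ENNReal.rpow_mul]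
  congr 1
  ring

/-- Bernstein's inequality: the supremum is at most the `L¹` norm on the Fourier side, and
Cauchy–Schwarz on the ring costs the square root of its volume, `2^{qd/2}`. The decay as `q → -∞`
makes the negative scales summable. -/
lemma amp_le (q : ℤ) {Θ : Space d → ℂ} (hΘ : MemLp Θ 2 volume) :
    amp P q Θ ≤ 2 ^ ((q : ℝ) * (d / 2)) * (eLpNorm (fun ξ => (ringSym P 0 ξ : ℂ)) 2 volume *
      eLpNorm Θ 2 volume) := by
  rw [← mul_assoc, ← eLpNorm_ringSym, amp]
  refine (eLpNorm_exponent_top (f := 𝓕⁻ (cut P q Θ)) (μ := volume)).le.trans ?_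
  refine essSup_le_of_ae_le _ (Filter.Eventually.of_forall fun x => ?_)
  refine (enorm_fourierInv_le _ x).trans ?_
  simp_rw [cut, enorm_mul]
  exact lintegral_enorm_mul_le (continuous_ringSym_complex P q).aestronglyMeasurable hΘ.1

lemma amp_ne_top (q : ℤ) {Θ : Space d → ℂ} (hΘ : MemLp Θ 2 volume) : amp P q Θ ≠ ⊤ :=
  ne_top_of_le_ne_top (ENNReal.mul_ne_top (two_rpow_ne_top _)
    (ENNReal.mul_ne_top (memLp_ringSym P 0 2).2.ne hΘ.2.ne)) (amp_le P q hΘ)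

lemma IsHomSymbol.zpow {m : Space d → ℂ} (hm : IsHomSymbol m) (q : ℤ) (ξ : Space d) :
    m ((2 : ℝ) ^ q • ξ) = m ξ := hm.homog _ ξ (by positivity)

/-- Homogeneity of degree zero makes `m` invariant under dyadic dilations, and the enlarged cut-off
equals `1` where `φ` lives. So `m(D)` acts on the block at scale `q` through one dilated Schwartz
symbol. -/
lemma blk_cut_eq {m : Space d → ℂ} (hm : IsHomSymbol m) {ρ : 𝓢(Space d, ℂ)}
    (hρ : ∀ ξ, ρ ξ = m ξ * (P.fat ((2 * Real.pi) • ξ) : ℂ)) (q : ℤ) (Θ : Space d → ℂ) :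
    blk q ρ (cut P q Θ) = 𝓕⁻ fun ξ => (ringSym P q ξ : ℂ) * (m ξ * Θ ξ) := by
  rw [blk]
  congr 1
  ext ξ
  rw [dil_apply, hρ, hm.zpow, cut, ringSym, smul_comm (2 * Real.pi)]
  have h := P.fat_mul_φ ((2 : ℝ) ^ (-q) • (2 * Real.pi) • ξ)
  have h' : (P.fat ((2 : ℝ) ^ (-q) • (2 * Real.pi) • ξ) : ℂ) *
      (P.φ ((2 : ℝ) ^ (-q) • (2 * Real.pi) • ξ) : ℂ) =
      (P.φ ((2 : ℝ) ^ (-q) • (2 * Real.pi) • ξ) : ℂ) := by exact_mod_cast h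
  linear_combination m ξ * Θ ξ * h'

/-- The frequency truncation of a function converges in `L²`. -/
theorem tendsto_truncation (hd : 0 < d) {f F : Space d → ℂ} (hf : MemLp f 2 volume)
    (hF : MemLp F 2 volume) (h : IsFourierPair f F) :
    Filter.Tendsto (fun N : ℕ => eLpNorm (f - ∑ q ∈ Finset.Ico (-(N : ℤ)) N,
      𝓕⁻ fun ξ => (ringSym P q ξ : ℂ) * F ξ) 2 volume) Filter.atTop (nhds 0) := by
  have : Nonempty (Fin d) := ⟨⟨0, hd⟩⟩
  have hi : ∀ q, Integrable (cut P q F) := fun q => integrable_cut P q hF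
  have h2 : ∀ q, MemLp (cut P q F) 2 volume := fun q => memLp_cut P q hF
  have hsum : ∀ s : Finset ℤ, (∑ q ∈ s, 𝓕⁻ (cut P q F)) = 𝓕⁻ (fun ξ => ∑ q ∈ s, cut P q F ξ) := by
    intro s
    ext x
    rw [Finset.sum_apply]
    simp only [Real.fourierInv_eq]
    rw [← integral_finsetSum]
    · congr 1; ext ξ; rw [Finset.smul_sum]
    · intro q _
      simpa using (Real.fourierIntegral_convergent_iff (-x)).2 (hi q)
  have key : ∀ N : ℕ, eLpNorm (f - ∑ q ∈ Finset.Ico (-(N : ℤ)) N,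
      𝓕⁻ fun ξ => (ringSym P q ξ : ℂ) * F ξ) 2 volume = eLpNorm (fun ξ =>
        ((1 - ∑ q ∈ Finset.Ico (-(N : ℤ)) N, ringSym P q ξ : ℝ) : ℂ) * F ξ) 2 volume := by
    intro N
    have hI : Integrable fun ξ => ∑ q ∈ Finset.Ico (-(N : ℤ)) N, cut P q F ξ :=
      integrable_finsetSum _ fun q _ => hi q
    have hM : MemLp (fun ξ => ∑ q ∈ Finset.Ico (-(N : ℤ)) N, cut P q F ξ) 2 volume :=
      memLp_finsetSum _ fun q _ => h2 q
    have hfi : MemLp (𝓕⁻ fun ξ => ∑ q ∈ Finset.Ico (-(N : ℤ)) N, cut P q F ξ) 2 volume :=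
      ⟨(continuous_fourierInv hI).aestronglyMeasurable, by
        rw [eLpNorm_fourierInv hI hM]; exact hM.2⟩
    have hp := h.sub (isFourierPair_fourierInv hI) hf hfi hF hM
    have e : (fun ξ => ((1 - ∑ q ∈ Finset.Ico (-(N : ℤ)) N, ringSym P q ξ : ℝ) : ℂ) * F ξ) =
        F - fun ξ => ∑ q ∈ Finset.Ico (-(N : ℤ)) N, cut P q F ξ := by
      ext ξ
      simp only [Pi.sub_apply, cut]
      rw [← Finset.sum_mul]
      push_cast
      ring
    rw [e, ← hp.eLpNorm_eq ((hf.sub hfi).locallyIntegrable one_le_two) (hF.sub hM), ← hsum]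
    rfl
  simp_rw [key]
  refine tendsto_eLpNorm_two_mul (fun n => ?_) (fun n ξ => ?_) ?_ hF
  · apply Continuous.measurable
    refine Complex.continuous_ofReal.comp (continuous_const.sub ?_)
    exact continuous_finsetSum _ fun q _ => continuous_ringSym P q
  · rw [Complex.norm_real]
    exact P.sum_φ_mem n _
  -- The homogeneous partition misses only the origin, a null set as `d > 0`.
  · have h0 : ∀ᵐ ξ : Space d, ξ ≠ 0 := by
      simp [ae_iff]
    filter_upwards [h0] with ξ hξ
    have h1 := P.tendsto_sum_φ (ξ := (2 * Real.pi) • ξ) (smul_ne_zero two_pi_ne_zero' hξ)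
    have h3 := (Complex.continuous_ofReal.tendsto _).comp (h1.const_sub 1)
    simpa only [Function.comp_def, ringSym, sub_self, Complex.ofReal_zero] using h3

/-- The bilinear operator applied to `f` is the limit of its values at the truncations of `f`. -/
theorem tendsto_bil (hd : 0 < d) (κ : 𝓢(Space d, ℂ)) {a : Space d → ℝ} (ha : MemLp a 2 volume)
    {f F : Space d → ℂ} (hf : MemLp f 2 volume)
    (hF : MemLp F 2 volume) (h : IsFourierPair f F) (x : Space d) :
    Filter.Tendsto (fun N : ℕ => ∑ q ∈ Finset.Ico (-(N : ℤ)) N,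
      bil κ a (𝓕⁻ fun ξ => (ringSym P q ξ : ℂ) * F ξ) x) Filter.atTop (nhds (bil κ a f x)) := by
  -- For fixed `x`, `bil` is the pairing of its second factor with an `L²` function, so `L²`
  -- convergence of the truncations gives pointwise convergence.
  have hΦ := memLp_two_translate_mul_diff κ ha x
  have hfq : ∀ q, MemLp (𝓕⁻ fun ξ => (ringSym P q ξ : ℂ) * F ξ) 2 volume := fun q =>
    ⟨(continuous_fourierInv (integrable_cut P q hF)).aestronglyMeasurable,
      (eLpNorm_fourierInv (integrable_cut P q hF) (memLp_cut P q hF)).trans_lt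
        (memLp_cut P q hF).2⟩
  have hs : ∀ N : ℕ, MemLp (∑ q ∈ Finset.Ico (-(N : ℤ)) N,
      𝓕⁻ fun ξ => (ringSym P q ξ : ℂ) * F ξ) 2 volume := fun N =>
    memLp_finsetSum' _ fun q _ => hfq q
  rw [tendsto_iff_edist_tendsto_0]
  have hlim := (ENNReal.Tendsto.const_mul (a := eLpNorm (fun y => κ (x - y) *
    ((a y - a x : ℝ) : ℂ)) 2 volume) (tendsto_truncation P hd hf hF h) (Or.inr hΦ.2.ne))
  rw [mul_zero] at hlim
  refine tendsto_of_tendsto_of_tendsto_of_le_of_le tendsto_const_nhds hlim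
    (fun N => zero_le) fun N => ?_
  have e : bil κ a f x - ∑ q ∈ Finset.Ico (-(N : ℤ)) N,
      bil κ a (𝓕⁻ fun ξ => (ringSym P q ξ : ℂ) * F ξ) x =
      ∫ y, (κ (x - y) * ((a y - a x : ℝ) : ℂ)) * (f - ∑ q ∈ Finset.Ico (-(N : ℤ)) N,
      𝓕⁻ fun ξ => (ringSym P q ξ : ℂ) * F ξ) y := by
    simp only [bil]
    have hi : ∀ q, Integrable fun y => κ (x - y) * ((a y - a x : ℝ) : ℂ) *
        (𝓕⁻ fun ξ => (ringSym P q ξ : ℂ) * F ξ) y := fun q => hΦ.integrable_mul (hfq q)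
    rw [← integral_finsetSum _ fun q _ => hi q, ← integral_sub]
    · congr 1
      ext y
      rw [Pi.sub_apply, Finset.sum_apply, mul_sub, Finset.mul_sum]
    · exact hΦ.integrable_mul hf
    · exact integrable_finsetSum _ fun q _ => hi q
  simp only
  rw [edist_comm, edist_eq_enorm_sub, e]
  exact enorm_integral_mul_le hΦ.1 (hf.sub (hs N)).1

lemma liminf_sum_le_tsum (u : ℤ → ℝ≥0∞) :
    Filter.liminf (fun N : ℕ => ∑ q ∈ Finset.Ico (-(N : ℤ)) N, u q) Filter.atTop ≤ ∑' q, u q :=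
  Filter.liminf_le_of_le (by isBoundedDefault) fun b hb => by
    obtain ⟨N, hN⟩ := hb.exists
    exact hN.trans (ENNReal.sum_le_tsum _)

/-- Fatou's lemma: pointwise convergence of the partial sums suffices, with no convergence in `L^p`,
and the right side may be infinite. -/
theorem eLpNorm_bil_le_tsum (hd : 0 < d) (κ : 𝓢(Space d, ℂ)) {a : Space d → ℝ}
    (hac : Continuous a) (ha : MemLp a 2 volume)
    {f F : Space d → ℂ} (hf : MemLp f 2 volume)
    (hF : MemLp F 2 volume) (h : IsFourierPair f F) {p : ℝ≥0∞} (hp : 1 ≤ p) :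
    eLpNorm (bil κ a f) p volume ≤
      ∑' q : ℤ, eLpNorm (bil κ a (𝓕⁻ fun ξ => (ringSym P q ξ : ℂ) * F ξ)) p volume := by
  have hm : ∀ q, AEStronglyMeasurable (bil κ a (𝓕⁻ fun ξ => (ringSym P q ξ : ℂ) * F ξ)) volume :=
    fun q => measurable_bil κ.continuous hac
      (continuous_fourierInv (integrable_cut P q hF)).aestronglyMeasurable
  have h1 := Lp.eLpNorm_lim_le_liminf_eLpNorm (p := p) (μ := volume)
    (f := fun N : ℕ => fun x => ∑ q ∈ Finset.Ico (-(N : ℤ)) N,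
      bil κ a (𝓕⁻ fun ξ => (ringSym P q ξ : ℂ) * F ξ) x)
    (fun N => Finset.aestronglyMeasurable_fun_sum _ fun q _ => hm q) (bil κ a f)
    (Filter.Eventually.of_forall fun x => tendsto_bil P hd κ ha hf hF h x)
  refine h1.trans (le_trans (Filter.liminf_le_liminf (Filter.Eventually.of_forall fun N => ?_))
    (liminf_sum_le_tsum _))
  refine le_trans (le_of_eq ?_) (eLpNorm_sum_le (fun q _ => hm q) hp)
  congr 1
  ext x
  simp

theorem eLpNorm_bilDiv_le_tsum (hd : 0 < d) (k : ℤ) (ψ : 𝓢(Space d, ℂ)) {v : Space d → Space d}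
    (hvc : Continuous v) (hv : MemLp v 2 volume)
    {f F : Space d → ℂ} (hf : MemLp f 2 volume)
    (hF : MemLp F 2 volume) (h : IsFourierPair f F) {p : ℝ≥0∞} (hp : 1 ≤ p) :
    eLpNorm (bilDiv k ψ v f) p volume ≤
      ∑' q : ℤ, eLpNorm (bilDiv k ψ v (𝓕⁻ fun ξ => (ringSym P q ξ : ℂ) * F ξ)) p volume := by
  have hm : ∀ q, AEStronglyMeasurable
      (bilDiv k ψ v (𝓕⁻ fun ξ => (ringSym P q ξ : ℂ) * F ξ)) volume :=
    fun q => measurable_bilDiv k ψ hvc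
      (continuous_fourierInv (integrable_cut P q hF)).aestronglyMeasurable
  have h1 := Lp.eLpNorm_lim_le_liminf_eLpNorm (p := p) (μ := volume)
    (f := fun N : ℕ => fun x => ∑ q ∈ Finset.Ico (-(N : ℤ)) N,
      bilDiv k ψ v (𝓕⁻ fun ξ => (ringSym P q ξ : ℂ) * F ξ) x)
    (fun N => Finset.aestronglyMeasurable_fun_sum _ fun q _ => hm q) (bilDiv k ψ v f)
    (Filter.Eventually.of_forall fun x => by
      have h2 := tendsto_finsetSum Finset.univ fun (i : Fin d) _ =>
        tendsto_bil P hd (ker k (dsym i ψ)) (memLp_coord hv i) hf hF h x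
      have h3 := h2.const_mul ((2 : ℝ) ^ k : ℂ)
      refine h3.congr fun N => ?_
      rw [Finset.sum_comm, Finset.mul_sum]
      rfl)
  refine h1.trans (le_trans (Filter.liminf_le_liminf (Filter.Eventually.of_forall fun N => ?_))
    (liminf_sum_le_tsum _))
  refine le_trans (le_of_eq ?_) (eLpNorm_sum_le (fun q _ => hm q) hp)
  congr 1
  ext x
  simp

end Decomposition

/-! ### Summation over the frequency scales -/

section Scales

lemma two_rpow_mono {s t : ℝ} (h : s ≤ t) : (2 : ℝ≥0∞) ^ s ≤ 2 ^ t :=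
  ENNReal.rpow_le_rpow_of_exponent_le one_le_two h

lemma tsum_nat_two_rpow_ne_top {σ : ℝ} (hσ : 0 < σ) :
    ∑' n : ℕ, (2 : ℝ≥0∞) ^ (-(σ * n)) ≠ ⊤ := by
  have h : ∀ n : ℕ, (2 : ℝ≥0∞) ^ (-(σ * n)) = (2 ^ (-σ)) ^ n := fun n => by
    rw [← ENNReal.rpow_natCast, ← ENNReal.rpow_mul, neg_mul]
  simp_rw [h]
  rw [ENNReal.tsum_geometric, ENNReal.inv_ne_top, Ne, tsub_eq_zero_iff_le, not_le]
  exact ENNReal.rpow_lt_one_of_one_lt_of_neg ENNReal.one_lt_two (by linarith)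

/-- The sum `∑ 2^{-σ|n|}` over the integers. -/
def geoSum (σ : ℝ) : ℝ≥0∞ := ∑' n : ℤ, 2 ^ (-(σ * |(n : ℝ)|))

lemma geoSum_ne_top {σ : ℝ} (hσ : 0 < σ) : geoSum σ ≠ ⊤ := by
  have h := HasSum.of_nat_of_neg_add_one (f := fun n : ℤ => (2 : ℝ≥0∞) ^ (-(σ * |(n : ℝ)|)))
    ENNReal.summable.hasSum ENNReal.summable.hasSum
  rw [geoSum, h.tsum_eq]
  refine ENNReal.add_ne_top.2 ⟨?_, ?_⟩
  · simpa using tsum_nat_two_rpow_ne_top hσ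
  · refine ne_top_of_le_ne_top (tsum_nat_two_rpow_ne_top hσ) (ENNReal.tsum_le_tsum fun n => ?_)
    apply two_rpow_mono
    push_cast
    rw [abs_neg, abs_of_nonneg (by positivity)]
    nlinarith

lemma tsum_two_rpow_sub (σ : ℝ) (k : ℤ) :
    ∑' q : ℤ, (2 : ℝ≥0∞) ^ (-(σ * |(k : ℝ) - q|)) = geoSum σ := by
  rw [geoSum, ← (Equiv.subLeft k).tsum_eq]
  simp

lemma tsum_two_rpow_sub' (σ : ℝ) (q : ℤ) :
    ∑' k : ℤ, (2 : ℝ≥0∞) ^ (-(σ * |(k : ℝ) - q|)) = geoSum σ := by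
  rw [← tsum_two_rpow_sub σ q]
  simp_rw [abs_sub_comm]

/-- Cauchy–Schwarz for the splitting `u c = √u · (√u c)`. -/
lemma tsum_mul_sq_le (u c : ℤ → ℝ≥0∞) :
    (∑' q, u q * c q) ^ 2 ≤ (∑' q, u q) * ∑' q, u q * c q ^ 2 := by
  have h := ENNReal.lintegral_mul_le_Lp_mul_Lq (Measure.count : Measure ℤ)
    Real.HolderConjugate.two_two
    (f := fun q => u q ^ (1 / 2 : ℝ)) (g := fun q => u q ^ (1 / 2 : ℝ) * c q)
    (measurable_of_countable _).aemeasurable (measurable_of_countable _).aemeasurable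
  simp only [lintegral_count, Pi.mul_apply] at h
  have e1 : ∀ q, u q ^ (1 / 2 : ℝ) * (u q ^ (1 / 2 : ℝ) * c q) = u q * c q := fun q => by
    rw [← mul_assoc, ← ENNReal.rpow_add_of_nonneg _ _ (by norm_num) (by norm_num)]
    norm_num
  have e2 : ∀ q, (u q ^ (1 / 2 : ℝ)) ^ (2 : ℝ) = u q := fun q => by
    rw [← ENNReal.rpow_mul]; norm_num
  have e3 : ∀ q, (u q ^ (1 / 2 : ℝ) * c q) ^ (2 : ℝ) = u q * c q ^ 2 := fun q => by
    rw [ENNReal.mul_rpow_of_nonneg _ _ (by norm_num), e2]; norm_num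
  simp_rw [e1, e2, e3] at h
  refine (pow_le_pow_left₀ zero_le h 2).trans (le_of_eq ?_)
  rw [mul_pow, ← ENNReal.rpow_natCast, ← ENNReal.rpow_natCast, ← ENNReal.rpow_mul,
    ← ENNReal.rpow_mul]
  norm_num

/-- Young's inequality for the convolution of `ℓ¹` and `ℓ²`, with the kernel `2^{-σ|n|}`. -/
theorem tsum_sq_conv_le (σ : ℝ) (c : ℤ → ℝ≥0∞) :
    ∑' k : ℤ, (∑' q : ℤ, 2 ^ (-(σ * |(k : ℝ) - q|)) * c q) ^ 2 ≤
      geoSum σ ^ 2 * ∑' q, c q ^ 2 := by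
  calc ∑' k : ℤ, (∑' q : ℤ, 2 ^ (-(σ * |(k : ℝ) - q|)) * c q) ^ 2
      ≤ ∑' k : ℤ, geoSum σ * ∑' q : ℤ, 2 ^ (-(σ * |(k : ℝ) - q|)) * c q ^ 2 :=
        ENNReal.tsum_le_tsum fun k => by
          rw [← tsum_two_rpow_sub σ k]
          exact tsum_mul_sq_le _ _
    _ = _ := by
        rw [ENNReal.tsum_mul_left, ENNReal.tsum_comm]
        simp_rw [ENNReal.tsum_mul_right, tsum_two_rpow_sub']
        rw [ENNReal.tsum_mul_left, sq, mul_assoc]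

end Scales

/-! ### Estimates of the bilinear operators -/

section Estimates

variable (P : DyadicPartition d)

/-- The three estimates for a single pair of frequency scales. -/
theorem exists_eLpNorm_bil_block_le {m : Space d → ℂ} (hm : IsHomSymbol m) (ψ : 𝓢(Space d, ℂ)) :
    ∃ C : ℝ≥0, ∀ (k q : ℤ) {a : Space d → ℝ}, ContDiff ℝ ∞ a → MemLp a 2 volume →
      ∀ {p : ℝ≥0∞}, 1 ≤ p → ∀ {Θ : Space d → ℂ}, MemLp Θ 2 volume →
      (∀ t : ℝ, (t = k ∨ t = q) →
        eLpNorm (bil (ker k ψ) a (𝓕⁻ fun ξ => (ringSym P q ξ : ℂ) * (m ξ * Θ ξ))) p volume ≤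
          C * 2 ^ (-t) * (eLpNorm (fderiv ℝ a) p volume * amp P q Θ)) ∧
      eLpNorm (bil (ker k ψ) a (𝓕⁻ fun ξ => (ringSym P q ξ : ℂ) * (m ξ * Θ ξ))) p volume ≤
          C * (eLpNorm a p volume * amp P q Θ) := by
  obtain ⟨ρ, σ, hρ, hσ⟩ := exists_fatSym P hm
  -- `C1` belongs to the gain `2^{-k}` from the moment of the kernel, `C2` to the gain `2^{-q}` from
  -- integration by parts, `C3` to the bound without gradient.
  set C1 := kmass ρ * kmoment ψ with hC1
  set C2 := ∑ j, (kmass (σ j) + 1) * (kmoment (dsym j ψ) + kmass ψ + 1) with hC2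
  set C3 := 2 * (kmass ρ * kmass ψ) with hC3
  have f1 : C1 ≠ ⊤ := ENNReal.mul_ne_top (kmass_ne_top _) (kmoment_ne_top _)
  have f2 : C2 ≠ ⊤ := ENNReal.sum_ne_top.2 fun j _ => by
    simp [ENNReal.mul_eq_top, kmass_ne_top, kmoment_ne_top]
  have f3 : C3 ≠ ⊤ := by
    simp [hC3, ENNReal.mul_eq_top, kmass_ne_top]
  have f : C1 + C2 + C3 ≠ ⊤ := by simp [f1, f2, f3]
  refine ⟨(C1 + C2 + C3).toNNReal, fun k q a ha ha2 p hp Θ hΘ => ⟨fun t ht => ?_, ?_⟩⟩ <;>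
    rw [ENNReal.coe_toNNReal f, ← blk_cut_eq P hm hρ q Θ]
  · rw [mul_comm (C1 + C2 + C3)]
    rcases ht with rfl | rfl
    · refine (eLpNorm_bil_blk_le k q ψ ρ ha hp (integrable_cut P q hΘ) (amp_ne_top P q hΘ)).trans ?_
      rw [amp, ← hC1]
      gcongr
      rw [add_assoc]
      exact le_self_add
    · refine (eLpNorm_bil_blk_le_of_sum k q ψ σ hσ ha ha2 hp (integrable_cut P q hΘ)
        (amp_ne_top P q hΘ)).trans ?_
      rw [amp, ← hC2]
      gcongr
      exact le_add_self.trans le_self_add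
  · refine (eLpNorm_bil_blk_le_two k q ψ ρ ha hp (integrable_cut P q hΘ)
        (amp_ne_top P q hΘ)).trans ?_
    rw [amp, ← hC3]
    gcongr
    exact le_add_self

/-- The convection commutator is bounded in terms of the largest block of `θ`. -/
theorem exists_eLpNorm_bilDiv_le (hd : 0 < d) {m : Space d → ℂ} (hm : IsHomSymbol m)
    (ψ : 𝓢(Space d, ℂ)) :
    ∃ C : ℝ≥0, ∀ (k : ℤ) {v : Space d → Space d}, ContDiff ℝ ∞ v → MemLp v 2 volume → DivFree v →
      ∀ {p : ℝ≥0∞}, 1 ≤ p → ∀ {f Θ : Space d → ℂ}, MemLp f 2 volume → MemLp Θ 2 volume →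
      IsFourierPair f (fun ξ => m ξ * Θ ξ) →
      eLpNorm (bilDiv k ψ v f) p volume ≤
        C * (eLpNorm (fderiv ℝ v) p volume * ⨆ q, amp P q Θ) := by
  obtain ⟨ρ, σ, hρ, hσ⟩ := exists_fatSym P hm
  set C1 := ∑ i, (kmass (dsym i ρ) * kmoment ψ + 1) with hC1
  set C2 := ∑ i, ∑ j, (kmass (σ j) + 1) *
    (kmoment (dsym j (dsym i ψ)) + kmass (dsym i ψ) + 1) with hC2
  have f1 : C1 ≠ ⊤ := ENNReal.sum_ne_top.2 fun j _ => by
    simp [ENNReal.mul_eq_top, kmass_ne_top, kmoment_ne_top]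
  have f2 : C2 ≠ ⊤ := ENNReal.sum_ne_top.2 fun i _ => ENNReal.sum_ne_top.2 fun j _ => by
    simp [ENNReal.mul_eq_top, kmass_ne_top, kmoment_ne_top]
  have f : geoSum 1 * (C1 + C2) ≠ ⊤ :=
    ENNReal.mul_ne_top (geoSum_ne_top one_pos) (by simp [f1, f2])
  refine ⟨(geoSum 1 * (C1 + C2)).toNNReal, fun k v hv hv2 hdiv p hp g Θ hg hΘ hgΘ => ?_⟩
  rw [ENNReal.coe_toNNReal f]
  have hF : MemLp (fun ξ => m ξ * Θ ξ) 2 volume := by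
    refine MemLp.of_le hΘ (hm.measurable.aestronglyMeasurable.mul hΘ.1)
      (Filter.Eventually.of_forall fun ξ => ?_)
    rw [norm_mul]
    exact mul_le_of_le_one_left (norm_nonneg _) (hm.norm_le ξ)
  refine (eLpNorm_bilDiv_le_tsum P hd k ψ hv.continuous hv2 hg hF hgΘ hp).trans ?_
  rw [← tsum_two_rpow_sub 1 k, mul_assoc, ← ENNReal.tsum_mul_right]
  refine ENNReal.tsum_le_tsum fun q => ?_
  rw [← blk_cut_eq P hm hρ q Θ]
  have hb := amp_ne_top P q hΘ
  have hle : amp P q Θ ≤ ⨆ q, amp P q Θ := le_iSup (fun q => amp P q Θ) q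
  -- For `q ≥ k` the block is used as a divergence, giving `2^{k-q}`; for `q ≤ k` the condition `div
  -- v = 0` gives `2^{q-k}`.
  rcases le_total k q with h | h
  · refine (eLpNorm_bilDiv_le_of_sum k q ψ σ hσ hv hv2 hp (integrable_cut P q hΘ) hb).trans ?_
    rw [← hC2, mul_assoc, one_mul, abs_of_nonpos (by simpa using h), neg_neg]
    gcongr
    · exact le_add_self
    · exact hle
  · refine (eLpNorm_bilDiv_le k q ψ ρ hv hv2 hdiv hp (integrable_cut P q hΘ) hb).trans ?_
    rw [← hC1, mul_assoc, one_mul, abs_of_nonneg (by simpa using h), neg_sub]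
    gcongr
    · exact le_self_add
    · exact hle

/-- The weighted blocks of nonnegative index. -/
def wamp (s : ℝ) (Θ : Space d → ℂ) (q : ℤ) : ℝ≥0∞ :=
  if 0 ≤ q then 2 ^ ((q : ℝ) * (s - 1)) * amp P q Θ else 0

/-- The product commutator at a nonnegative frequency scale. -/
theorem exists_eLpNorm_bil_le (hd : 0 < d) {m : Space d → ℂ} (hm : IsHomSymbol m)
    (ψ : 𝓢(Space d, ℂ)) {s : ℝ} (hs0 : 0 < s) (hs1 : s < 1) :
    ∃ C : ℝ≥0, ∀ (k : ℕ) {a : Space d → ℝ}, ContDiff ℝ ∞ a → MemLp a 2 volume →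
      ∀ {f Θ : Space d → ℂ}, MemLp f 2 volume → MemLp Θ 2 volume →
      IsFourierPair f (fun ξ => m ξ * Θ ξ) →
      ∀ B : ℝ≥0∞, (∀ q : ℤ, q < 0 → amp P q Θ ≤ B) →
      2 ^ ((k : ℝ) * s) * eLpNorm (bil (ker k ψ) a f) 2 volume ≤
        C * (eLpNorm (fderiv ℝ a) 2 volume *
            ∑' q : ℤ, 2 ^ (-(min s (1 - s) * |((k : ℤ) : ℝ) - q|)) * wamp P s Θ q +
          2 ^ (-((1 - s) / 2 * k)) * (eLpNorm (fderiv ℝ a) 2 volume * B +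
            eLpNorm a 2 volume * eLpNorm Θ 2 volume)) := by
  obtain ⟨C0, hC0⟩ := exists_eLpNorm_bil_block_le P hm ψ
  set R := eLpNorm (fun ξ : Space d => (ringSym P 0 ξ : ℂ)) 2 volume with hR
  have hRt : R ≠ ⊤ := (memLp_ringSym P 0 2).2.ne
  -- The decay rate in `q < 0` left after interpolation: Bernstein's exponent `d/2` times the
  -- interpolation weight `(1 - s)/2`.
  set τ : ℝ := (1 - s) / 2 * (d / 2) with hτ
  have hτ0 : 0 < τ := by
    have : (0 : ℝ) < d := by exact_mod_cast hd
    have : 0 < 1 - s := by linarith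
    positivity
  set C1 := C0 * (1 + (R + 1) * geoSum τ) with hC1
  have f : C1 ≠ ⊤ := by
    have := geoSum_ne_top hτ0
    refine ENNReal.mul_ne_top (by simp) (ENNReal.add_ne_top.2 ⟨by simp, ENNReal.mul_ne_top ?_ this⟩)
    simp [hRt]
  refine ⟨C1.toNNReal, fun k a ha ha2 f Θ hf hΘ hfΘ B hB => ?_⟩
  rw [ENNReal.coe_toNNReal ‹_›]
  have hF : MemLp (fun ξ => m ξ * Θ ξ) 2 volume := by
    refine MemLp.of_le hΘ (hm.measurable.aestronglyMeasurable.mul hΘ.1)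
      (Filter.Eventually.of_forall fun ξ => ?_)
    rw [norm_mul]
    exact mul_le_of_le_one_left (norm_nonneg _) (hm.norm_le ξ)
  set G := eLpNorm (fderiv ℝ a) 2 volume with hG
  set Y := eLpNorm a 2 volume with hY
  set T := eLpNorm Θ 2 volume with hT
  set σ := min s (1 - s) with hσ
  set u : ℤ → ℝ≥0∞ := fun q =>
    eLpNorm (bil (ker k ψ) a (𝓕⁻ fun ξ => (ringSym P q ξ : ℂ) * (m ξ * Θ ξ))) 2 volume with hu
  have hterm : ∀ q : ℤ, 2 ^ ((k : ℝ) * s) * u q ≤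
      C0 * (G * (2 ^ (-(σ * |((k : ℤ) : ℝ) - q|)) * wamp P s Θ q)) +
      C0 * (R + 1) * (2 ^ (-((1 - s) / 2 * k)) * (G * B + Y * T)) * 2 ^ (-(τ * |(q : ℝ)|)) := by
    intro q
    obtain ⟨h1, h2⟩ := hC0 k q ha ha2 one_le_two hΘ
    rcases le_or_gt 0 q with hq | hq
    · refine le_trans ?_ le_self_add
      rw [wamp, if_pos hq]
      have key : ∀ t : ℝ, (t = k ∨ t = q) → (k : ℝ) * s - t ≤ -(σ * |((k : ℤ) : ℝ) - q|) +
          (q : ℝ) * (s - 1) → 2 ^ ((k : ℝ) * s) * u q ≤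
          C0 * (G * (2 ^ (-(σ * |((k : ℤ) : ℝ) - q|)) * (2 ^ ((q : ℝ) * (s - 1)) * amp P q Θ))) := by
        intro t ht hle
        calc 2 ^ ((k : ℝ) * s) * u q ≤ 2 ^ ((k : ℝ) * s) * (C0 * 2 ^ (-t) * (G * amp P q Θ)) := by
              gcongr
              exact h1 t (by simpa using ht)
          _ = C0 * (G * (2 ^ ((k : ℝ) * s - t) * amp P q Θ)) := by
              rw [sub_eq_add_neg, two_rpow_add]; ring
          _ ≤ C0 * (G * (2 ^ (-(σ * |((k : ℤ) : ℝ) - q|) + (q : ℝ) * (s - 1)) * amp P q Θ)) := by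
              gcongr
              · exact one_le_two
          _ = _ := by rw [two_rpow_add]; ring
      -- For `q ≥ k`, `ks - q = -s(q - k) + q(s - 1)`; for `q ≤ k`, `ks - k = -(1 - s)(k - q) + q(s
      -- - 1)`. Both decay at least at the rate `σ`.
      rcases le_total ((k : ℤ) : ℝ) (q : ℝ) with h | h
      · refine key q (Or.inr rfl) ?_
        rw [abs_of_nonpos (by linarith)]
        have : σ ≤ s := min_le_left _ _
        push_cast at h ⊢
        nlinarith
      · refine key k (Or.inl rfl) ?_
        rw [abs_of_nonneg (by linarith)]
        have : σ ≤ 1 - s := min_le_right _ _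
        push_cast at h ⊢
        nlinarith
    · refine le_trans ?_ le_add_self
      have hq' : (q : ℝ) ≤ 0 := by exact_mod_cast hq.le
      rw [abs_of_nonpos hq']
      have hA : G * B ≤ (R + 1) * (G * B + Y * T) := by
        calc G * B ≤ 1 * (G * B + Y * T) := by rw [one_mul]; exact le_self_add
          _ ≤ _ := by gcongr; exact le_add_self
      have hYT : R * (Y * T) ≤ (R + 1) * (G * B + Y * T) := by
        gcongr
        · exact le_self_add
        · exact le_add_self
      have x1 : 2 ^ ((k : ℝ) * s) * u q ≤
          C0 * (R + 1) * (G * B + Y * T) * 2 ^ (-((1 - s) * k)) := by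
        calc 2 ^ ((k : ℝ) * s) * u q
            ≤ 2 ^ ((k : ℝ) * s) * (C0 * 2 ^ (-(k : ℝ)) * (G * amp P q Θ)) := by
              gcongr
              exact h1 k (Or.inl (by simp))
          _ ≤ 2 ^ ((k : ℝ) * s) * (C0 * 2 ^ (-(k : ℝ)) * (G * B)) := by
              gcongr
              exact hB q hq
          _ = C0 * (G * B) * 2 ^ (-((1 - s) * k)) := by
              rw [show -((1 - s) * (k : ℝ)) = k * s + -k by ring, two_rpow_add]; ring
          _ ≤ C0 * ((R + 1) * (G * B + Y * T)) * 2 ^ (-((1 - s) * k)) := by gcongr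
          _ = _ := by ring
      have x2 : 2 ^ ((k : ℝ) * s) * u q ≤
          C0 * (R + 1) * (G * B + Y * T) * 2 ^ ((k : ℝ) * s + q * (d / 2)) := by
        calc 2 ^ ((k : ℝ) * s) * u q
            ≤ 2 ^ ((k : ℝ) * s) * (C0 * (Y * amp P q Θ)) := by gcongr
          _ ≤ 2 ^ ((k : ℝ) * s) * (C0 * (Y * (2 ^ ((q : ℝ) * (d / 2)) * (R * T)))) := by
              gcongr
              exact amp_le P q hΘ
          _ = C0 * (R * (Y * T)) * 2 ^ ((k : ℝ) * s + q * (d / 2)) := by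
              rw [two_rpow_add]; ring
          _ ≤ C0 * ((R + 1) * (G * B + Y * T)) * 2 ^ ((k : ℝ) * s + q * (d / 2)) := by gcongr
          _ = _ := by ring
      have e : C0 * (R + 1) * (2 ^ (-((1 - s) / 2 * (k : ℝ))) * (G * B + Y * T)) *
          2 ^ (-(τ * -(q : ℝ))) = C0 * (R + 1) * (G * B + Y * T) *
          2 ^ (-((1 - s) / 2 * (k : ℝ)) + τ * q) := by
        rw [two_rpow_add, mul_neg, neg_neg]; ring
      rw [e]
      -- `x1` has no decay in `q` and `x2` grows with `k`. The target exponent is the convex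
      -- combination of theirs with weights `1 - ε` and `ε`, hence at least the smaller one; this
      -- `ε` leaves the decay `2^{-(1-s)k/2}`.
      set ε := (1 - s) / 2 with hε
      have hε0 : 0 < ε := by rw [hε]; linarith
      have hε1 : ε < 1 := by rw [hε]; linarith
      rcases le_total (-((1 - s) * (k : ℝ))) ((k : ℝ) * s + q * (d / 2)) with h | h
      · refine x1.trans (mul_le_mul_right (two_rpow_mono ?_) _)
        · have e3 : -(ε * (k : ℝ)) + τ * q = (1 - ε) * (-((1 - s) * (k : ℝ))) +
            ε * ((k : ℝ) * s + q * (d / 2)) := by rw [hτ, hε]; ring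
          rw [e3]
          nlinarith
      · refine x2.trans (mul_le_mul_right (two_rpow_mono ?_) _)
        · have e3 : -(ε * (k : ℝ)) + τ * q = (1 - ε) * (-((1 - s) * (k : ℝ))) +
            ε * ((k : ℝ) * s + q * (d / 2)) := by rw [hτ, hε]; ring
          rw [e3]
          nlinarith
  calc 2 ^ ((k : ℝ) * s) * eLpNorm (bil (ker k ψ) a f) 2 volume
      ≤ 2 ^ ((k : ℝ) * s) * ∑' q, u q := by
        gcongr
        exact eLpNorm_bil_le_tsum P hd _ ha.continuous ha2 hf hF hfΘ one_le_two
    _ = ∑' q, 2 ^ ((k : ℝ) * s) * u q := ENNReal.tsum_mul_left.symm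
    _ ≤ ∑' q : ℤ, (C0 * (G * (2 ^ (-(σ * |((k : ℤ) : ℝ) - q|)) * wamp P s Θ q)) +
      C0 * (R + 1) * (2 ^ (-((1 - s) / 2 * (k : ℝ))) * (G * B + Y * T)) * 2 ^ (-(τ * |(q : ℝ)|))) :=
        ENNReal.tsum_le_tsum hterm
    _ = C0 * (G * ∑' q : ℤ, 2 ^ (-(σ * |((k : ℤ) : ℝ) - q|)) * wamp P s Θ q) +
        C0 * ((R + 1) * geoSum τ) * (2 ^ (-((1 - s) / 2 * (k : ℝ))) * (G * B + Y * T)) := by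
        rw [ENNReal.tsum_add, ENNReal.tsum_mul_left, ENNReal.tsum_mul_left, ENNReal.tsum_mul_left,
          ← geoSum]
        ring
    _ ≤ C1 * (G * ∑' q : ℤ, 2 ^ (-(σ * |((k : ℤ) : ℝ) - q|)) * wamp P s Θ q) +
        C1 * (2 ^ (-((1 - s) / 2 * (k : ℝ))) * (G * B + Y * T)) := by
        gcongr
        · rw [hC1, mul_add, mul_one]; exact le_self_add
        · rw [hC1]; gcongr; exact le_add_self
    _ = _ := (mul_add _ _ _).symm

end Estimates

/-! ### Distributions with a density -/

section Density

/-- The tempered distribution `u` is the function `g`, tested with all Schwartz functions. -/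
def HasDensity (u : Temp d) (g : Space d → ℂ) : Prop := ∀ φ : 𝓢(Space d, ℂ), u φ = ∫ x, φ x * g x

lemma HasDensity.isFunction {u : Temp d} {g : Space d → ℂ} (h : HasDensity u g)
    (hg : LocallyIntegrable g volume) : IsFunction u g := ⟨hg, fun φ _ => h φ⟩

lemma hasDensity_toLp {p : ℝ≥0∞} [hp : Fact (1 ≤ p)] {g : Space d → ℂ} (hg : MemLp g p volume) :
    HasDensity (hg.toLp g : Temp d) g := toTemperedDistribution_toLp_apply hg

lemma IsFunction.hasDensity {u : Temp d} {g : Space d → ℂ} (h : IsFunction u g) {p : ℝ≥0∞}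
    [hp : Fact (1 ≤ p)] (hg : MemLp g p volume) : HasDensity u g := by
  rw [h.eq_toLp hg]
  exact hasDensity_toLp hg

lemma IsFunction.congr_hasDensity {u u' : Temp d} {g : Space d → ℂ} (h : IsFunction u g)
    (h' : HasDensity u' g) : u = u' := h.eq (h'.isFunction h.1)

lemma HasDensity.fourier {u : Temp d} {f F : Space d → ℂ} (h : HasDensity u f)
    (hF : IsFourierPair f F) : HasDensity (𝓕 u) F := fun φ => by
  rw [TemperedDistribution.fourier_apply, h, hF]

lemma HasDensity.of_fourier {u : Temp d} {f F : Space d → ℂ} (h : HasDensity (𝓕 u) F)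
    (hF : IsFourierPair f F) : HasDensity u f := fun φ => by
  have h1 := hF (𝓕⁻ φ)
  rw [FourierTransform.fourier_fourierInv_eq] at h1
  rw [h1, ← h, TemperedDistribution.fourier_apply, FourierTransform.fourier_fourierInv_eq]

lemma hasDensity_multiplier {u : Temp d} {f F : Space d → ℂ} {m : Space d → ℝ}
    (h : HasDensity (𝓕 u) F)
    (hm : (fun ξ : Space d => ((m ((2 * Real.pi) • ξ) : ℝ) : ℂ)).HasTemperateGrowth)
    (hf : IsFourierPair f fun ξ => (m ((2 * Real.pi) • ξ) : ℂ) * F ξ) :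
    HasDensity (multiplier m u) f := by
  refine HasDensity.of_fourier (fun φ => ?_) hf
  rw [multiplier, TemperedDistribution.fourierMultiplierCLM_apply,
    FourierTransform.fourier_fourierInv_eq, TemperedDistribution.smulLeftCLM_apply_apply, h]
  congr 1
  ext ξ
  rw [SchwartzMap.smulLeftCLM_apply_apply hm, smul_eq_mul]
  ring

lemma distLpNorm_multiplier {u : Temp d} {f F : Space d → ℂ} {m : Space d → ℝ}
    (h : HasDensity (𝓕 u) F)
    (hm : (fun ξ : Space d => ((m ((2 * Real.pi) • ξ) : ℝ) : ℂ)).HasTemperateGrowth)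
    (hf : IsFourierPair f fun ξ => (m ((2 * Real.pi) • ξ) : ℂ) * F ξ)
    (hloc : LocallyIntegrable f volume) (p : ℝ≥0∞) :
    distLpNorm p (multiplier m u) = eLpNorm f p volume :=
  ((hasDensity_multiplier h hm hf).isFunction hloc).distLpNorm_eq p

lemma enorm_fourier_le (F : Space d → ℂ) (x : Space d) : ‖𝓕 F x‖ₑ ≤ ∫⁻ ξ, ‖F ξ‖ₑ := by
  rw [Real.fourier_eq]
  refine (enorm_integral_le_lintegral_enorm _).trans (le_of_eq ?_)
  congr 1
  ext ξ
  rw [← ofReal_norm, Circle.norm_smul, ofReal_norm]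

lemma continuous_fourier {F : Space d → ℂ} (h1 : Integrable F) : Continuous (𝓕 F) :=
  VectorFourier.fourierIntegral_continuous Real.continuous_fourierChar
    (by simpa using continuous_inner) h1

lemma memLp_top_fourier {F : Space d → ℂ} (h1 : Integrable F) : MemLp (𝓕 F) ∞ volume := by
  refine ⟨(continuous_fourier h1).aestronglyMeasurable, ?_⟩
  rw [eLpNorm_exponent_top]
  exact (essSup_le_of_ae_le _ (Filter.Eventually.of_forall fun x => enorm_fourier_le F x)).trans_lt
    h1.2

/-- The divergence `∑ 2πi ξ_i W_i` on the Fourier side. -/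
def divSym (W : Fin d → Space d → ℂ) (ξ : Space d) : ℂ :=
  ∑ i, 2 * Real.pi * Complex.I * (ξ i : ℂ) * W i ξ

lemma schwartz_mul_divSym (φ : 𝓢(Space d, ℂ)) {W : Fin d → Space d → ℂ}
    (hW : ∀ i, MemLp (W i) ∞ volume) :
    ∫ ξ, φ ξ * divSym W ξ = ∑ i, ∫ ξ, dsym i φ ξ * W i ξ := by
  rw [← integral_finsetSum _ fun i _ => integrable_schwartz_mul_memLp (dsym i φ) le_top (hW i)]
  congr 1
  ext ξ
  rw [divSym, Finset.mul_sum]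
  refine Finset.sum_congr rfl fun i _ => ?_
  rw [dsym_apply]
  ring

/-- Such a function grows at most linearly. The distribution is built from the bounded `W i` through
multiplication by coordinates. -/
lemma exists_hasDensity_divSym {W : Fin d → Space d → ℂ} (hW : ∀ i, MemLp (W i) ∞ volume) :
    ∃ u : Temp d, HasDensity u (divSym W) := by
  refine ⟨∑ i, (2 * Real.pi * Complex.I) • TemperedDistribution.smulLeftCLM ℂ
    (fun ξ => ((inner ℝ ξ (basisVec i) : ℝ) : ℂ)) ((hW i).toLp (W i) : Temp d), fun φ => ?_⟩
  rw [schwartz_mul_divSym φ hW]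
  simp only [sum_apply]
  refine Finset.sum_congr rfl fun i _ => ?_
  have h : (fun ξ : Space d => inner ℝ ξ (basisVec i)).HasTemperateGrowth := by fun_prop
  rw [← hasDensity_toLp (hW i) (dsym i φ), dsym, map_smul, ← SchwartzMap.smulLeftCLM_ofReal ℂ h]
  rfl

lemma divSym_mul_left (c : Space d → ℂ) (W : Fin d → Space d → ℂ) (ξ : Space d) :
    c ξ * divSym W ξ = divSym (fun i ξ => c ξ * W i ξ) ξ := by
  rw [divSym, divSym, Finset.mul_sum]
  exact Finset.sum_congr rfl fun i _ => by ring

lemma locallyIntegrable_divSym {W : Fin d → Space d → ℂ} (hW : ∀ i, MemLp (W i) ∞ volume) :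
    LocallyIntegrable (divSym W) volume := by
  unfold divSym
  refine locallyIntegrable_finsetSum _ fun i _ => ?_
  have h : LocallyIntegrable (W i) volume := (hW i).locallyIntegrable le_top
  rw [← locallyIntegrableOn_univ] at h ⊢
  exact h.continuousOn_mul (by fun_prop) isClosed_univ.isLocallyClosed

end Density

/-! ### The Fourier transforms of the commutators -/

section Structure

/-- The data of the Riesz transform of a square integrable function: `Θ` is the Fourier transform
of `θ`, and `f` is the Riesz transform of `θ`. -/
structure IsRieszData (j : Fin d) (θ : Space d → ℝ) (Θ f : Space d → ℂ) : Prop where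
  memLp_left : MemLp θ 2 volume
  memLp_fourier : MemLp Θ 2 volume
  memLp_riesz : MemLp f 2 volume
  pair : IsFourierPair (fun x => (θ x : ℂ)) Θ
  pair_riesz : IsFourierPair f fun ξ => rieszSymbol j ξ * Θ ξ

lemma IsHomSymbol.memLp {m : Space d → ℂ} (hm : IsHomSymbol m) {Θ : Space d → ℂ} {p : ℝ≥0∞}
    (hΘ : MemLp Θ p volume) : MemLp (fun ξ => m ξ * Θ ξ) p volume := by
  refine MemLp.of_le hΘ (hm.measurable.aestronglyMeasurable.mul hΘ.1)
    (Filter.Eventually.of_forall fun ξ => ?_)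
  rw [norm_mul]
  exact mul_le_of_le_one_left (norm_nonneg _) (hm.norm_le ξ)

lemma IsHomSymbol.eLpNorm_le {m : Space d → ℂ} (hm : IsHomSymbol m) (Θ : Space d → ℂ)
    (p : ℝ≥0∞) : eLpNorm (fun ξ => m ξ * Θ ξ) p volume ≤ eLpNorm Θ p volume := by
  refine eLpNorm_mono fun ξ => ?_
  rw [norm_mul]
  exact mul_le_of_le_one_left (norm_nonneg _) (hm.norm_le ξ)

lemma exists_isRieszData (j : Fin d) {θ : Space d → ℝ} (hθ : MemLp θ 2 volume) :
    ∃ Θ f, IsRieszData j θ Θ f := by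
  have h1 := isFourierPair_Lp ((hθ.ofReal (K := ℂ)).toLp _)
  set Θ : Lp ℂ 2 (volume : Measure (Space d)) := 𝓕 ((hθ.ofReal (K := ℂ)).toLp _) with hΘ
  have hr := (isHomSymbol_riesz j).memLp (Lp.memLp Θ)
  have h2 := isFourierPair_Lp (𝓕⁻ (hr.toLp _))
  rw [FourierTransform.fourier_fourierInv_eq] at h2
  exact ⟨Θ, _, hθ, Lp.memLp Θ, Lp.memLp _, h1.congr (MemLp.coeFn_toLp _) (ae_eq_refl _),
    h2.congr (ae_eq_refl _) hr.coeFn_toLp⟩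

namespace IsRieszData

variable {j : Fin d} {θ : Space d → ℝ} {Θ f : Space d → ℂ} (h : IsRieszData j θ Θ f)
include h

lemma eLpNorm_fourier : eLpNorm Θ 2 volume = eLpNorm θ 2 volume := by
  rw [← h.pair.eLpNorm_eq ((h.memLp_left.ofReal (K := ℂ)).locallyIntegrable one_le_two)
    h.memLp_fourier]
  exact eLpNorm_congr_norm_ae (Filter.Eventually.of_forall fun x => by simp)

lemma eLpNorm_riesz_le : eLpNorm f 2 volume ≤ eLpNorm θ 2 volume := by
  rw [h.pair_riesz.eLpNorm_eq (h.memLp_riesz.locallyIntegrable one_le_two)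
    ((isHomSymbol_riesz j).memLp h.memLp_fourier), ← h.eLpNorm_fourier]
  exact (isHomSymbol_riesz j).eLpNorm_le Θ 2

lemma hasDensity_ofL2 : HasDensity (ofL2 θ h.memLp_left) (fun x => (θ x : ℂ)) :=
  hasDensity_toLp _

lemma isRiesz : IsRiesz j (ofL2 θ h.memLp_left) (h.memLp_riesz.toLp f : Temp d) :=
  ⟨Θ, (h.hasDensity_ofL2.fourier h.pair).isFunction (h.memLp_fourier.locallyIntegrable one_le_two),
    ((hasDensity_toLp h.memLp_riesz).fourier h.pair_riesz).isFunction
      (((isHomSymbol_riesz j).memLp h.memLp_fourier).locallyIntegrable one_le_two)⟩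

/-- The function `g` in `IsRiesz` represents the transform of `θ`, so it equals `Θ` almost
everywhere and the Riesz transform is unique. -/
lemma hasDensity_of_isRiesz {u : Temp d} (hu : IsRiesz j (ofL2 θ h.memLp_left) u) :
    HasDensity u f := by
  obtain ⟨g, hg, hu⟩ := hu
  have h1 := hg.ae_eq ((h.hasDensity_ofL2.fourier h.pair).isFunction
    (h.memLp_fourier.locallyIntegrable one_le_two))
  have h2 := hu.congr_ae (g' := fun ξ => rieszSymbol j ξ * Θ ξ) (by
    filter_upwards [h1] with ξ hξ
    rw [hξ])
  exact (h2.hasDensity ((isHomSymbol_riesz j).memLp h.memLp_fourier)).of_fourier h.pair_riesz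

end IsRieszData

/-! ### Products and convection terms of square integrable functions. -/

lemma integrable_ofReal_mul {a : Space d → ℝ} {f : Space d → ℂ} (ha : MemLp a 2 volume)
    (hf : MemLp f 2 volume) : Integrable fun x => (a x : ℂ) * f x :=
  (ha.ofReal (K := ℂ)).integrable_mul hf

lemma exists_schwartz_mul {a : Space d → ℝ} (ha : ContDiff ℝ ∞ a) (φ : 𝓢(Space d, ℂ))
    (hφ : HasCompactSupport φ) : ∃ ψ : 𝓢(Space d, ℂ), ∀ x, ψ x = (a x : ℂ) * φ x := by
  have h1 : HasCompactSupport fun x => (a x : ℂ) * φ x := hφ.mul_left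
  have h2 : ContDiff ℝ ∞ fun x => (a x : ℂ) * φ x :=
    (Complex.ofRealCLM.contDiff.comp ha).mul (φ.smooth ⊤)
  exact ⟨h1.toSchwartzMap h2, fun x => rfl⟩

lemma hasDensity_of_isProduct {a : Space d → ℝ} {u w : Temp d} {f : Space d → ℂ}
    (ha : MemLp a 2 volume) (hf : MemLp f 2 volume) (hu : HasDensity u f)
    (h : IsProduct a u w) : HasDensity w fun x => (a x : ℂ) * f x := by
  have hi := integrable_ofReal_mul ha hf
  refine IsFunction.hasDensity (p := 1) ⟨hi.locallyIntegrable, fun φ hφ => ?_⟩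
    (memLp_one_iff_integrable.2 hi)
  obtain ⟨ψ, hψ⟩ := exists_schwartz_mul h.1 φ hφ
  rw [h.2 φ ψ hφ hψ, hu]
  congr 1
  ext x
  rw [hψ]
  ring

lemma isProduct_of_hasDensity {a : Space d → ℝ} {u w : Temp d} {f : Space d → ℂ}
    (ha : ContDiff ℝ ∞ a) (hu : HasDensity u f) (hw : HasDensity w fun x => (a x : ℂ) * f x) :
    IsProduct a u w := by
  refine ⟨ha, fun φ ψ _ hψ => ?_⟩
  rw [hw, hu]
  congr 1
  ext x
  rw [hψ]
  ring

/-- The term `(div v) φ` drops out. By duality `v·∇u = div(vu)`, which involves only the integrable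
products `v_i f`. -/
lemma sum_fderiv_mul {v : Space d → Space d} (hv : ContDiff ℝ ∞ v) (hdiv : DivFree v)
    (φ : 𝓢(Space d, ℂ)) (ψ : Fin d → 𝓢(Space d, ℂ)) (hψ : ∀ i x, ψ i x = (v x i : ℂ) * φ x)
    (x : Space d) :
    ∑ i, (∂_{basisVec i} (ψ i)) x = ∑ i, (v x i : ℂ) * (∂_{basisVec i} φ) x := by
  have h1 : ∀ i, (∂_{basisVec i} (ψ i)) x = (v x i : ℂ) * (∂_{basisVec i} φ) x +
      ((fderiv ℝ v x (basisVec i) i : ℝ) : ℂ) * φ x := by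
    intro i
    rw [SchwartzMap.lineDerivOp_apply_eq_fderiv, SchwartzMap.lineDerivOp_apply_eq_fderiv]
    have e : (ψ i : Space d → ℂ) = fun x => (v x i : ℂ) * φ x := funext (hψ i)
    have h2 : HasFDerivAt (fun x => ((v x i : ℝ) : ℂ))
        (Complex.ofRealCLM.comp (fderiv ℝ (fun x => v x i) x)) x :=
      (Complex.ofRealCLM.hasFDerivAt).comp x
        (((contDiff_coord hv i).differentiable (by simp)) x).hasFDerivAt
    have h4 := (h2.mul (φ.differentiableAt.hasFDerivAt (x := x))).fderiv
    rw [e]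
    change fderiv ℝ ((fun x => ((v x i : ℝ) : ℂ)) * (φ : Space d → ℂ)) x _ = _
    rw [h4]
    simp [fderiv_coord hv, mul_comm]
  simp_rw [h1]
  rw [Finset.sum_add_distrib, ← Finset.sum_mul]
  have h2 := hdiv x
  have h3 : ∑ i, ((fderiv ℝ v x (basisVec i) i : ℝ) : ℂ) = 0 := by exact_mod_cast h2
  rw [h3, zero_mul, add_zero]

/-- The Fourier transform of the convection term. -/
theorem hasDensity_fourier_iff_isConvection {v : Space d → Space d} (hv : ContDiff ℝ ∞ v)
    (hdiv : DivFree v) (hv2 : MemLp v 2 volume) {u w : Temp d} {f : Space d → ℂ}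
    (hf : MemLp f 2 volume) (hu : HasDensity u f) :
    HasDensity (𝓕 w) (divSym fun i => 𝓕 fun x => (v x i : ℂ) * f x) ↔ IsConvection v u w := by
  have hi : ∀ i, Integrable fun x => (v x i : ℂ) * f x := fun i =>
    integrable_ofReal_mul (memLp_coord hv2 i) hf
  have hW : ∀ i, MemLp (𝓕 fun x => (v x i : ℂ) * f x) ∞ volume := fun i =>
    memLp_top_fourier (hi i)
  have key : ∀ T : Temp d, HasDensity (𝓕 T) (divSym fun i => 𝓕 fun x => (v x i : ℂ) * f x) →
      IsConvection v u T := by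
    intro T hT
    refine ⟨hv, fun φ ψ _ hψ => ?_⟩
    have h1 := hT (𝓕⁻ φ)
    rw [TemperedDistribution.fourier_apply, FourierTransform.fourier_fourierInv_eq,
      schwartz_mul_divSym _ hW] at h1
    rw [h1]
    have h2 : ∀ i, ∫ ξ, dsym i (𝓕⁻ φ) ξ * (𝓕 fun x => (v x i : ℂ) * f x) ξ =
        ∫ x, -((v x i : ℂ) * (∂_{basisVec i} φ) x * f x) := by
      intro i
      rw [← isFourierPair_of_integrable (hi i) (dsym i (𝓕⁻ φ))]
      -- The factor `2πi ξ_i` on the Fourier side becomes `-∂_i` on the test function, as in the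
      -- definition of a distributional derivative.
      have h3 : 𝓕 (dsym i (𝓕⁻ φ)) = - ∂_{basisVec i} φ := by
        have := SchwartzMap.lineDerivOp_fourier_eq (𝓕⁻ φ) (basisVec i)
        rw [FourierTransform.fourier_fourierInv_eq] at this
        rw [this, dsym, ← FourierTransform.fourier_neg, neg_smul, neg_neg]
      rw [h3]
      congr 1
      ext x
      simp only [neg_apply]
      ring
    simp_rw [h2, integral_neg]
    have h4 : ∀ i, Integrable fun x => (v x i : ℂ) * (∂_{basisVec i} φ) x * f x := fun i => by
      refine (integrable_schwartz_mul (∂_{basisVec i} φ) (hi i)).congr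
        (Filter.Eventually.of_forall fun x => ?_)
      simp only
      ring
    have h5 : ∀ i, (∂_{basisVec i} u : Temp d) (ψ i) = -∫ x, (∂_{basisVec i} (ψ i)) x * f x := by
      intro i
      rw [TemperedDistribution.lineDerivOp_apply_apply, map_neg, hu]
    simp_rw [h5]
    rw [Finset.sum_neg_distrib, Finset.sum_neg_distrib, ← integral_finsetSum _ fun i _ => h4 i,
      ← integral_finsetSum _ fun i _ =>
        integrable_schwartz_mul_memLp (∂_{basisVec i} (ψ i)) one_le_two hf]
    congr 2
    ext x
    rw [← Finset.sum_mul, ← Finset.sum_mul, sum_fderiv_mul hv hdiv φ ψ hψ]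
  refine ⟨key w, fun h => ?_⟩
  obtain ⟨E, hE⟩ := exists_hasDensity_divSym hW
  have hT := key (𝓕⁻ E) (by rwa [FourierTransform.fourier_fourierInv_eq])
  -- The convection predicate prescribes all values on compactly supported test functions, so it has
  -- only one solution, and `𝓕⁻ E` is one.
  have e : w = 𝓕⁻ E := ext_of_hasCompactSupport fun φ hφ => by
    choose ψ hψ using fun i => exists_schwartz_mul (contDiff_coord hv i) φ hφ
    rw [h.2 φ ψ hφ hψ, hT.2 φ ψ hφ hψ]
  rwa [e, FourierTransform.fourier_fourierInv_eq]

/-- The Fourier transform of the commutator `[R, a] θ`, where `f = R θ`. -/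
def commSym (j : Fin d) (a θ : Space d → ℝ) (f : Space d → ℂ) (ξ : Space d) : ℂ :=
  rieszSymbol j ξ * 𝓕 (fun x => (a x : ℂ) * (θ x : ℂ)) ξ - 𝓕 (fun x => (a x : ℂ) * f x) ξ

namespace IsRieszData

variable {j : Fin d} {θ : Space d → ℝ} {Θ f : Space d → ℂ} (h : IsRieszData j θ Θ f)
include h

lemma memLp_rieszSymbol_mul {a : Space d → ℝ} (ha : MemLp a 2 volume) :
    MemLp (fun ξ => rieszSymbol j ξ * 𝓕 (fun x => (a x : ℂ) * (θ x : ℂ)) ξ) ∞ volume :=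
  (isHomSymbol_riesz j).memLp (memLp_top_fourier (integrable_ofReal_mul ha h.memLp_left.ofReal))

lemma memLp_commSym {a : Space d → ℝ} (ha : MemLp a 2 volume) :
    MemLp (commSym j a θ f) ∞ volume :=
  (h.memLp_rieszSymbol_mul ha).sub (memLp_top_fourier (integrable_ofReal_mul ha h.memLp_riesz))

/-- Each product is in `L¹` by Cauchy–Schwarz, the Fourier transform maps `L¹` to `L^∞`, and `R` is
a contraction on `L²`. This bound alone handles the lowest block of the commutators. -/
lemma enorm_commSym_le {a : Space d → ℝ} (ha : MemLp a 2 volume) (ξ : Space d) :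
    ‖commSym j a θ f ξ‖ₑ ≤ 2 * (eLpNorm a 2 volume * eLpNorm θ 2 volume) := by
  have key : ∀ {g : Space d → ℂ}, MemLp g 2 volume → eLpNorm g 2 volume ≤ eLpNorm θ 2 volume →
      ‖𝓕 (fun x => (a x : ℂ) * g x) ξ‖ₑ ≤ eLpNorm a 2 volume * eLpNorm θ 2 volume := by
    intro g hg hgθ
    refine (enorm_fourier_le _ ξ).trans ?_
    simp_rw [enorm_mul]
    refine (lintegral_enorm_mul_le ha.ofReal.1 hg.1).trans ?_
    have e : eLpNorm (fun x => (a x : ℂ)) 2 volume = eLpNorm a 2 volume :=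
      eLpNorm_congr_norm_ae (Filter.Eventually.of_forall fun x => by simp)
    exact mul_le_mul' e.le hgθ
  have e : eLpNorm (fun x => (θ x : ℂ)) 2 volume = eLpNorm θ 2 volume :=
    eLpNorm_congr_norm_ae (Filter.Eventually.of_forall fun x => by simp)
  rw [two_mul, commSym]
  refine (enorm_sub_le).trans (add_le_add ?_ (key h.memLp_riesz h.eLpNorm_riesz_le))
  rw [enorm_mul]
  have h1 : ‖rieszSymbol j ξ‖ₑ ≤ 1 := by
    rw [← ofReal_norm]
    exact ENNReal.ofReal_le_one.2 ((isHomSymbol_riesz j).norm_le ξ)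
  calc _ ≤ 1 * ‖𝓕 (fun x => (a x : ℂ) * (θ x : ℂ)) ξ‖ₑ := by gcongr
    _ ≤ _ := by rw [one_mul]; exact key h.memLp_left.ofReal e.le

/-- All four intermediate distributions of the predicate are forced by uniqueness of densities,
hence so is the commutator. -/
theorem hasDensity_of_isCommProduct {a : Space d → ℝ} (ha : MemLp a 2 volume) {w : Temp d}
    (hw : IsCommProduct j a (ofL2 θ h.memLp_left) w) : HasDensity (𝓕 w) (commSym j a θ f) := by
  obtain ⟨au, Rau, Ru, aRu, hau, ⟨g, hg, hRau⟩, hRu, haRu, rfl⟩ := hw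
  have hi := integrable_ofReal_mul ha (h.memLp_left.ofReal (K := ℂ))
  have hi' := integrable_ofReal_mul ha h.memLp_riesz
  have h1 := (hasDensity_of_isProduct ha h.memLp_left.ofReal h.hasDensity_ofL2 hau).fourier
    (isFourierPair_of_integrable hi)
  have h2 := (hasDensity_of_isProduct ha h.memLp_riesz (h.hasDensity_of_isRiesz hRu) haRu).fourier
    (isFourierPair_of_integrable hi')
  have h3 := hg.ae_eq (h1.isFunction ((memLp_top_fourier hi).locallyIntegrable le_top))
  have h4 := (hRau.congr_ae (g' := fun ξ => rieszSymbol j ξ * 𝓕 (fun x => (a x : ℂ) * (θ x : ℂ)) ξ)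
    (by filter_upwards [h3] with ξ hξ using congrArg (rieszSymbol j ξ * ·) hξ)).hasDensity (h.memLp_rieszSymbol_mul ha)
  intro φ
  rw [sub_eq_add_neg, FourierTransform.fourier_add, FourierTransform.fourier_neg,
    ← sub_eq_add_neg]
  change 𝓕 Rau φ - 𝓕 aRu φ = _
  rw [h4, h2, ← integral_sub (integrable_schwartz_mul_memLp φ le_top (h.memLp_rieszSymbol_mul ha))
    (integrable_schwartz_mul_memLp φ le_top (memLp_top_fourier hi'))]
  congr 1
  ext ξ
  rw [commSym, mul_sub]

theorem exists_isCommProduct {a : Space d → ℝ} (hac : ContDiff ℝ ∞ a) (ha : MemLp a 2 volume) :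
    ∃ w, IsCommProduct j a (ofL2 θ h.memLp_left) w := by
  have hi := memLp_one_iff_integrable.2 (integrable_ofReal_mul ha (h.memLp_left.ofReal (K := ℂ)))
  have hi' := memLp_one_iff_integrable.2 (integrable_ofReal_mul ha h.memLp_riesz)
  have h0 := h.memLp_rieszSymbol_mul ha
  refine ⟨_, (hi.toLp _ : Temp d), 𝓕⁻ (h0.toLp _ : Temp d), (h.memLp_riesz.toLp f : Temp d),
    (hi'.toLp _ : Temp d), isProduct_of_hasDensity hac h.hasDensity_ofL2 (hasDensity_toLp hi),
    ⟨_, ((hasDensity_toLp hi).fourier (isFourierPair_of_integrable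
      (memLp_one_iff_integrable.1 hi))).isFunction ((memLp_top_fourier
      (memLp_one_iff_integrable.1 hi)).locallyIntegrable le_top), ?_⟩, h.isRiesz,
    isProduct_of_hasDensity hac (hasDensity_toLp h.memLp_riesz) (hasDensity_toLp hi'), rfl⟩
  rw [FourierTransform.fourier_fourierInv_eq]
  exact (hasDensity_toLp h0).isFunction (h0.locallyIntegrable le_top)

theorem hasDensity_of_isCommConvection {v : Space d → Space d} (hv : ContDiff ℝ ∞ v)
    (hdiv : DivFree v) (hv2 : MemLp v 2 volume) {w : Temp d}
    (hw : IsCommConvection j v (ofL2 θ h.memLp_left) w) :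
    HasDensity (𝓕 w) (divSym fun i => commSym j (fun x => v x i) θ f) := by
  obtain ⟨vu, Rvu, Ru, vRu, hvu, ⟨g, hg, hRvu⟩, hRu, hvRu, rfl⟩ := hw
  have hi := fun i => integrable_ofReal_mul (memLp_coord hv2 i) (h.memLp_left.ofReal (K := ℂ))
  have hi' := fun i => integrable_ofReal_mul (memLp_coord hv2 i) h.memLp_riesz
  have h0 := fun i => h.memLp_rieszSymbol_mul (memLp_coord hv2 i)
  have h1 := (hasDensity_fourier_iff_isConvection hv hdiv hv2 h.memLp_left.ofReal
    h.hasDensity_ofL2).2 hvu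
  have h2 := (hasDensity_fourier_iff_isConvection hv hdiv hv2 h.memLp_riesz
    (h.hasDensity_of_isRiesz hRu)).2 hvRu
  have h3 := hg.ae_eq (h1.isFunction (locallyIntegrable_divSym fun i => memLp_top_fourier (hi i)))
  have h4 := hRvu.congr_ae (g' := divSym fun i ξ =>
    rieszSymbol j ξ * 𝓕 (fun x => (v x i : ℂ) * (θ x : ℂ)) ξ) (by
      filter_upwards [h3] with ξ hξ
      exact (congrArg (rieszSymbol j ξ * ·) hξ).trans (divSym_mul_left _ _ _))
  -- `h4` tests only with compact support, and its density need not be in any `L^p`. Identification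
  -- with the tempered `E` extends the formula to all Schwartz functions.
  obtain ⟨E, hE⟩ := exists_hasDensity_divSym h0
  have h5 : HasDensity (𝓕 Rvu) _ := (h4.congr_hasDensity hE) ▸ hE
  intro φ
  rw [sub_eq_add_neg, FourierTransform.fourier_add, FourierTransform.fourier_neg,
    ← sub_eq_add_neg]
  change 𝓕 Rvu φ - 𝓕 vRu φ = _
  rw [h5, h2, schwartz_mul_divSym _ h0, schwartz_mul_divSym _ fun i => memLp_top_fourier (hi' i),
    schwartz_mul_divSym _ fun i => h.memLp_commSym (memLp_coord hv2 i), ← Finset.sum_sub_distrib]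
  refine Finset.sum_congr rfl fun i _ => ?_
  rw [← integral_sub (integrable_schwartz_mul_memLp _ le_top (h0 i))
    (integrable_schwartz_mul_memLp _ le_top (memLp_top_fourier (hi' i)))]
  congr 1
  ext ξ
  rw [commSym, mul_sub]

theorem exists_isCommConvection {v : Space d → Space d} (hv : ContDiff ℝ ∞ v)
    (hdiv : DivFree v) (hv2 : MemLp v 2 volume) :
    ∃ w, IsCommConvection j v (ofL2 θ h.memLp_left) w := by
  have hi := fun i => integrable_ofReal_mul (memLp_coord hv2 i) (h.memLp_left.ofReal (K := ℂ))
  have hi' := fun i => integrable_ofReal_mul (memLp_coord hv2 i) h.memLp_riesz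
  have h0 := fun i => h.memLp_rieszSymbol_mul (memLp_coord hv2 i)
  obtain ⟨E1, hE1⟩ := exists_hasDensity_divSym fun i => memLp_top_fourier (hi i)
  obtain ⟨E2, hE2⟩ := exists_hasDensity_divSym fun i => memLp_top_fourier (hi' i)
  obtain ⟨E3, hE3⟩ := exists_hasDensity_divSym h0
  refine ⟨_, 𝓕⁻ E1, 𝓕⁻ E3, (h.memLp_riesz.toLp f : Temp d), 𝓕⁻ E2,
    (hasDensity_fourier_iff_isConvection hv hdiv hv2 h.memLp_left.ofReal h.hasDensity_ofL2).1 ?_,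
    ⟨divSym fun i => 𝓕 fun x => (v x i : ℂ) * (θ x : ℂ), ?_, ?_⟩, h.isRiesz, (hasDensity_fourier_iff_isConvection hv hdiv hv2 h.memLp_riesz
      (hasDensity_toLp h.memLp_riesz)).1 ?_, rfl⟩
  · rwa [FourierTransform.fourier_fourierInv_eq]
  · rw [FourierTransform.fourier_fourierInv_eq]
    exact hE1.isFunction (locallyIntegrable_divSym fun i => memLp_top_fourier (hi i))
  · rw [FourierTransform.fourier_fourierInv_eq]
    have e : (fun ξ => rieszSymbol j ξ * divSym (fun i => 𝓕 fun x => (v x i : ℂ) * (θ x : ℂ)) ξ) =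
        divSym fun i ξ => rieszSymbol j ξ * 𝓕 (fun x => (v x i : ℂ) * (θ x : ℂ)) ξ :=
      funext fun ξ => divSym_mul_left _ _ ξ
    rw [e]
    exact hE3.isFunction (locallyIntegrable_divSym h0)
  · rwa [FourierTransform.fourier_fourierInv_eq]

end IsRieszData

end Structure

/-! ### Frequency blocks of the commutators -/

section Blocks

lemma fourierInv_sub_apply {F G : Space d → ℂ} (hF : Integrable F) (hG : Integrable G)
    (x : Space d) : 𝓕⁻ (fun ξ => F ξ - G ξ) x = 𝓕⁻ F x - 𝓕⁻ G x := by
  simp only [Real.fourierInv_eq, smul_sub]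
  refine integral_sub ?_ ?_
  · simpa using (Real.fourierIntegral_convergent_iff (-x)).2 hF
  · simpa using (Real.fourierIntegral_convergent_iff (-x)).2 hG

lemma fourierInv_sum_apply {ι : Type*} (s : Finset ι) {F : ι → Space d → ℂ}
    (hF : ∀ i, Integrable (F i)) (x : Space d) :
    𝓕⁻ (fun ξ => ∑ i ∈ s, F i ξ) x = ∑ i ∈ s, 𝓕⁻ (F i) x := by
  simp only [Real.fourierInv_eq, Finset.smul_sum]
  refine integral_finsetSum _ fun i _ => ?_
  simpa using (Real.fourierIntegral_convergent_iff (-x)).2 (hF i)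

lemma fourierInv_const_mul_apply (c : ℂ) (F : Space d → ℂ) (x : Space d) :
    𝓕⁻ (fun ξ => c * F ξ) x = c * 𝓕⁻ F x := by
  simp only [Real.fourierInv_eq]
  rw [← integral_const_mul]
  congr 1
  ext ξ
  rw [Circle.smul_def, Circle.smul_def, smul_eq_mul, smul_eq_mul]
  ring

/-- Expanding the increment gives `κ * (ag) - a (κ * g)`, and each convolution is a Fourier
multiplier. -/
lemma bil_ker_eq (k : ℤ) (ψ : 𝓢(Space d, ℂ)) {a : Space d → ℝ} (ha : MemLp a 2 volume)
    {g G : Space d → ℂ} (hg : MemLp g 2 volume) (h : IsFourierPair g G) (x : Space d) :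
    bil (ker k ψ) a g x = 𝓕⁻ (fun ξ => dil k ψ ξ * 𝓕 (fun y => (a y : ℂ) * g y) ξ) x -
      (a x : ℂ) * 𝓕⁻ (fun ξ => dil k ψ ξ * G ξ) x := by
  have hi := integrable_ofReal_mul ha hg
  rw [← (isFourierPair_of_integrable hi).convolution_eq, ← h.convolution_eq, bil,
    ← integral_const_mul, ← integral_sub]
  · congr 1
    ext y
    rw [ker]
    push_cast
    ring
  · obtain ⟨C, hC⟩ : ∃ C, ∀ x, ‖(ker k ψ) x‖ ≤ C := ⟨_, (ker k ψ).norm_le_seminorm ℝ⟩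
    exact hi.bdd_mul ((ker k ψ).continuous.comp (by fun_prop)).aestronglyMeasurable
      (Filter.Eventually.of_forall fun y => hC _)
  · exact ((memLp_translate (ker k ψ) x 2).integrable_mul hg).const_mul _

lemma integrable_schwartz_mul_top (ψ : 𝓢(Space d, ℂ)) {W : Space d → ℂ}
    (hW : MemLp W ∞ volume) : Integrable fun ξ => ψ ξ * W ξ :=
  integrable_schwartz_mul_memLp ψ le_top hW

lemma memLp_two_schwartz_mul_top (ψ : 𝓢(Space d, ℂ)) {W : Space d → ℂ}
    (hW : MemLp W ∞ volume) : MemLp (fun ξ => ψ ξ * W ξ) 2 volume :=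
  hW.mul' (ψ.memLp 2 volume)

/-- The cancellation behind the theorem. The two operators subtract `a` times the same function, the
block of `Rθ`, with `R` once in the kernel and once in the argument. These terms cancel and the
commutator remains. -/
theorem IsRieszData.fourierInv_dil_commSym {j : Fin d} {θ : Space d → ℝ} {Θ f : Space d → ℂ}
    (h : IsRieszData j θ Θ f) {a : Space d → ℝ} (ha : MemLp a 2 volume) (k : ℤ)
    {ψ ψ' : 𝓢(Space d, ℂ)} (hψ : ∀ ξ, ψ' ξ = rieszSymbol j ξ * ψ ξ) (x : Space d) :
    𝓕⁻ (fun ξ => dil k ψ ξ * commSym j a θ f ξ) x =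
      bil (ker k ψ') a (fun y => (θ y : ℂ)) x - bil (ker k ψ) a f x := by
  have hd : ∀ ξ, dil k ψ' ξ = rieszSymbol j ξ * dil k ψ ξ := fun ξ => by
    rw [dil_apply, dil_apply, hψ, (isHomSymbol_riesz j).zpow]
  have hθ : MemLp (fun x => (θ x : ℂ)) 2 volume := h.memLp_left.ofReal
  have hi := memLp_top_fourier (integrable_ofReal_mul ha hθ)
  have hi' := memLp_top_fourier (integrable_ofReal_mul ha h.memLp_riesz)
  rw [bil_ker_eq k ψ' ha hθ h.pair, bil_ker_eq k ψ ha h.memLp_riesz h.pair_riesz]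
  have e : (fun ξ => dil k ψ' ξ * Θ ξ) = fun ξ => dil k ψ ξ * (rieszSymbol j ξ * Θ ξ) := by
    ext ξ
    rw [hd]
    ring
  rw [e, sub_sub_sub_cancel_right, ← fourierInv_sub_apply (integrable_schwartz_mul_top _ hi)
    (integrable_schwartz_mul_top _ hi')]
  refine congrArg (fun F : Space d → ℂ => 𝓕⁻ F x) (funext fun ξ => ?_)
  rw [hd, commSym]
  ring

/-- The factors `2πi ξ_i` of the divergence are absorbed into the symbol of the block, at the price
of `2^k`. -/
theorem IsRieszData.fourierInv_dil_divSym {j : Fin d} {θ : Space d → ℝ} {Θ f : Space d → ℂ}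
    (h : IsRieszData j θ Θ f) {v : Space d → Space d} (hv : MemLp v 2 volume) (k : ℤ)
    {ψ ψ' : 𝓢(Space d, ℂ)} (hψ : ∀ ξ, ψ' ξ = rieszSymbol j ξ * ψ ξ) (x : Space d) :
    𝓕⁻ (fun ξ => dil k ψ ξ * divSym (fun i => commSym j (fun x => v x i) θ f) ξ) x =
      bilDiv k ψ' v (fun y => (θ y : ℂ)) x - bilDiv k ψ v f x := by
  have e : (fun ξ => dil k ψ ξ * divSym (fun i => commSym j (fun x => v x i) θ f) ξ) =
      fun ξ => ((2 : ℝ) ^ k : ℂ) * ∑ i, dil k (dsym i ψ) ξ * commSym j (fun x => v x i) θ f ξ := by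
    ext ξ
    rw [divSym, Finset.mul_sum, Finset.mul_sum]
    refine Finset.sum_congr rfl fun i _ => ?_
    have h2 := congrArg (fun f : 𝓢(Space d, ℂ) => f ξ) (dil_dsym k i ψ)
    simp only [smul_apply, smul_eq_mul] at h2
    rw [← mul_assoc ((2 : ℝ) ^ k : ℂ), ← h2, dsym_apply]
    ring
  rw [e, fourierInv_const_mul_apply, fourierInv_sum_apply _ fun i =>
    integrable_schwartz_mul_top _ (h.memLp_commSym (memLp_coord hv i)), bilDiv, bilDiv, ← mul_sub,
    ← Finset.sum_sub_distrib]
  congr 1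
  refine Finset.sum_congr rfl fun i _ => ?_
  refine h.fourierInv_dil_commSym (memLp_coord hv i) k (fun ξ => ?_) x
  rw [dsym_apply, dsym_apply, hψ]
  ring

variable (P : DyadicPartition d)

lemma contDiff_sym (k : ℕ) : ContDiff ℝ ∞ (P.sym k) := by
  cases k with
  | zero => exact P.smooth_χ
  | succ k => exact P.smooth_φ.comp (contDiff_const_smul _)

lemma hasCompactSupport_sym (k : ℕ) : HasCompactSupport (P.sym k) := by
  cases k with
  | zero => exact P.compact_χ
  | succ k => exact P.compact_φ.comp_smul (two_zpow_ne_zero _)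

lemma exists_schwartz_sym (k : ℕ) :
    ∃ ψ : 𝓢(Space d, ℂ), ∀ ξ, ψ ξ = (P.sym k ((2 * Real.pi) • ξ) : ℂ) := by
  have h1 : HasCompactSupport fun ξ : Space d => (P.sym k ((2 * Real.pi) • ξ) : ℂ) :=
    ((hasCompactSupport_sym P k).comp_smul two_pi_ne_zero').comp_left
      (g := fun t : ℝ => (t : ℂ)) (by simp)
  have h2 : ContDiff ℝ ∞ fun ξ : Space d => (P.sym k ((2 * Real.pi) • ξ) : ℂ) :=
    Complex.ofRealCLM.contDiff.comp ((contDiff_sym P k).comp (contDiff_const_smul _))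
  exact ⟨h1.toSchwartzMap h2, fun ξ => rfl⟩

/-- The `L^p` norm of a dyadic block, in terms of the Fourier transform. -/
theorem distLpNorm_block (k : ℕ) {u : Temp d} {F : Space d → ℂ} (h : HasDensity (𝓕 u) F)
    (hF : Integrable fun ξ => (P.sym k ((2 * Real.pi) • ξ) : ℂ) * F ξ) (p : ℝ≥0∞) :
    distLpNorm p (block P k u) =
      eLpNorm (𝓕⁻ fun ξ => (P.sym k ((2 * Real.pi) • ξ) : ℂ) * F ξ) p volume := by
  have e : block P k = multiplier (P.sym k) := by cases k <;> rfl
  rw [e]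
  refine distLpNorm_multiplier h ?_ (isFourierPair_fourierInv hF)
    (continuous_fourierInv hF).locallyIntegrable p
  obtain ⟨ψ, hψ⟩ := exists_schwartz_sym P k
  rw [← funext hψ]
  exact ψ.hasTemperateGrowth

lemma sym_succ (k : ℕ) (ξ : Space d) :
    P.sym (k + 1) ((2 * Real.pi) • ξ) = ringSym P k ξ := rfl

lemma integrable_sym_mul (k : ℕ) {W : Space d → ℂ} {p : ℝ≥0∞} (hp : 1 ≤ p)
    (hW : MemLp W p volume) :
    Integrable fun ξ => (P.sym k ((2 * Real.pi) • ξ) : ℂ) * W ξ := by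
  obtain ⟨ψ, hψ⟩ := exists_schwartz_sym P k
  simp_rw [← hψ]
  exact integrable_schwartz_mul_memLp ψ hp hW

lemma integrable_sym_mul_divSym (k : ℕ) {W : Fin d → Space d → ℂ}
    (hW : ∀ i, MemLp (W i) ∞ volume) :
    Integrable fun ξ => (P.sym k ((2 * Real.pi) • ξ) : ℂ) * divSym W ξ := by
  obtain ⟨ψ, hψ⟩ := exists_schwartz_sym P k
  simp_rw [← hψ]
  have e : (fun ξ => ψ ξ * divSym W ξ) = fun ξ => ∑ i, dsym i ψ ξ * W i ξ := by
    ext ξ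
    rw [divSym, Finset.mul_sum]
    refine Finset.sum_congr rfl fun i _ => ?_
    rw [dsym_apply]
    ring
  rw [e]
  exact integrable_finsetSum _ fun i _ => integrable_schwartz_mul_top _ (hW i)

end Blocks

/-! ### Blocks and Besov norms -/

section Besov

variable (P : DyadicPartition d)

lemma le_besovNorm_top (s : ℝ) (p : ℝ≥0∞) (u : Temp d) (k : ℕ) :
    2 ^ (((k : ℝ) - 1) * s) * distLpNorm p (block P k u) ≤ besovNorm P s p ∞ u := by
  rw [besovNorm, eLpNorm_exponent_top, eLpNormEssSup_count]
  exact le_iSup (fun k : ℕ => ‖(2 : ℝ≥0∞) ^ (((k : ℝ) - 1) * s) * distLpNorm p (block P k u)‖ₑ) k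

lemma besovNorm_top_le {s : ℝ} {p : ℝ≥0∞} {u : Temp d} {C : ℝ≥0∞}
    (h : ∀ k : ℕ, 2 ^ (((k : ℝ) - 1) * s) * distLpNorm p (block P k u) ≤ C) :
    besovNorm P s p ∞ u ≤ C := by
  rw [besovNorm, eLpNorm_exponent_top, eLpNormEssSup_count]
  exact iSup_le h

lemma tsum_sq_eq_besovNorm_sq (s : ℝ) (p : ℝ≥0∞) (u : Temp d) :
    ∑' k : ℕ, (2 ^ (((k : ℝ) - 1) * s) * distLpNorm p (block P k u)) ^ 2 =
      besovNorm P s p 2 u ^ 2 := by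
  rw [besovNorm, eLpNorm_eq_lintegral_rpow_enorm_toReal two_ne_zero ENNReal.ofNat_ne_top,
    lintegral_count, ← ENNReal.rpow_natCast, ← ENNReal.rpow_mul]
  simp

lemma le_besovNorm_two (s : ℝ) (p : ℝ≥0∞) (u : Temp d) (k : ℕ) :
    2 ^ (((k : ℝ) - 1) * s) * distLpNorm p (block P k u) ≤ besovNorm P s p 2 u := by
  rw [← ENNReal.pow_le_pow_left_iff two_ne_zero, ← tsum_sq_eq_besovNorm_sq]
  exact ENNReal.le_tsum (f := fun k : ℕ =>
    (2 ^ (((k : ℝ) - 1) * s) * distLpNorm p (block P k u)) ^ 2) k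

-- The shift of one matters: `block P (q + 1)` is `Δ_q`, which for `q ≥ 0` coincides with the
-- homogeneous block at `q`.
variable {P} in
lemma IsRieszData.distLpNorm_block_succ {j : Fin d} {θ : Space d → ℝ} {Θ f : Space d → ℂ}
    (h : IsRieszData j θ Θ f) (q : ℕ) :
    distLpNorm ∞ (block P (q + 1) (ofL2 θ h.memLp_left)) = amp P q Θ :=
  distLpNorm_block P (q + 1) (h.hasDensity_ofL2.fourier h.pair)
    (integrable_sym_mul P (q + 1) one_le_two h.memLp_fourier) ∞

/-- The rings with `q < 0` lie where `χ(·/2) = 1`, and `χ(·/2) = χ + φ`. So the symbols of `Δ_{-1}`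
and `Δ_0` already add up to `1` there. -/
lemma ringSym_mul_low {q : ℤ} (hq : q < 0) (ξ : Space d) :
    ringSym P q ξ * (P.sym 0 ((2 * Real.pi) • ξ) + ringSym P 0 ξ) = ringSym P q ξ := by
  by_cases h : ringSym P q ξ = 0
  · simp [h]
  · have h1 := P.χ_eq_one_of_φ_ne_zero (q := 1 - q) (by omega) h
    rw [smul_smul, ← zpow_add₀ two_ne_zero] at h1
    have e : -(1 - q) + -q = -(1 : ℤ) := by ring
    rw [e] at h1
    have h2 := P.φ_eq ((2 * Real.pi) • ξ)
    rw [h1] at h2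
    have h3 : ringSym P 0 ξ = P.φ ((2 * Real.pi) • ξ) := by
      rw [ringSym]; simp
    rw [h3, h2]
    simp [DyadicPartition.sym]

/-- The blocks with negative index are controlled by the low frequency blocks. -/
theorem exists_amp_le_of_neg :
    ∃ C : ℝ≥0, ∀ {j : Fin d} {θ : Space d → ℝ} {Θ f : Space d → ℂ} (h : IsRieszData j θ Θ f),
      ∀ q : ℤ, q < 0 → amp P q Θ ≤ C * (distLpNorm ∞ (block P 0 (ofL2 θ h.memLp_left)) +
        distLpNorm ∞ (block P 1 (ofL2 θ h.memLp_left))) := by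
  obtain ⟨ψ, hψ⟩ := exists_ringSym P (isHomSymbol_one (d := d))
  refine ⟨(kmass ψ).toNNReal, fun {j θ Θ f} h q hq => ?_⟩
  rw [ENNReal.coe_toNNReal (kmass_ne_top ψ)]
  have hi : ∀ k, Integrable fun ξ => (P.sym k ((2 * Real.pi) • ξ) : ℂ) * Θ ξ := fun k =>
    integrable_sym_mul P k one_le_two h.memLp_fourier
  rw [distLpNorm_block P 0 (h.hasDensity_ofL2.fourier h.pair) (hi 0),
    distLpNorm_block P 1 (h.hasDensity_ofL2.fourier h.pair) (hi 1)]
  -- `F` is the transform of `Δ_{-1}θ + Δ_0θ`; a block of negative index is this function convolved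
  -- with a kernel of fixed mass.
  set F : Space d → ℂ := fun ξ => (P.sym 0 ((2 * Real.pi) • ξ) : ℂ) * Θ ξ +
    (P.sym 1 ((2 * Real.pi) • ξ) : ℂ) * Θ ξ with hF
  have hFi : Integrable F := (hi 0).add (hi 1)
  have e : cut P q Θ = fun ξ => dil q ψ ξ * F ξ := by
    ext ξ
    have h1 : (ringSym P q ξ : ℂ) * ((P.sym 0 ((2 * Real.pi) • ξ) : ℂ) + (ringSym P 0 ξ : ℂ)) =
      (ringSym P q ξ : ℂ) := by exact_mod_cast ringSym_mul_low P hq ξ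
    have h2 : dil q ψ ξ = (ringSym P q ξ : ℂ) := by
      rw [dil_apply, hψ, one_mul, ringSym, smul_comm]
    rw [cut, hF, h2]
    have h3 : P.sym 1 ((2 * Real.pi) • ξ) = ringSym P 0 ξ := rfl
    simp only [h3]
    linear_combination -Θ ξ * h1
  have h4 : 𝓕⁻ F = (𝓕⁻ fun ξ => (P.sym 0 ((2 * Real.pi) • ξ) : ℂ) * Θ ξ) +
      𝓕⁻ fun ξ => (P.sym 1 ((2 * Real.pi) • ξ) : ℂ) * Θ ξ := by
    ext x
    have := fourierInv_sub_apply hFi (hi 1) x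
    simp only [hF, add_sub_cancel_right] at this
    rw [Pi.add_apply, this]
    ring
  have h5 : eLpNorm (𝓕⁻ F) ∞ volume ≤
      eLpNorm (𝓕⁻ fun ξ => (P.sym 0 ((2 * Real.pi) • ξ) : ℂ) * Θ ξ) ∞ volume +
      eLpNorm (𝓕⁻ fun ξ => (P.sym 1 ((2 * Real.pi) • ξ) : ℂ) * Θ ξ) ∞ volume := by
    rw [h4]
    exact eLpNorm_add_le (continuous_fourierInv (hi 0)).aestronglyMeasurable
      (continuous_fourierInv (hi 1)).aestronglyMeasurable le_top
  rw [amp, e, eLpNorm_exponent_top]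
  refine essSup_le_of_ae_le _ (Filter.Eventually.of_forall fun x => ?_)
  exact (enorm_blk_le q ψ hFi x).trans (mul_le_mul_right h5 _)

end Besov

/-! ### Low frequencies -/

section Low

/-- `M` bounds both the supremum and, by Plancherel, the `L²` norm of `𝓕⁻ F`; for finite `p` the
power `p` is split as `(p - 2) + 2`. This is where `p ≥ 2` is needed. -/
lemma eLpNorm_fourierInv_le {F : Space d → ℂ} (h1 : Integrable F) (h2 : MemLp F 2 volume)
    {p : ℝ≥0∞} (hp : 2 ≤ p) :
    eLpNorm (𝓕⁻ F) p volume ≤ (∫⁻ ξ, ‖F ξ‖ₑ) + eLpNorm F 2 volume := by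
  set M := (∫⁻ ξ, ‖F ξ‖ₑ) + eLpNorm F 2 volume with hM
  have hb : ∀ x, ‖𝓕⁻ F x‖ₑ ≤ M := fun x => (enorm_fourierInv_le F x).trans le_self_add
  rcases eq_or_ne p ⊤ with rfl | hpt
  · rw [eLpNorm_exponent_top]
    exact essSup_le_of_ae_le _ (Filter.Eventually.of_forall hb)
  have hp0 : p ≠ 0 := (lt_of_lt_of_le two_pos hp).ne'
  have hp2 : 2 ≤ p.toReal := by
    rw [← ENNReal.toReal_ofNat 2]
    exact ENNReal.toReal_mono hpt hp
  have h3 : ∫⁻ x, ‖𝓕⁻ F x‖ₑ ^ 2 ≤ M ^ 2 := by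
    have h4 : eLpNorm (𝓕⁻ F) 2 volume ≤ M := by
      rw [eLpNorm_fourierInv h1 h2]; exact le_add_self
    rw [eLpNorm_two_sq] at h4
    have h5 := pow_le_pow_left₀ zero_le h4 2
    rw [← ENNReal.rpow_natCast, ← ENNReal.rpow_mul] at h5
    simpa using h5
  rw [eLpNorm_eq_lintegral_rpow_enorm_toReal hp0 hpt]
  have h6 : ∫⁻ x, ‖𝓕⁻ F x‖ₑ ^ p.toReal ≤ M ^ p.toReal := by
    calc ∫⁻ x, ‖𝓕⁻ F x‖ₑ ^ p.toReal
        = ∫⁻ x, ‖𝓕⁻ F x‖ₑ ^ (p.toReal - 2) * ‖𝓕⁻ F x‖ₑ ^ 2 := by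
          congr 1
          ext x
          rw [← ENNReal.rpow_natCast, ← ENNReal.rpow_add_of_nonneg _ _ (by linarith) (by simp)]
          simp
      _ ≤ ∫⁻ x, M ^ (p.toReal - 2) * ‖𝓕⁻ F x‖ₑ ^ 2 := by
          refine lintegral_mono fun x => ?_
          exact mul_le_mul_left (ENNReal.rpow_le_rpow (hb x) (by linarith)) _
      _ = M ^ (p.toReal - 2) * ∫⁻ x, ‖𝓕⁻ F x‖ₑ ^ 2 :=
          lintegral_const_mul _ ((continuous_fourierInv h1).measurable.enorm.pow_const 2)
      _ ≤ M ^ (p.toReal - 2) * M ^ 2 := by gcongr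
      _ = M ^ p.toReal := by
          rw [← ENNReal.rpow_natCast, ← ENNReal.rpow_add_of_nonneg _ _ (by linarith) (by simp)]
          simp
  calc _ ≤ (M ^ p.toReal) ^ (1 / p.toReal) := by gcongr
    _ = M := by
      rw [← ENNReal.rpow_mul, mul_one_div_cancel (by linarith), ENNReal.rpow_one]

lemma eLpNorm_mul_le_of_enorm_le (ψ : 𝓢(Space d, ℂ)) {W : Space d → ℂ} {N : ℝ≥0∞}
    (hN : N ≠ ⊤) (hW : ∀ ξ, ‖W ξ‖ₑ ≤ N) (p : ℝ≥0∞) :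
    eLpNorm (fun ξ => ψ ξ * W ξ) p volume ≤ N * eLpNorm ψ p volume := by
  refine eLpNorm_le_mul_of_enorm_le hN fun ξ => ?_
  rw [enorm_mul, mul_comm]
  gcongr
  exact hW ξ

end Low

/-! ### The convection commutator -/

section Convection

variable (P : DyadicPartition d)

/-- The estimate of the convection commutator at nonnegative frequencies. -/
theorem exists_distLpNorm_convection_high (hd : 0 < d) (j : Fin d) :
    ∃ C : ℝ≥0, ∀ {v : Space d → Space d}, ContDiff ℝ ∞ v → DivFree v → MemLp v 2 volume →
      ∀ {θ : Space d → ℝ} {Θ f : Space d → ℂ}, IsRieszData j θ Θ f → ∀ {w : Temp d},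
      HasDensity (𝓕 w) (divSym fun i => commSym j (fun x => v x i) θ f) →
      ∀ {p : ℝ≥0∞}, 1 ≤ p → ∀ k : ℕ, distLpNorm p (block P (k + 1) w) ≤
        C * (eLpNorm (fderiv ℝ v) p volume * ⨆ q, amp P q Θ) := by
  obtain ⟨ψ, hψ⟩ := exists_ringSym P (isHomSymbol_one (d := d))
  obtain ⟨ψ', hψ'⟩ := exists_ringSym P (isHomSymbol_riesz j)
  obtain ⟨C1, hC1⟩ := exists_eLpNorm_bilDiv_le P hd isHomSymbol_one ψ'
  obtain ⟨C2, hC2⟩ := exists_eLpNorm_bilDiv_le P hd (isHomSymbol_riesz j) ψ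
  refine ⟨C1 + C2, fun {v} hv hdiv hv2 {θ Θ f} h {w} hw {p} hp k => ?_⟩
  have hW := fun i => h.memLp_commSym (memLp_coord hv2 i)
  have hθ : MemLp (fun x => (θ x : ℂ)) 2 volume := h.memLp_left.ofReal
  rw [distLpNorm_block P (k + 1) hw (integrable_sym_mul_divSym P (k + 1) hW)]
  have e : (𝓕⁻ fun ξ => (P.sym (k + 1) ((2 * Real.pi) • ξ) : ℂ) *
      divSym (fun i => commSym j (fun x => v x i) θ f) ξ) =
      bilDiv k ψ' v (fun y => (θ y : ℂ)) - bilDiv k ψ v f := by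
    ext x
    rw [Pi.sub_apply, ← h.fourierInv_dil_divSym hv2 k (ψ := ψ) (ψ' := ψ') (fun ξ => by
      rw [hψ, hψ', one_mul]) x]
    refine congrArg (fun F : Space d → ℂ => 𝓕⁻ F x) (funext fun ξ => ?_)
    rw [dil_apply, hψ, one_mul, sym_succ, ringSym, smul_comm (2 * Real.pi)]
  rw [e]
  refine (eLpNorm_sub_le (measurable_bilDiv k ψ' hv.continuous hθ.1)
    (measurable_bilDiv k ψ hv.continuous h.memLp_riesz.1) hp).trans ?_
  rw [ENNReal.coe_add, add_mul]
  refine add_le_add (hC1 k hv hv2 hdiv hp hθ h.memLp_fourier ?_)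
    (hC2 k hv hv2 hdiv hp h.memLp_riesz h.memLp_fourier h.pair_riesz)
  simpa using h.pair

/-- The estimate of the convection commutator at low frequencies. -/
theorem exists_distLpNorm_convection_low (j : Fin d) :
    ∃ C : ℝ≥0, ∀ {v : Space d → Space d}, MemLp v 2 volume →
      ∀ {θ : Space d → ℝ} {Θ f : Space d → ℂ}, IsRieszData j θ Θ f → ∀ {w : Temp d},
      HasDensity (𝓕 w) (divSym fun i => commSym j (fun x => v x i) θ f) →
      ∀ {p : ℝ≥0∞}, 2 ≤ p → distLpNorm p (block P 0 w) ≤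
        C * (eLpNorm v 2 volume * eLpNorm θ 2 volume) := by
  obtain ⟨ψ, hψ⟩ := exists_schwartz_sym P 0
  -- The `2` comes from `enorm_commSym_le`, the two norms of the symbol from
  -- `eLpNorm_fourierInv_le`.
  set c : Fin d → ℝ≥0∞ := fun i =>
    2 * ((∫⁻ ξ, ‖dsym i ψ ξ‖ₑ) + eLpNorm (dsym i ψ) 2 volume) with hc
  have hct : ∑ i, c i ≠ ⊤ := ENNReal.sum_ne_top.2 fun i _ =>
    ENNReal.mul_ne_top (by simp) (ENNReal.add_ne_top.2
      ⟨((dsym i ψ).integrable (μ := volume)).2.ne, ((dsym i ψ).memLp 2 volume).2.ne⟩)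
  refine ⟨(∑ i, c i).toNNReal, fun {v} hv2 {θ Θ f} h {w} hw {p} hp => ?_⟩
  rw [ENNReal.coe_toNNReal hct]
  have hW := fun i => h.memLp_commSym (memLp_coord hv2 i)
  rw [distLpNorm_block P 0 hw (integrable_sym_mul_divSym P 0 hW)]
  set N := eLpNorm v 2 volume * eLpNorm θ 2 volume with hN
  have hNt : 2 * N ≠ ⊤ := ENNReal.mul_ne_top (by simp)
    (ENNReal.mul_ne_top hv2.2.ne h.memLp_left.2.ne)
  have hWN : ∀ i ξ, ‖commSym j (fun x => v x i) θ f ξ‖ₑ ≤ 2 * N := fun i ξ => by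
    refine (h.enorm_commSym_le (memLp_coord hv2 i) ξ).trans ?_
    rw [hN]
    gcongr
    exact eLpNorm_coord_le v i 2
  have e : (𝓕⁻ fun ξ => (P.sym 0 ((2 * Real.pi) • ξ) : ℂ) *
      divSym (fun i => commSym j (fun x => v x i) θ f) ξ) =
      ∑ i, 𝓕⁻ fun ξ => dsym i ψ ξ * commSym j (fun x => v x i) θ f ξ := by
    ext x
    rw [Finset.sum_apply, ← fourierInv_sum_apply _ fun i => integrable_schwartz_mul_top _ (hW i)]
    refine congrArg (fun F : Space d → ℂ => 𝓕⁻ F x) (funext fun ξ => ?_)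
    rw [← hψ, divSym, Finset.mul_sum]
    refine Finset.sum_congr rfl fun i _ => ?_
    rw [dsym_apply]
    ring
  rw [e]
  refine (eLpNorm_sum_le (fun i _ => (continuous_fourierInv
    (integrable_schwartz_mul_top _ (hW i))).aestronglyMeasurable) (one_le_two.trans hp)).trans ?_
  rw [Finset.sum_mul]
  refine Finset.sum_le_sum fun i _ => ?_
  refine (eLpNorm_fourierInv_le (integrable_schwartz_mul_top _ (hW i))
    (memLp_two_schwartz_mul_top _ (hW i)) hp).trans ?_
  have h1 := eLpNorm_mul_le_of_enorm_le (dsym i ψ) hNt (hWN i) 1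
  have h2 := eLpNorm_mul_le_of_enorm_le (dsym i ψ) hNt (hWN i) 2
  rw [eLpNorm_one_eq_lintegral_enorm, eLpNorm_one_eq_lintegral_enorm] at h1
  refine (add_le_add h1 h2).trans (le_of_eq ?_)
  rw [hc]
  ring

/-- The estimate of the convection commutator in `B^0_{p,∞}`. -/
theorem exists_besovNorm_convection_le (hd : 0 < d) (j : Fin d) :
    ∃ C : ℝ≥0, ∀ {v : Space d → Space d}, ContDiff ℝ ∞ v → DivFree v → MemLp v 2 volume →
      ∀ {θ : Space d → ℝ} {Θ f : Space d → ℂ} (h : IsRieszData j θ Θ f), ∀ {w : Temp d},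
      HasDensity (𝓕 w) (divSym fun i => commSym j (fun x => v x i) θ f) →
      ∀ {p : ℝ≥0∞}, 2 ≤ p → besovNorm P 0 p ∞ w ≤
        C * (eLpNorm (fderiv ℝ v) p volume * besovNorm P 0 ∞ ∞ (ofL2 θ h.memLp_left) +
          eLpNorm v 2 volume * eLpNorm θ 2 volume) := by
  obtain ⟨C1, hC1⟩ := exists_distLpNorm_convection_high P hd j
  obtain ⟨C2, hC2⟩ := exists_distLpNorm_convection_low P j
  obtain ⟨C3, hC3⟩ := exists_amp_le_of_neg P
  refine ⟨C1 * (2 * C3 + 1) + C2, fun {v} hv hdiv hv2 {θ Θ f} h {w} hw {p} hp => ?_⟩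
  set B := besovNorm P 0 ∞ ∞ (ofL2 θ h.memLp_left) with hB
  have hblk : ∀ k, distLpNorm ∞ (block P k (ofL2 θ h.memLp_left)) ≤ B := fun k => by
    have := le_besovNorm_top P 0 ∞ (ofL2 θ h.memLp_left) k
    rwa [mul_zero, ENNReal.rpow_zero, one_mul] at this
  -- `2 * C3` accounts for `q < 0` through two inhomogeneous blocks; `1` accounts for `q ≥ 0`.
  have hamp : ⨆ q, amp P q Θ ≤ (2 * C3 + 1) * B := by
    refine iSup_le fun q => ?_
    rcases lt_or_ge q 0 with hq | hq
    · refine (hC3 h q hq).trans ?_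
      calc (C3 : ℝ≥0∞) * (_ + _) ≤ C3 * (B + B) := by gcongr <;> exact hblk _
        _ = 2 * C3 * B := by ring
        _ ≤ (2 * C3 + 1) * B := by gcongr; exact le_self_add
    · obtain ⟨n, rfl⟩ := Int.eq_ofNat_of_zero_le hq
      rw [← h.distLpNorm_block_succ]
      calc _ ≤ 1 * B := by rw [one_mul]; exact hblk _
        _ ≤ _ := by gcongr; exact le_add_self
  refine besovNorm_top_le P fun k => ?_
  rw [mul_zero, ENNReal.rpow_zero, one_mul]
  push_cast
  cases k with
  | zero =>
    refine (hC2 hv2 h hw hp).trans ?_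
    gcongr
    · exact le_add_self
    · exact le_add_self
  | succ k =>
    refine (hC1 hv hdiv hv2 h hw (one_le_two.trans hp) k).trans ?_
    calc (C1 : ℝ≥0∞) * (eLpNorm (fderiv ℝ v) p volume * ⨆ q, amp P q Θ)
        ≤ C1 * (eLpNorm (fderiv ℝ v) p volume * ((2 * C3 + 1) * B)) := by gcongr
      _ = C1 * (2 * C3 + 1) * (eLpNorm (fderiv ℝ v) p volume * B) := by ring
      _ ≤ _ := by
        gcongr
        · exact le_self_add
        · exact le_self_add

end Convection

/-! ### The product commutator -/

section Product

variable (P : DyadicPartition d)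

lemma eLpNorm_two_pow (f : Space d → ℂ) : eLpNorm f 2 volume ^ 2 = ∫⁻ x, ‖f x‖ₑ ^ 2 := by
  rw [eLpNorm_two_sq, ← ENNReal.rpow_natCast, ← ENNReal.rpow_mul]
  simp

lemma add_sq_le_four_mul (a b : ℝ≥0∞) : (a + b) ^ 2 ≤ 4 * (a ^ 2 + b ^ 2) := by
  have key : ∀ a b : ℝ≥0∞, a ≤ b → (a + b) ^ 2 ≤ 4 * (a ^ 2 + b ^ 2) := fun a b h => by
    calc (a + b) ^ 2 ≤ (b + b) ^ 2 := by gcongr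
      _ = 4 * b ^ 2 := by ring
      _ ≤ _ := by gcongr; exact le_add_self
  rcases le_total a b with h | h
  · exact key a b h
  · rw [add_comm a b, add_comm (a ^ 2)]
    exact key b a h

/-- The weight of `H^s` is controlled by the symbols of the dyadic blocks. -/
lemma exists_weight_le {s : ℝ} (hs : 0 ≤ s) : ∃ C : ℝ≥0, ∀ ξ : Space d, ∃ k : ℕ,
    ‖((((1 + ‖ξ‖ ^ 2) ^ (s / 2) : ℝ)) : ℂ)‖ₑ ≤
      C * (2 ^ (((k : ℝ) - 1) * s) * ‖(P.sym k ξ : ℂ)‖ₑ) := by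
  obtain ⟨M, hM1, hM⟩ := P.exists_norm_le_of_sym
  have hM0 : 0 ≤ M := zero_le_one.trans hM1
  -- The `3` compensates the lower bound `1/3` of `exists_sym_ge`.
  refine ⟨(3 * M ^ (s / 2)).toNNReal, fun ξ => ?_⟩
  obtain ⟨k, hk⟩ := P.exists_sym_ge ξ
  refine ⟨k, ?_⟩
  have h0 : (0 : ℝ) < P.sym k ξ := lt_of_lt_of_le (by norm_num) hk
  have h1 := hM k ξ h0.ne'
  have h2 : (1 + ‖ξ‖ ^ 2) ^ (s / 2) ≤
      3 * M ^ (s / 2) * ((2 : ℝ) ^ (((k : ℝ) - 1) * s) * P.sym k ξ) := by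
    calc (1 + ‖ξ‖ ^ 2) ^ (s / 2) ≤ (M * (2 : ℝ) ^ (2 * ((k : ℝ) - 1))) ^ (s / 2) := by gcongr
      _ = M ^ (s / 2) * (2 : ℝ) ^ (((k : ℝ) - 1) * s) := by
        rw [Real.mul_rpow hM0 (by positivity), ← Real.rpow_mul zero_le_two]
        congr 2
        ring
      _ = 3 * M ^ (s / 2) * ((2 : ℝ) ^ (((k : ℝ) - 1) * s) * (1 / 3)) := by ring
      _ ≤ _ := by gcongr
  have e1 : ∀ t : ℝ, 0 ≤ t → ‖((t : ℝ) : ℂ)‖ₑ = ENNReal.ofReal t := fun t ht => by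
    rw [← ofReal_norm, Complex.norm_real, Real.norm_of_nonneg ht]
  have e2 : (2 : ℝ≥0∞) ^ (((k : ℝ) - 1) * s) = ENNReal.ofReal ((2 : ℝ) ^ (((k : ℝ) - 1) * s)) := by
    rw [← ENNReal.ofReal_rpow_of_pos two_pos]
    simp
  rw [e1 _ (by positivity), e1 _ h0.le, e2, ← ENNReal.ofReal_mul (by positivity)]
  change _ ≤ ENNReal.ofReal (3 * M ^ (s / 2)) * _
  rw [← ENNReal.ofReal_mul (by positivity)]
  exact ENNReal.ofReal_le_ofReal h2

/-- The `H^s` norm is controlled by the dyadic blocks. -/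
theorem exists_lintegral_weight_le {s : ℝ} (hs : 0 ≤ s) : ∃ C : ℝ≥0, ∀ W : Space d → ℂ,
    AEStronglyMeasurable W volume →
    eLpNorm (fun ξ => (((1 + ‖(2 * Real.pi) • ξ‖ ^ 2) ^ (s / 2) : ℝ) : ℂ) * W ξ) 2 volume ^ 2 ≤
      C * ∑' k : ℕ, (2 ^ (((k : ℝ) - 1) * s) *
        eLpNorm (fun ξ => (P.sym k ((2 * Real.pi) • ξ) : ℂ) * W ξ) 2 volume) ^ 2 := by
  obtain ⟨C, hC⟩ := exists_weight_le P hs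
  refine ⟨C ^ 2, fun W hW => ?_⟩
  have hm : ∀ k : ℕ, AEMeasurable (fun ξ : Space d => (2 ^ (((k : ℝ) - 1) * s)) ^ 2 *
      ‖(P.sym k ((2 * Real.pi) • ξ) : ℂ) * W ξ‖ₑ ^ 2) volume := fun k => by
    have h1 : Continuous fun ξ : Space d => (P.sym k ((2 * Real.pi) • ξ) : ℂ) :=
      Complex.continuous_ofReal.comp ((contDiff_sym P k).continuous.comp (by fun_prop))
    exact ((h1.aestronglyMeasurable.mul hW).enorm.pow_const 2).const_mul _
  have hpt : ∀ ξ : Space d, ‖(((1 + ‖(2 * Real.pi) • ξ‖ ^ 2) ^ (s / 2) : ℝ) : ℂ) * W ξ‖ₑ ^ 2 ≤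
      (C : ℝ≥0∞) ^ 2 * ∑' k : ℕ, (2 ^ (((k : ℝ) - 1) * s)) ^ 2 *
        ‖(P.sym k ((2 * Real.pi) • ξ) : ℂ) * W ξ‖ₑ ^ 2 := by
    intro ξ
    obtain ⟨k, hk⟩ := hC ((2 * Real.pi) • ξ)
    -- At each `ξ` a single block dominates the weight; the full sum makes the bound independent of
    -- which one.
    refine le_trans ?_ (mul_le_mul_right (ENNReal.le_tsum k) _)
    rw [← mul_pow, ← mul_pow]
    refine pow_le_pow_left₀ zero_le ?_ 2
    rw [enorm_mul, enorm_mul, ← mul_assoc, ← mul_assoc, mul_assoc (C : ℝ≥0∞)]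
    exact mul_le_mul_left hk _
  rw [eLpNorm_two_pow]
  refine (lintegral_mono hpt).trans (le_of_eq ?_)
  rw [lintegral_const_mul'' _ (AEMeasurable.tsum hm), lintegral_tsum hm]
  push_cast
  congr 2
  ext k
  rw [lintegral_const_mul' _ _ (ENNReal.pow_ne_top (two_rpow_ne_top _)), mul_pow, eLpNorm_two_pow]

lemma hasTemperateGrowth_weight (s : ℝ) :
    (fun ξ : Space d => (((1 + ‖(2 * Real.pi) • ξ‖ ^ 2) ^ (s / 2) : ℝ) : ℂ)).HasTemperateGrowth := by
  have h : (fun ξ : Space d => (2 * Real.pi) • ξ).HasTemperateGrowth := by fun_prop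
  have h2 : (fun ξ : Space d => (((1 + ‖ξ‖ ^ 2) ^ (s / 2) : ℝ) : ℂ)).HasTemperateGrowth := by
    fun_prop
  exact h2.comp h

/-- The `H^s` norm in terms of the Fourier transform. -/
lemma sobolevNorm_le {s : ℝ} {w : Temp d} {W : Space d → ℂ} (hw : HasDensity (𝓕 w) W)
    (hW : AEStronglyMeasurable W volume) : sobolevNorm s w ≤
      eLpNorm (fun ξ => (((1 + ‖(2 * Real.pi) • ξ‖ ^ 2) ^ (s / 2) : ℝ) : ℂ) * W ξ) 2 volume := by
  set F : Space d → ℂ := fun ξ => (((1 + ‖(2 * Real.pi) • ξ‖ ^ 2) ^ (s / 2) : ℝ) : ℂ) * W ξ with hF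
  rcases eq_or_ne (eLpNorm F 2 volume) ⊤ with h | h
  · rw [h]; exact le_top
  · have hm : AEStronglyMeasurable F volume :=
      (hasTemperateGrowth_weight s).1.continuous.aestronglyMeasurable.mul hW
    have hF2 : MemLp F 2 volume := ⟨hm, h.lt_top⟩
    have hp := isFourierPair_Lp (𝓕⁻ (hF2.toLp F))
    rw [FourierTransform.fourier_fourierInv_eq] at hp
    have hp' := hp.congr (ae_eq_refl _) hF2.coeFn_toLp
    have hl := (Lp.memLp (𝓕⁻ (hF2.toLp F))).locallyIntegrable one_le_two
    rw [sobolevNorm, distLpNorm_multiplier hw (hasTemperateGrowth_weight s) hp' hl 2,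
      hp'.eLpNorm_eq hl hF2]

/-- The estimate of the product commutator at a nonnegative frequency. -/
theorem exists_eLpNorm_commSym_le (hd : 0 < d) (j : Fin d) {s : ℝ} (hs0 : 0 < s) (hs1 : s < 1) :
    ∃ C : ℝ≥0, ∀ {a : Space d → ℝ}, ContDiff ℝ ∞ a → MemLp a 2 volume →
      ∀ {θ : Space d → ℝ} {Θ f : Space d → ℂ}, IsRieszData j θ Θ f →
      ∀ B : ℝ≥0∞, (∀ q : ℤ, q < 0 → amp P q Θ ≤ B) → ∀ k : ℕ,
      2 ^ ((k : ℝ) * s) * eLpNorm (fun ξ => (P.sym (k + 1) ((2 * Real.pi) • ξ) : ℂ) *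
          commSym j a θ f ξ) 2 volume ≤
        C * (eLpNorm (fderiv ℝ a) 2 volume *
            ∑' q : ℤ, 2 ^ (-(min s (1 - s) * |((k : ℤ) : ℝ) - q|)) * wamp P s Θ q +
          2 ^ (-((1 - s) / 2 * k)) * (eLpNorm (fderiv ℝ a) 2 volume * B +
            eLpNorm a 2 volume * eLpNorm θ 2 volume)) := by
  obtain ⟨ψ, hψ⟩ := exists_ringSym P (isHomSymbol_one (d := d))
  obtain ⟨ψ', hψ'⟩ := exists_ringSym P (isHomSymbol_riesz j)
  obtain ⟨C1, hC1⟩ := exists_eLpNorm_bil_le P hd isHomSymbol_one ψ' hs0 hs1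
  obtain ⟨C2, hC2⟩ := exists_eLpNorm_bil_le P hd (isHomSymbol_riesz j) ψ hs0 hs1
  refine ⟨C1 + C2, fun {a} hac ha {θ Θ f} h B hB k => ?_⟩
  have hW := h.memLp_commSym ha
  have hθ : MemLp (fun x => (θ x : ℂ)) 2 volume := h.memLp_left.ofReal
  have e : (fun ξ => (P.sym (k + 1) ((2 * Real.pi) • ξ) : ℂ) * commSym j a θ f ξ) =
      fun ξ => dil k ψ ξ * commSym j a θ f ξ := by
    ext ξ
    rw [dil_apply, hψ, one_mul, sym_succ, ringSym, smul_comm (2 * Real.pi)]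
  have e2 : (𝓕⁻ fun ξ => dil k ψ ξ * commSym j a θ f ξ) =
      bil (ker k ψ') a (fun y => (θ y : ℂ)) - bil (ker k ψ) a f := by
    ext x
    exact h.fourierInv_dil_commSym ha k (fun ξ => by rw [hψ, hψ', one_mul]) x
  rw [e, ← eLpNorm_fourierInv (integrable_schwartz_mul_top _ hW)
    (memLp_two_schwartz_mul_top _ hW), e2]
  refine (mul_le_mul_right (eLpNorm_sub_le
    (measurable_bil (ker k ψ').continuous hac.continuous hθ.1)
    (measurable_bil (ker k ψ).continuous hac.continuous h.memLp_riesz.1) one_le_two) _).trans ?_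
  rw [mul_add, ENNReal.coe_add, add_mul, ← h.eLpNorm_fourier]
  refine add_le_add (hC1 k hac ha hθ h.memLp_fourier ?_ B hB)
    (hC2 k hac ha h.memLp_riesz h.memLp_fourier h.pair_riesz B hB)
  simpa using h.pair

/-- The blocks of `θ` from `Δ_0` on are exactly those weighted by `wamp`; the right side contains
`Δ_{-1}` in addition. -/
lemma IsRieszData.tsum_wamp_sq_le {j : Fin d} {θ : Space d → ℝ} {Θ f : Space d → ℂ}
    (h : IsRieszData j θ Θ f) (s : ℝ) :
    ∑' q : ℤ, wamp P s Θ q ^ 2 ≤ besovNorm P (s - 1) ∞ 2 (ofL2 θ h.memLp_left) ^ 2 := by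
  have h1 := HasSum.of_nat_of_neg_add_one (f := fun q : ℤ => wamp P s Θ q ^ 2)
    ENNReal.summable.hasSum ENNReal.summable.hasSum
  have h2 : ∀ n : ℕ, wamp P s Θ (-((n : ℤ) + 1)) ^ 2 = 0 := fun n => by
    rw [wamp, if_neg (by omega)]
    simp
  rw [h1.tsum_eq]
  simp_rw [h2]
  rw [tsum_zero, add_zero, ← tsum_sq_eq_besovNorm_sq]
  refine le_trans (le_trans (ENNReal.tsum_le_tsum fun n => ?_) le_add_self)
    (tsum_eq_zero_add' ENNReal.summable).ge
  rw [h.distLpNorm_block_succ, wamp, if_pos (by omega)]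
  push_cast
  rw [add_sub_cancel_right]

/-- The estimate of the product commutator in `H^s`. -/
theorem exists_sobolevNorm_product_le (hd : 0 < d) (j : Fin d) {s : ℝ} (hs0 : 0 < s)
    (hs1 : s < 1) :
    ∃ C : ℝ≥0, ∀ {a : Space d → ℝ}, ContDiff ℝ ∞ a → MemLp a 2 volume →
      ∀ {θ : Space d → ℝ} {Θ f : Space d → ℂ} (h : IsRieszData j θ Θ f), ∀ {w : Temp d},
      HasDensity (𝓕 w) (commSym j a θ f) → sobolevNorm s w ≤
        C * (eLpNorm (fderiv ℝ a) 2 volume * besovNorm P (s - 1) ∞ 2 (ofL2 θ h.memLp_left) +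
          eLpNorm a 2 volume * eLpNorm θ 2 volume) := by
  obtain ⟨C0, hC0⟩ := exists_lintegral_weight_le P hs0.le
  obtain ⟨C1, hC1⟩ := exists_eLpNorm_commSym_le P hd j hs0 hs1
  obtain ⟨C3, hC3⟩ := exists_amp_le_of_neg P
  obtain ⟨ψ, hψ⟩ := exists_schwartz_sym P 0
  set σ := min s (1 - s) with hσ
  have hσ0 : 0 < σ := lt_min hs0 (by linarith)
  set E := ∑' n : ℕ, (2 : ℝ≥0∞) ^ (-((1 - s) * n)) with hE
  -- The first square bounds the block `Δ_{-1}`. In the rest, `4` comes from squaring a sum, `geoSum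
  -- σ ^ 2` from Young's inequality, and `E` from summing the decay in `k` of the low-frequency
  -- contributions.
  set K : ℝ≥0∞ := C0 * ((2 * eLpNorm ψ 2 volume) ^ 2 +
    C1 ^ 2 * (4 * (geoSum σ ^ 2 + (2 * C3 + 1) ^ 2 * E))) with hK
  have hKt : K ≠ ⊤ := by
    have h1 : eLpNorm ψ 2 volume ≠ ⊤ := (ψ.memLp 2 volume).2.ne
    have h2 := geoSum_ne_top hσ0
    have h3 : E ≠ ⊤ := tsum_nat_two_rpow_ne_top (by linarith)
    simp [hK, ENNReal.mul_eq_top, h1, h2, h3]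
  refine ⟨(K ^ (1 / 2 : ℝ)).toNNReal, fun {a} hac ha {θ Θ f} h {w} hw => ?_⟩
  rw [ENNReal.coe_toNNReal (ENNReal.rpow_ne_top_of_nonneg (by norm_num) hKt)]
  set G := eLpNorm (fderiv ℝ a) 2 volume with hG
  set B := besovNorm P (s - 1) ∞ 2 (ofL2 θ h.memLp_left) with hB
  set Z := eLpNorm a 2 volume * eLpNorm θ 2 volume with hZ
  have hZt : 2 * Z ≠ ⊤ := ENNReal.mul_ne_top (by simp)
    (ENNReal.mul_ne_top ha.2.ne h.memLp_left.2.ne)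
  have hW := h.memLp_commSym ha
  refine (sobolevNorm_le hw hW.1).trans ?_
  have hlow : ∀ q : ℤ, q < 0 → amp P q Θ ≤ 2 * C3 * B := by
    intro q hq
    refine (hC3 h q hq).trans ?_
    -- `Δ_{-1}` carries the weight `2^{-(s-1)} ≥ 1`, and `Δ_0` the weight `1`, so neither loses
    -- anything against `B`.
    have b0 : distLpNorm ∞ (block P 0 (ofL2 θ h.memLp_left)) ≤ B := by
      have h1 := le_besovNorm_two P (s - 1) ∞ (ofL2 θ h.memLp_left) 0
      refine le_trans ?_ h1
      refine le_mul_of_one_le_left zero_le ?_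
      rw [← ENNReal.rpow_zero (x := 2)]
      apply two_rpow_mono
      push_cast
      linarith
    have b1 : distLpNorm ∞ (block P 1 (ofL2 θ h.memLp_left)) ≤ B := by
      have h1 := le_besovNorm_two P (s - 1) ∞ (ofL2 θ h.memLp_left) 1
      simpa using h1
    calc (C3 : ℝ≥0∞) * (_ + _) ≤ C3 * (B + B) := by gcongr
      _ = _ := by ring
  set V : ℤ → ℝ≥0∞ := fun k => ∑' q : ℤ, 2 ^ (-(σ * |(k : ℝ) - q|)) * wamp P s Θ q with hV
  have hVsum : ∑' k : ℤ, V k ^ 2 ≤ geoSum σ ^ 2 * B ^ 2 :=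
    (tsum_sq_conv_le σ _).trans (mul_le_mul_right (h.tsum_wamp_sq_le P s) _)
  have hVnat : ∑' k : ℕ, V k ^ 2 ≤ geoSum σ ^ 2 * B ^ 2 :=
    le_trans (ENNReal.tsum_comp_le_tsum_of_injective Nat.cast_injective fun k => V k ^ 2) hVsum
  have hzero : 2 ^ ((((0 : ℕ) : ℝ) - 1) * s) * eLpNorm (fun ξ =>
      (P.sym 0 ((2 * Real.pi) • ξ) : ℂ) * commSym j a θ f ξ) 2 volume ≤
      2 * eLpNorm ψ 2 volume * (G * B + Z) := by
    have h1 : (2 : ℝ≥0∞) ^ ((((0 : ℕ) : ℝ) - 1) * s) ≤ 1 := by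
      rw [← ENNReal.rpow_zero (x := 2)]
      apply two_rpow_mono
      push_cast
      linarith
    simp_rw [← hψ]
    calc _ ≤ 1 * (2 * Z * eLpNorm ψ 2 volume) :=
          mul_le_mul' h1 (eLpNorm_mul_le_of_enorm_le ψ hZt (h.enorm_commSym_le ha) 2)
      _ = 2 * eLpNorm ψ 2 volume * Z := by ring
      _ ≤ _ := by gcongr; exact le_add_self
  have hsucc : ∀ k : ℕ, (2 ^ ((((k + 1 : ℕ) : ℝ) - 1) * s) * eLpNorm (fun ξ =>
      (P.sym (k + 1) ((2 * Real.pi) • ξ) : ℂ) * commSym j a θ f ξ) 2 volume) ^ 2 ≤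
      C1 ^ 2 * (4 * (G ^ 2 * V k ^ 2 +
        2 ^ (-((1 - s) * k)) * ((2 * C3 + 1) * (G * B + Z)) ^ 2)) := by
    intro k
    have h1 := hC1 hac ha h (2 * C3 * B) hlow k
    have h2 : G * (2 * C3 * B) + Z ≤ (2 * C3 + 1) * (G * B + Z) := by
      calc G * (2 * C3 * B) + Z = 2 * C3 * (G * B) + 1 * Z := by ring
        _ ≤ (2 * C3 + 1) * (G * B) + (2 * C3 + 1) * Z := by
          gcongr
          · exact le_self_add
          · exact le_add_self
        _ = _ := by ring
    push_cast
    rw [add_sub_cancel_right]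
    refine (pow_le_pow_left₀ zero_le h1 2).trans ?_
    rw [mul_pow]
    gcongr
    refine (add_sq_le_four_mul _ _).trans ?_
    rw [mul_pow, mul_pow]
    have h3 : ((2 : ℝ≥0∞) ^ (-((1 - s) / 2 * k))) ^ 2 = 2 ^ (-((1 - s) * k)) := by
      rw [← ENNReal.rpow_natCast, ← ENNReal.rpow_mul]
      congr 1
      push_cast
      ring
    rw [h3]
    gcongr
  have htot : eLpNorm (fun ξ => (((1 + ‖(2 * Real.pi) • ξ‖ ^ 2) ^ (s / 2) : ℝ) : ℂ) *
      commSym j a θ f ξ) 2 volume ^ 2 ≤ K * (G * B + Z) ^ 2 := by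
    refine (hC0 _ hW.1).trans ?_
    rw [hK, mul_assoc]
    gcongr
    rw [tsum_eq_zero_add' ENNReal.summable, add_mul]
    refine add_le_add ?_ ?_
    · rw [← mul_pow]
      exact pow_le_pow_left₀ zero_le hzero 2
    · refine (ENNReal.tsum_le_tsum hsucc).trans ?_
      rw [ENNReal.tsum_mul_left, ENNReal.tsum_mul_left, ENNReal.tsum_add, ENNReal.tsum_mul_left,
        ENNReal.tsum_mul_right, ← hE]
      calc (C1 : ℝ≥0∞) ^ 2 * (4 * (G ^ 2 * ∑' k : ℕ, V k ^ 2 +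
            E * ((2 * C3 + 1) * (G * B + Z)) ^ 2))
          ≤ C1 ^ 2 * (4 * (G ^ 2 * (geoSum σ ^ 2 * B ^ 2) +
            E * ((2 * C3 + 1) * (G * B + Z)) ^ 2)) := by gcongr
        _ = C1 ^ 2 * (4 * (geoSum σ ^ 2 * (G * B) ^ 2 +
            E * ((2 * C3 + 1) * (G * B + Z)) ^ 2)) := by ring
        _ ≤ C1 ^ 2 * (4 * (geoSum σ ^ 2 * (G * B + Z) ^ 2 +
            E * ((2 * C3 + 1) * (G * B + Z)) ^ 2)) := by gcongr; exact le_self_add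
        _ = _ := by ring
  have hfin := ENNReal.rpow_le_rpow htot (by norm_num : (0 : ℝ) ≤ 1 / 2)
  rw [ENNReal.mul_rpow_of_nonneg _ _ (by norm_num), ← ENNReal.rpow_natCast,
    ← ENNReal.rpow_natCast, ← ENNReal.rpow_mul, ← ENNReal.rpow_mul] at hfin
  simpa using hfin

/-- The estimate of the vector-valued product commutator in `H^s`. -/
theorem exists_vectorSobolevNorm_product_le (hd : 0 < d) (j : Fin d) {s : ℝ} (hs0 : 0 < s)
    (hs1 : s < 1) :
    ∃ C : ℝ≥0, ∀ {v : Space d → Space d}, ContDiff ℝ ∞ v → MemLp v 2 volume →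
      ∀ {θ : Space d → ℝ} {Θ f : Space d → ℂ} (h : IsRieszData j θ Θ f), ∀ {w : Fin d → Temp d},
      (∀ i, HasDensity (𝓕 (w i)) (commSym j (fun x => v x i) θ f)) → vectorSobolevNorm s w ≤
        C * (eLpNorm (fderiv ℝ v) 2 volume * besovNorm P (s - 1) ∞ 2 (ofL2 θ h.memLp_left) +
          eLpNorm v 2 volume * eLpNorm θ 2 volume) := by
  obtain ⟨C, hC⟩ := exists_sobolevNorm_product_le P hd j hs0 hs1
  -- The Euclidean sum of `d` equal bounds costs `√d ≤ d`.
  refine ⟨d * C, fun {v} hv hv2 {θ Θ f} h {w} hw => ?_⟩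
  set X := eLpNorm (fderiv ℝ v) 2 volume * besovNorm P (s - 1) ∞ 2 (ofL2 θ h.memLp_left) +
    eLpNorm v 2 volume * eLpNorm θ 2 volume with hX
  have h1 : ∀ i, sobolevNorm s (w i) ≤ C * X := fun i => by
    refine (hC (contDiff_coord hv i) (memLp_coord hv2 i) h (hw i)).trans ?_
    rw [hX]
    gcongr
    · exact eLpNorm_fderiv_coord_le hv i 2
    · exact eLpNorm_coord_le v i 2
  have h2 : ∑ i, sobolevNorm s (w i) ^ 2 ≤ (d * C * X) ^ 2 := by
    calc ∑ i, sobolevNorm s (w i) ^ 2 ≤ ∑ _i : Fin d, (C * X) ^ 2 :=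
          Finset.sum_le_sum fun i _ => pow_le_pow_left₀ zero_le (h1 i) 2
      _ = (d : ℝ≥0∞) * (C * X) ^ 2 := by simp
      _ ≤ (d : ℝ≥0∞) ^ 2 * (C * X) ^ 2 := by
          gcongr
          exact le_self_pow (by exact_mod_cast hd) two_ne_zero
      _ = _ := by ring
  have h3 := ENNReal.rpow_le_rpow h2 (by norm_num : (0 : ℝ) ≤ 1 / 2)
  rw [← ENNReal.rpow_natCast, ← ENNReal.rpow_mul] at h3
  rw [vectorSobolevNorm]
  refine h3.trans (le_of_eq ?_)
  push_cast
  norm_num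

end Product

end RieszCommutator

end

open RieszCommutator in
/-- Commutator estimates for the Riesz transform `R = ∂₁ / |D|` and a smooth divergence-free vector
field `v` on `ℝ^d`, `d ≥ 2`. The commutators exist as tempered distributions, and they satisfy the
two estimates; the right-hand sides are allowed to be infinite. -/
theorem theorem3p1 (d : ℕ) (hd : 2 ≤ d) (P : DyadicPartition d) :
    (∀ s : ℝ, 0 < s → s < 1 → ∃ C : ℝ≥0,
      ∀ (v : Space d → Space d) (θ : Space d → ℝ),
        ContDiff ℝ ∞ v → DivFree v → MemLp v 2 volume →
        ContDiff ℝ ∞ θ → ∀ hθ : MemLp θ 2 volume,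
          (∃ w : Fin d → Temp d,
            ∀ i, IsCommProduct ⟨0, by omega⟩ (fun x => v x i) (ofL2 θ hθ) (w i)) ∧
          ∀ w : Fin d → Temp d,
            (∀ i, IsCommProduct ⟨0, by omega⟩ (fun x => v x i) (ofL2 θ hθ) (w i)) →
              vectorSobolevNorm s w ≤
                C * (eLpNorm (fderiv ℝ v) 2 volume * besovNorm P (s - 1) ∞ 2 (ofL2 θ hθ) +
                  eLpNorm v 2 volume * eLpNorm θ 2 volume)) ∧
    (∀ p : ℝ≥0∞, 2 ≤ p → ∃ C : ℝ≥0,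
      ∀ (v : Space d → Space d) (θ : Space d → ℝ),
        ContDiff ℝ ∞ v → DivFree v → MemLp v 2 volume →
        ContDiff ℝ ∞ θ → ∀ hθ : MemLp θ 2 volume,
          (∃ w : Temp d, IsCommConvection ⟨0, by omega⟩ v (ofL2 θ hθ) w) ∧
          ∀ w : Temp d, IsCommConvection ⟨0, by omega⟩ v (ofL2 θ hθ) w →
            besovNorm P 0 p ∞ w ≤
              C * (eLpNorm (fderiv ℝ v) p volume * besovNorm P 0 ∞ ∞ (ofL2 θ hθ) +
                eLpNorm v 2 volume * eLpNorm θ 2 volume)) := by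
  have hd0 : 0 < d := by omega
  refine ⟨fun s hs0 hs1 => ?_, fun p hp => ?_⟩
  · obtain ⟨C, hC⟩ := exists_vectorSobolevNorm_product_le P hd0 ⟨0, hd0⟩ hs0 hs1
    refine ⟨C, fun v θ hv _ hv2 _ hθ => ?_⟩
    obtain ⟨Θ, f, h⟩ := exists_isRieszData ⟨0, hd0⟩ hθ
    refine ⟨?_, fun w hw => ?_⟩
    · choose w hw using fun i => h.exists_isCommProduct (contDiff_coord hv i) (memLp_coord hv2 i)
      exact ⟨w, hw⟩
    · exact hC hv hv2 h fun i => h.hasDensity_of_isCommProduct (memLp_coord hv2 i) (hw i)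
  · obtain ⟨C, hC⟩ := exists_besovNorm_convection_le P hd0 ⟨0, hd0⟩
    refine ⟨C, fun v θ hv hdiv hv2 _ hθ => ?_⟩
    obtain ⟨Θ, f, h⟩ := exists_isRieszData ⟨0, hd0⟩ hθ
    exact ⟨h.exists_isCommConvection hv hdiv hv2, fun w hw =>
      hC hv hdiv hv2 h (h.hasDensity_of_isCommConvection hv hdiv hv2 hw) hp⟩
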